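/- Let $\mathbf T=\mathbf R/2\pi\mathbf Z$ carry the measure $d\theta/2\pi$, and for $u\in L^2(\mathbf T;\mathbf C)$ let $\hat u(k)=\int_{\mathbf T}u(\theta)e^{-ik\theta}\,d\theta/2\pi$. For $N>0$ let $$\Omega_N=\Bigl\{u\in L^2(\mathbf T;\mathbf C):\int_{\mathbf T}|u|^2\,\frac{d\theta}{2\pi}\le N\Bigr\}.$$ For $s\in\mathbf R$ put $\Vert u\Vert_{H^s}^2=|\hat u(0)|^2+\sum_{k\ne0}|k|^{2s}|\hat u(k)|^2\in[0,\infty]$. Let $\mu$ be the law on $L^2(\mathbf T;\mathbf C)$ of Brownian loop $\sum_{j\neq 0}e^{ij\theta}(\gamma_j+i\gamma_j')/j$, where $\gamma_j,\gamma'_j$ are mutually independent standard Gaussian random variables. Let $\lambda\in\mathbf R$ and let $$\nu(du)=Z(N,\lambda)^{-1}\,\mathbf I_{\Omega_N}(u)\exp\Bigl(\frac{\lambda}{4}\int_{\mathbf T}|u(\theta)|^4\frac{d\theta}{2\pi}\Bigr)\mu(du),$$ where $Z(N,\lambda)$ is the total mass of the unnormalized measure, be the Gibbs measure of the focussing cubic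 nonlinear Schrödinger equation. Suppose that $N>0$ and $0\le\lambda N<3/(14\pi^2)$, and let $\alpha=1-14\pi^2N\lambda/3$. Then $\nu$ is a probability measure ($0<Z(N,\lambda)<\infty$) and satisfies the logarithmic Sobolev inequality $$\int_{\Omega_N}F^2\log\Bigl(F^2\Big/\int F^2\,d\nu\Bigr)\,d\nu\le\frac{2}{\alpha}\int_{\Omega_N}\Vert\nabla F\Vert_{H^{-1}}^2\,d\nu ,$$ where the integral on the left converges, in each of the following two cases. (i) $F:\Omega_N\to\mathbf R$ is continuously differentiable, with $F$ and $\Vert\nabla F\Vert_{H^{-1}}$ in $L^2(\nu)$; here $\nabla F(u)\in L^2(\mathbf T;\mathbf C)$ is the gradient for the real inner product $\Re\int u\bar v\,d\theta/2\pi$. (ii) $F:\Omega_N\to\mathbf R$ is locally Lipschitz for the $L^2$ norm, with $F$ and $\Vert\nabla F\Vert_{H^{-1}}$ in $L^2(\nu)$; here $\Vert\nabla F\Vert_{H^{-1}}$ is interpreted as the metric norm of the gradient for the $H^1$ distance, $$\limsup_{v\in\Omega_N,\ v\ne u,\ \Vert v-u\Vert_{H^1}\to0}\ \frac{|F(v)-F(u)|}{\Vert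 v-u\Vert_{H^1}} .$$ -/

import Mathlib

open MeasureTheory ProbabilityTheory Filter Topology
open scoped ENNReal

noncomputable section

namespace NLSGibbs

instance fact_two_pi_pos : Fact (0 < 2 * Real.pi) := ⟨Real.two_pi_pos⟩

/-- The circle `𝕋 = ℝ / 2πℤ`. -/
abbrev Circ : Type := AddCircle (2 * Real.pi)

/-- Normalized arc length `dθ / 2π` on the circle. -/
abbrev arc : Measure Circ := AddCircle.haarAddCircle

/-- The complex Hilbert space `L²(𝕋; ℂ)` for `dθ / 2π`. It is also a real Hilbert space for
`Re ∫ u \bar v dθ / 2π`; derivatives and gradients below are the real ones. -/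
abbrev LTwo : Type := Lp ℂ 2 arc

instance : MeasurableSpace LTwo := borel LTwo

instance : BorelSpace LTwo := ⟨rfl⟩

/-- The ball `Ω_N = {u ∈ L² : ∫ |u|² dθ/2π ≤ N}`. -/
def Ball (N : ℝ) : Set LTwo := {u | ∫ θ, ‖u θ‖ ^ 2 ∂arc ≤ N}

/-! ### Brownian loop and the Gibbs measure -/

/-- The law of mutually independent standard Gaussian variables `(γ_j, γ'_j)`, `j ∈ ℤ`. -/
def gaussianLaw : Measure (ℤ → ℝ × ℝ) :=
  Measure.infinitePi fun _ : ℤ => (gaussianReal 0 1).prod (gaussianReal 0 1)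

/-- The Fourier coefficient `(γ_j + i γ'_j) / j` for `j ≠ 0`, and `0` for `j = 0`. -/
def loopCoeff (γ : ℤ → ℝ × ℝ) (j : ℤ) : ℂ :=
  if j = 0 then 0 else (((γ j).1 : ℂ) + Complex.I * ((γ j).2 : ℂ)) / (j : ℂ)

/-- Brownian loop `∑_{j ≠ 0} e^{ijθ} (γ_j + i γ'_j) / j`, as an element of `L²`. The series converges
in `L²` exactly when the coefficients are square summable, which is almost surely the case. -/
def brownianLoop (γ : ℤ → ℝ × ℝ) : LTwo :=
  ∑' j : ℤ, loopCoeff γ j • (fourierLp 2 j : LTwo)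

lemma continuous_loopCoeff (j : ℤ) : Continuous fun γ : ℤ → ℝ × ℝ => loopCoeff γ j := by
  unfold loopCoeff
  split_ifs
  · exact continuous_const
  · fun_prop

lemma summable_loop_iff (γ : ℤ → ℝ × ℝ) :
    (Summable fun j : ℤ => loopCoeff γ j • (fourierLp 2 j : LTwo)) ↔
      Summable fun j : ℤ => ‖loopCoeff γ j‖ ^ 2 := by
  have h := (orthonormal_fourier (T := 2 * Real.pi)).orthogonalFamily.summable_iff_norm_sq_summable
    (fun j => loopCoeff γ j)
  simpa [LinearIsometry.toSpanSingleton_apply] using h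

lemma measurable_brownianLoop : Measurable brownianLoop := by
  classical
  set S : Set (ℤ → ℝ × ℝ) := {γ | Summable fun j : ℤ => ‖loopCoeff γ j‖ ^ 2} with hS
  have hSm : MeasurableSet S := by
    have : S = {γ | ∑' j : ℤ, (‖loopCoeff γ j‖ₑ ^ 2 : ℝ≥0∞) ≠ ∞} := by
      ext γ
      have h0 : ∀ j : ℤ, (‖loopCoeff γ j‖ₑ ^ 2 : ℝ≥0∞) = ((‖loopCoeff γ j‖₊ ^ 2 : NNReal) : ℝ≥0∞) :=
        fun j => by simp [enorm_eq_nnnorm]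
      simp only [hS, Set.mem_ofPred_eq, h0, ENNReal.tsum_coe_ne_top_iff_summable]
      rw [← NNReal.summable_coe]
      simp
    rw [this]
    refine (measurableSet_singleton (∞ : ℝ≥0∞)).compl.preimage ?_
    exact Measurable.tsum fun j => (continuous_loopCoeff j).measurable.enorm.pow_const 2
  have hlim : ∀ γ, Tendsto (fun n : ℕ => S.indicator
      (fun γ => ∑ j ∈ Finset.Icc (-(n : ℤ)) n, loopCoeff γ j • (fourierLp 2 j : LTwo)) γ) atTop
      (𝓝 (brownianLoop γ)) := by
    intro γ
    by_cases hγ : γ ∈ S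
    · have hs := ((summable_loop_iff γ).2 hγ).hasSum
      simp only [Set.indicator_of_mem hγ]
      exact hs.comp Finset.tendsto_Icc_neg
    · have h0 : brownianLoop γ = 0 :=
        tsum_eq_zero_of_not_summable fun h => hγ ((summable_loop_iff γ).1 h)
      simp only [Set.indicator_of_notMem hγ, h0]
      exact tendsto_const_nhds
  refine measurable_of_tendsto_metrizable (fun n => ?_) (tendsto_pi_nhds.2 hlim)
  refine Measurable.indicator ?_ hSm
  exact (continuous_finsetSum _ fun j _ =>
    (continuous_loopCoeff j).smul continuous_const).measurable

/-- The measure induced on `L²` by Brownian loop: under it the Fourier coefficients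
`a_j + i b_j`, `j ≠ 0`, have independent parts with density `∝ exp(-j² a² / 2)`, and
`a_0 + i b_0 = 0`. -/
def loopMeasure : Measure LTwo := gaussianLaw.map brownianLoop

/-- The weight `exp((λ/4) ∫ |u|⁴ dθ/2π)`; `u ∈ L⁴` for almost every `u` for `loopMeasure`. -/
def weight (lam : ℝ) (u : LTwo) : ℝ≥0∞ :=
  ENNReal.ofReal (Real.exp (lam / 4 * ∫ θ, ‖u θ‖ ^ 4 ∂arc))

/-- The normalizing constant `Z(N, λ)`. -/
def partitionFunction (N lam : ℝ) : ℝ≥0∞ := ∫⁻ u in Ball N, weight lam u ∂loopMeasure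

/-- The Gibbs measure `Z(N, λ)⁻¹ 1_{Ω_N}(u) exp((λ/4) ∫ |u|⁴) loopMeasure(du)` of the cubic
focussing NLS. -/
def gibbs (N lam : ℝ) : Measure LTwo :=
  (partitionFunction N lam)⁻¹ • (loopMeasure.restrict (Ball N)).withDensity (weight lam)

/-! ### Sobolev norms and gradients -/

/-- The norm of `H^s(𝕋; ℂ)`, with square `|a_0|² + ∑_{k ≠ 0} |k|^{2s} |a_k|²` where `a_k` are the
Fourier coefficients of `u`; it is `∞` when `u ∉ H^s`. -/
def sobolevENorm (s : ℝ) (u : LTwo) : ℝ≥0∞ :=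
  (∑' k : ℤ, ENNReal.ofReal (if k = 0 then 1 else |(k : ℝ)| ^ (2 * s)) *
    ‖fourierCoeff u k‖ₑ ^ 2) ^ (1 / 2 : ℝ)

/-- The metric norm of the gradient of `F : Ω_N → ℝ` for the `H¹` distance,
`limsup |F(v) - F(u)| / ‖v - u‖_{H¹}` as `v → u` in `H¹`, `v ∈ Ω_N`, `v ≠ u`.
(The quotient is `0` when `v - u ∉ H¹`.) -/
def slope (N : ℝ) (F : LTwo → ℝ) (u : LTwo) : ℝ≥0∞ :=
  limsup (fun v => ‖F v - F u‖ₑ / sobolevENorm 1 (v - u))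
    (comap (fun v => sobolevENorm 1 (v - u)) (𝓝 0) ⊓ 𝓟 (Ball N \ {u}))

/-- The logarithmic Sobolev inequality with constant `α` for the function `F`, where `G u` is the
norm of the gradient of `F` at `u`; it includes that the entropy integral converges. -/
def LogSobolev (ν : Measure LTwo) (α : ℝ) (F G : LTwo → ℝ) : Prop :=
  Integrable (fun u => F u ^ 2 * Real.log (F u ^ 2 / ∫ v, F v ^ 2 ∂ν)) ν ∧
    ∫ u, F u ^ 2 * Real.log (F u ^ 2 / ∫ v, F v ^ 2 ∂ν) ∂ν ≤ 2 / α * ∫ u, G u ^ 2 ∂ν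

end NLSGibbs

end

/-!
Along Cameron–Martin displacements `T c`, a Gaussian product measure satisfies the Prékopa–Leindler
inequality with the quadratic cost `‖c‖²`. This follows from the inequality on the line by
tensorization, first over finitely many coordinates and then in the limit by averaging.

A displacement `T c` has `sup |T c| ≤ (π² / 3)^{1/2} ‖c‖`. On the ball `Ω_N` the functional
`(λ / 4) ∫ |u|⁴` therefore fails to be concave along `T` by at most `π² λ N t s ‖c‖² / 2`, and the
Gibbs measure satisfies the Prékopa–Leindler inequality with the curvature `1 - π² λ N` in place
of `1`. Applied to a function and its sup-convolution (Bobkov–Ledoux) and linearized, it gives the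
logarithmic Sobolev inequality for bounded functions that are Lipschitz along `T`.

A locally Lipschitz `F` is bounded and Lipschitz on compact sets. The Brownian loop lies almost
surely in `H^{1/4}`, whose balls are relatively compact in `L²`, so that multiplication by cutoff
functions of the norm of `H^{1/4}` reduces `F` to the previous case.
-/

open MeasureTheory ProbabilityTheory Filter Topology
open scoped ENNReal

noncomputable section

namespace NLSGibbs

/-! ### The Prékopa–Leindler inequality on the line -/

section Line

open scoped Pointwise

lemma volume_add_volume_le_volume_add {K L : Set ℝ} (hK : IsCompact K) (hL : IsCompact L)
    (hK₀ : K.Nonempty) (hL₀ : L.Nonempty) : volume K + volume L ≤ volume (K + L) := by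
  obtain ⟨a, ha, ha_max⟩ := hK.exists_isGreatest hK₀
  obtain ⟨b, hb, hb_min⟩ := hL.exists_isLeast hL₀
  -- The translates `K + b` and `a + L` lie in `K + L` and meet only in the point `a + b`.
  have hmeas : MeasurableSet ((a + ·) '' L) := (hL.image (by fun_prop)).measurableSet
  have hinter : volume ((· + b) '' K ∩ (a + ·) '' L) = 0 := by
    refine measure_mono_null (t := {a + b}) ?_ (by simp)
    rintro _ ⟨⟨k, hk, rfl⟩, l, hl, h⟩
    have hka := ha_max hk
    have hbl := hb_min hl
    simp only [Set.mem_singleton_iff] at h ⊢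
    linarith
  calc volume K + volume L = volume ((· + b) '' K) + volume ((a + ·) '' L) := by simp
    _ = volume ((· + b) '' K ∪ (a + ·) '' L) :=
        (measure_union₀ hmeas.nullMeasurableSet hinter).symm
    _ ≤ volume (K + L) := by
        refine measure_mono (Set.union_subset ?_ ?_)
        · rintro _ ⟨k, hk, rfl⟩
          exact Set.add_mem_add hk hb
        · rintro _ ⟨l, hl, rfl⟩
          exact Set.add_mem_add ha hl

lemma mul_volume_add_mul_volume_le {t s : ℝ} (ht : 0 < t) (hs : 0 < s) {A B C : Set ℝ}
    (hA : MeasurableSet A) (hB : MeasurableSet B) (hA₀ : A.Nonempty) (hB₀ : B.Nonempty)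
    (h : ∀ x ∈ A, ∀ y ∈ B, t * x + s * y ∈ C) :
    ENNReal.ofReal t * volume A + ENNReal.ofReal s * volume B ≤ volume C := by
  obtain ⟨a, ha⟩ := hA₀
  obtain ⟨b, hb⟩ := hB₀
  rw [hA.measure_eq_iSup_isCompact, hB.measure_eq_iSup_isCompact]
  simp only [ENNReal.mul_iSup, iSup_and']
  refine ENNReal.biSup_add_biSup_le' ⟨∅, Set.empty_subset _, isCompact_empty⟩
    ⟨∅, Set.empty_subset _, isCompact_empty⟩ ?_
  rintro K ⟨hKA, hK⟩ L ⟨hLB, hL⟩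
  have hsmul : ∀ r : ℝ, 0 < r → ∀ S : Set ℝ, volume (r • S) = ENNReal.ofReal r * volume S :=
    fun r hr S => by simp [Measure.addHaar_smul, abs_of_pos hr]
  calc ENNReal.ofReal t * volume K + ENNReal.ofReal s * volume L
      ≤ ENNReal.ofReal t * volume (insert a K) + ENNReal.ofReal s * volume (insert b L) := by
        gcongr <;> exact Set.subset_insert _ _
    _ = volume (t • insert a K) + volume (s • insert b L) := by rw [hsmul t ht, hsmul s hs]
    _ ≤ volume (t • insert a K + s • insert b L) :=
        volume_add_volume_le_volume_add ((hK.insert a).smul t) ((hL.insert b).smul s)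
          (Set.insert_nonempty _ _).smul_set (Set.insert_nonempty _ _).smul_set
    _ ≤ volume C := by
        refine measure_mono ?_
        rintro _ ⟨_, ⟨x, hx, rfl⟩, _, ⟨y, hy, rfl⟩, rfl⟩
        exact h x (Set.insert_subset ha hKA hx) y (Set.insert_subset hb hLB hy)

lemma rpow_mul_rpow_le_ofReal_mul_add {t s : ℝ} (ht : 0 < t) (hs : 0 < s) (hts : t + s = 1)
    (a b : ℝ≥0∞) : a ^ t * b ^ s ≤ ENNReal.ofReal t * a + ENNReal.ofReal s * b := by
  have hconj : (t⁻¹).HolderConjugate s⁻¹ := by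
    rw [Real.holderConjugate_iff]
    exact ⟨(one_lt_inv₀ ht).2 (by linarith), by simpa using hts⟩
  simpa [ENNReal.rpow_rpow_inv, ht.ne', hs.ne', ENNReal.ofReal_inv_of_pos, ht, hs, div_eq_mul_inv,
    mul_comm] using ENNReal.young_inequality (a ^ t) (b ^ s) hconj

lemma rpow_mul_rpow_self {t s : ℝ} (ht : 0 ≤ t) (hs : 0 ≤ s) (hts : t + s = 1)
    (a : ℝ≥0∞) : a ^ t * a ^ s = a := by
  rw [← ENNReal.rpow_add_of_nonneg _ _ ht hs, hts, ENNReal.rpow_one]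

lemma rpow_mul_rpow_le_of_forall_lt {t s : ℝ} (ht : 0 < t) (hs : 0 < s) {a b c : ℝ≥0∞}
    (h : ∀ a' < a, ∀ b' < b, a' ^ t * b' ^ s ≤ c) : a ^ t * b ^ s ≤ c := by
  refine ENNReal.mul_le_of_forall_lt fun a' ha' b' hb' => ?_
  simpa [ENNReal.rpow_inv_rpow, ht.ne', hs.ne'] using
    h _ ((ENNReal.rpow_inv_lt_iff ht).2 ha') _ ((ENNReal.rpow_inv_lt_iff hs).2 hb')

lemma exists_nat_lt_lintegral_min {Ω : Type*} [MeasurableSpace Ω] {m : Measure Ω} {f : Ω → ℝ≥0∞}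
    (hf : Measurable f) {a : ℝ≥0∞} (ha : a < ∫⁻ x, f x ∂m) :
    ∃ n : ℕ, a < ∫⁻ x, min (f x) n ∂m := by
  have hlim : Tendsto (fun n : ℕ => ∫⁻ x, min (f x) n ∂m) atTop (𝓝 (∫⁻ x, f x ∂m)) :=
    lintegral_tendsto_of_tendsto_of_monotone (fun n => (hf.min measurable_const).aemeasurable)
      (Eventually.of_forall fun x i j hij => min_le_min le_rfl (Nat.cast_le.2 hij))
      (Eventually.of_forall fun x => by
        simpa using (tendsto_const_nhds (x := f x)).min ENNReal.tendsto_nat_nhds_top)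
  exact (hlim.eventually_const_lt ha).exists

lemma lintegral_eq_setLIntegral_Ioo_measure_lt {Ω : Type*} [MeasurableSpace Ω] (m : Measure Ω)
    {f : Ω → ℝ≥0∞} (hf : Measurable f) (hf1 : ∀ x, f x ≤ 1) :
    ∫⁻ x, f x ∂m = ∫⁻ l in Set.Ioo (0 : ℝ) 1, m {x | ENNReal.ofReal l < f x} := by
  have htop : ∀ x, f x ≠ ∞ := fun x => ne_top_of_le_ne_top ENNReal.one_ne_top (hf1 x)
  have hlevel : ∀ l ∈ Set.Ioi (0 : ℝ), m {x | l < (f x).toReal} =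
      (Set.Iio (1 : ℝ)).indicator (fun l => m {x | ENNReal.ofReal l < f x}) l := by
    intro l hl
    by_cases hl1 : l < 1
    · simp only [Set.indicator_of_mem (Set.mem_Iio.2 hl1),
        ENNReal.ofReal_lt_iff_lt_toReal hl.out.le (htop _)]
    · have : ∀ x, (f x).toReal ≤ l := fun x =>
        (ENNReal.toReal_mono ENNReal.one_ne_top (hf1 x)).trans (by simpa using hl1)
      simp [Set.indicator_of_notMem (mt Set.mem_Iio.1 hl1), (this _).not_gt]
  calc ∫⁻ x, f x ∂m = ∫⁻ x, ENNReal.ofReal (f x).toReal ∂m :=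
        lintegral_congr fun x => (ENNReal.ofReal_toReal (htop x)).symm
    _ = ∫⁻ l in Set.Ioi (0 : ℝ), m {x | l < (f x).toReal} :=
        lintegral_eq_lintegral_meas_lt m (Eventually.of_forall fun _ => ENNReal.toReal_nonneg)
          hf.ennreal_toReal.aemeasurable
    _ = ∫⁻ l in Set.Ioi (0 : ℝ), (Set.Iio (1 : ℝ)).indicator
          (fun l => m {x | ENNReal.ofReal l < f x}) l :=
        setLIntegral_congr_fun measurableSet_Ioi hlevel
    _ = _ := by rw [setLIntegral_indicator measurableSet_Iio, Set.Iio_inter_Ioi]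

/-- For functions of supremum one the superlevel sets at a common height are nonempty, so that the
Brunn–Minkowski inequality applies to each of them. -/
lemma ofReal_mul_lintegral_add_le_of_iSup_eq_one {t s : ℝ} (ht : 0 < t) (hs : 0 < s)
    (hts : t + s = 1) {u v w : ℝ → ℝ≥0∞} (hu : Measurable u) (hv : Measurable v)
    (hw : Measurable w) (hu1 : ⨆ x, u x = 1) (hv1 : ⨆ x, v x = 1)
    (h : ∀ x y, u x ^ t * v y ^ s ≤ w (t * x + s * y)) :
    ENNReal.ofReal t * (∫⁻ x, u x) + ENNReal.ofReal s * (∫⁻ x, v x) ≤ ∫⁻ x, w x := by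
  have hlevel : ∀ f : ℝ → ℝ≥0∞, Measurable fun l : ℝ => volume {x | ENNReal.ofReal l < f x} :=
    fun f => Antitone.measurable fun a b hab => measure_mono fun x hx =>
      (ENNReal.ofReal_le_ofReal hab).trans_lt hx
  refine le_trans ?_ (lintegral_mono fun x => min_le_left (w x) 1)
  rw [lintegral_eq_setLIntegral_Ioo_measure_lt _ hu fun x => hu1 ▸ le_iSup u x,
    lintegral_eq_setLIntegral_Ioo_measure_lt _ hv fun x => hv1 ▸ le_iSup v x,
    lintegral_eq_setLIntegral_Ioo_measure_lt _ (hw.min measurable_const) fun x => min_le_right _ _,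
    ← lintegral_const_mul _ (hlevel u), ← lintegral_const_mul _ (hlevel v),
    ← lintegral_add_left ((hlevel u).const_mul _)]
  refine setLIntegral_mono (hlevel _) fun l hl => ?_
  have hl1 : ENNReal.ofReal l < 1 := by simpa using hl.2
  have hne : ∀ f : ℝ → ℝ≥0∞, ⨆ x, f x = 1 → {x | ENNReal.ofReal l < f x}.Nonempty :=
    fun f hf => by
      obtain ⟨x, hx⟩ := lt_iSup_iff.1 (hf.symm ▸ hl1)
      exact ⟨x, hx⟩
  refine mul_volume_add_mul_volume_le ht hs (measurableSet_lt measurable_const hu)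
    (measurableSet_lt measurable_const hv) (hne u hu1) (hne v hv1)
    fun x hx y hy => lt_min (lt_of_lt_of_le ?_ (h x y)) hl1
  rw [← rpow_mul_rpow_self ht.le hs.le hts (ENNReal.ofReal l)]
  exact ENNReal.mul_lt_mul (ENNReal.rpow_lt_rpow hx ht) (ENNReal.rpow_lt_rpow hy hs)

lemma prekopa_leindler_of_iSup_ne_top {t s : ℝ} (ht : 0 < t) (hs : 0 < s) (hts : t + s = 1)
    {u v w : ℝ → ℝ≥0∞} (hu : Measurable u) (hv : Measurable v) (hw : Measurable w)
    (hu_top : ⨆ x, u x ≠ ∞) (hv_top : ⨆ x, v x ≠ ∞)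
    (h : ∀ x y, u x ^ t * v y ^ s ≤ w (t * x + s * y)) :
    (∫⁻ x, u x) ^ t * (∫⁻ x, v x) ^ s ≤ ∫⁻ x, w x := by
  set a := ⨆ x, u x
  set b := ⨆ x, v x
  rcases eq_or_ne a 0 with ha | ha
  · simp [ENNReal.iSup_eq_zero.1 ha, ht]
  rcases eq_or_ne b 0 with hb | hb
  · simp [ENNReal.iSup_eq_zero.1 hb, hs]
  set c := a⁻¹ ^ t * b⁻¹ ^ s
  have hscale : ∀ x y, (a⁻¹ * x) ^ t * (b⁻¹ * y) ^ s = c * (x ^ t * y ^ s) := fun x y => by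
    rw [ENNReal.mul_rpow_of_nonneg _ _ ht.le, ENNReal.mul_rpow_of_nonneg _ _ hs.le,
      mul_mul_mul_comm]
  have hc : c ≠ 0 := by simp [c, ENNReal.rpow_eq_zero_iff, hu_top, hv_top, ha, hb]
  have hc_top : c ≠ ∞ :=
    ENNReal.mul_ne_top (by simp [ENNReal.rpow_eq_top_iff, hu_top, ha])
      (by simp [ENNReal.rpow_eq_top_iff, hv_top, hb])
  refine (ENNReal.mul_le_mul_iff_right hc hc_top).1 ?_
  calc c * ((∫⁻ x, u x) ^ t * (∫⁻ x, v x) ^ s)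
      = (a⁻¹ * ∫⁻ x, u x) ^ t * (b⁻¹ * ∫⁻ x, v x) ^ s := (hscale _ _).symm
    _ ≤ ENNReal.ofReal t * (a⁻¹ * ∫⁻ x, u x) + ENNReal.ofReal s * (b⁻¹ * ∫⁻ x, v x) :=
        rpow_mul_rpow_le_ofReal_mul_add ht hs hts _ _
    _ = ENNReal.ofReal t * (∫⁻ x, a⁻¹ * u x) + ENNReal.ofReal s * (∫⁻ x, b⁻¹ * v x) := by
        rw [lintegral_const_mul _ hu, lintegral_const_mul _ hv]
    _ ≤ ∫⁻ x, c * w x := by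
        refine ofReal_mul_lintegral_add_le_of_iSup_eq_one ht hs hts (hu.const_mul _)
          (hv.const_mul _) (hw.const_mul _) ?_ ?_ fun x y => ?_
        · rw [← ENNReal.mul_iSup, ENNReal.inv_mul_cancel ha hu_top]
        · rw [← ENNReal.mul_iSup, ENNReal.inv_mul_cancel hb hv_top]
        · rw [hscale]
          gcongr
          exact h x y
    _ = c * ∫⁻ x, w x := lintegral_const_mul _ hw

theorem prekopa_leindler {t s : ℝ} (ht : 0 < t) (hs : 0 < s) (hts : t + s = 1)
    {u v w : ℝ → ℝ≥0∞} (hu : Measurable u) (hv : Measurable v) (hw : Measurable w)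
    (h : ∀ x y, u x ^ t * v y ^ s ≤ w (t * x + s * y)) :
    (∫⁻ x, u x) ^ t * (∫⁻ x, v x) ^ s ≤ ∫⁻ x, w x := by
  refine rpow_mul_rpow_le_of_forall_lt ht hs fun a ha b hb => ?_
  obtain ⟨k, hk⟩ := exists_nat_lt_lintegral_min hu ha
  obtain ⟨l, hl⟩ := exists_nat_lt_lintegral_min hv hb
  have htop : ∀ (f : ℝ → ℝ≥0∞) (n : ℕ), ⨆ x, min (f x) n ≠ ∞ := fun f n =>
    ne_top_of_le_ne_top (ENNReal.natCast_ne_top n) (iSup_le fun x => min_le_right _ _)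
  calc a ^ t * b ^ s ≤ (∫⁻ x, min (u x) k) ^ t * (∫⁻ x, min (v x) l) ^ s := by gcongr
    _ ≤ ∫⁻ x, w x := by
        refine prekopa_leindler_of_iSup_ne_top ht hs hts (hu.min measurable_const)
          (hv.min measurable_const) hw (htop u k) (htop v l) fun x y => le_trans ?_ (h x y)
        gcongr <;> exact min_le_left _ _

end Line

/-! ### Prékopa–Leindler inequalities with a cost -/

section Cost

variable {X Y : Type*} [MeasurableSpace X] [AddCommGroup X] [Module ℝ X]
  [MeasurableSpace Y] [AddCommGroup Y] [Module ℝ Y] {t s : ℝ}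

/-- The Prékopa–Leindler inequality for the measure `m` with weights `t` and `s`, in which the
hypothesis on `u`, `v`, `w` is relaxed by the factor `exp (-t s cost (x - y) / 2)`. For the standard
Gaussian measure of a Euclidean space the cost is the square of the norm. -/
def PrekopaLeindler (t s : ℝ) (m : Measure X) (cost : X → ℝ) : Prop :=
  ∀ ⦃u v w : X → ℝ≥0∞⦄, Measurable u → Measurable v → Measurable w →
    (∀ x y, u x ^ t * v y ^ s * ENNReal.ofReal (Real.exp (-(t * s / 2) * cost (x - y)))
      ≤ w (t • x + s • y)) →
    (∫⁻ x, u x ∂m) ^ t * (∫⁻ x, v x ∂m) ^ s ≤ ∫⁻ x, w x ∂m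

lemma PrekopaLeindler.mul_exp_le {m : Measure X} {cost : X → ℝ} (h : PrekopaLeindler t s m cost)
    {u v w : X → ℝ≥0∞} (hu : Measurable u) (hv : Measurable v) (hw : Measurable w) (a : ℝ)
    (huvw : ∀ x y, u x ^ t * v y ^ s * ENNReal.ofReal (Real.exp (a + -(t * s / 2) * cost (x - y)))
      ≤ w (t • x + s • y)) :
    (∫⁻ x, u x ∂m) ^ t * (∫⁻ x, v x ∂m) ^ s * ENNReal.ofReal (Real.exp a) ≤ ∫⁻ x, w x ∂m := by
  have hexp : ENNReal.ofReal (Real.exp (-a)) * ENNReal.ofReal (Real.exp a) = 1 := by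
    rw [← ENNReal.ofReal_mul (Real.exp_pos _).le, ← Real.exp_add]
    simp
  have hscaled : (∫⁻ x, u x ∂m) ^ t * (∫⁻ x, v x ∂m) ^ s ≤
      ∫⁻ x, ENNReal.ofReal (Real.exp (-a)) * w x ∂m := by
    refine h hu hv (hw.const_mul _) fun x y => ?_
    calc _ = ENNReal.ofReal (Real.exp (-a)) * (u x ^ t * v y ^ s *
          ENNReal.ofReal (Real.exp (a + -(t * s / 2) * cost (x - y)))) := by
          rw [mul_left_comm, ← ENNReal.ofReal_mul (Real.exp_pos _).le, ← Real.exp_add,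
            neg_add_cancel_left]
      _ ≤ _ := by gcongr; exact huvw x y
  calc _ ≤ (∫⁻ x, ENNReal.ofReal (Real.exp (-a)) * w x ∂m) * ENNReal.ofReal (Real.exp a) := by
        gcongr
    _ = ∫⁻ x, w x ∂m := by
        rw [lintegral_const_mul _ hw, mul_right_comm, hexp, one_mul]

lemma gaussianPDF_rpow_mul_rpow (ht : 0 ≤ t) (hs : 0 ≤ s) (hts : t + s = 1) (x y : ℝ) :
    gaussianPDF 0 1 x ^ t * gaussianPDF 0 1 y ^ s = gaussianPDF 0 1 (t * x + s * y) *
      ENNReal.ofReal (Real.exp (-(t * s / 2) * (x - y) ^ 2)) := by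
  have hreal : gaussianPDFReal 0 1 x ^ t * gaussianPDFReal 0 1 y ^ s =
      gaussianPDFReal 0 1 (t * x + s * y) * Real.exp (-(t * s / 2) * (x - y) ^ 2) := by
    have hc : 0 < (√(2 * Real.pi * 1))⁻¹ := by positivity
    simp only [gaussianPDFReal, NNReal.coe_one]
    rw [Real.mul_rpow hc.le (Real.exp_pos _).le, Real.mul_rpow hc.le (Real.exp_pos _).le,
      ← Real.exp_mul, ← Real.exp_mul, mul_mul_mul_comm, ← Real.rpow_add hc, hts, Real.rpow_one,
      ← Real.exp_add, mul_assoc _ (Real.exp _), ← Real.exp_add]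
    congr 2
    obtain rfl : s = 1 - t := by linarith
    ring
  simp only [gaussianPDF]
  rw [ENNReal.ofReal_rpow_of_nonneg (gaussianPDFReal_nonneg _ _ _) ht,
    ENNReal.ofReal_rpow_of_nonneg (gaussianPDFReal_nonneg _ _ _) hs,
    ← ENNReal.ofReal_mul (Real.rpow_nonneg (gaussianPDFReal_nonneg _ _ _) _), hreal,
    ENNReal.ofReal_mul (gaussianPDFReal_nonneg _ _ _)]

theorem prekopaLeindler_gaussianReal (ht : 0 < t) (hs : 0 < s) (hts : t + s = 1) :
    PrekopaLeindler t s (gaussianReal 0 1) fun x => x ^ 2 := by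
  intro u v w hu hv hw h
  have hp : Measurable (gaussianPDF 0 1) := measurable_gaussianPDF 0 1
  rw [gaussianReal_of_var_ne_zero 0 one_ne_zero, lintegral_withDensity_eq_lintegral_mul _ hp hu,
    lintegral_withDensity_eq_lintegral_mul _ hp hv, lintegral_withDensity_eq_lintegral_mul _ hp hw]
  refine prekopa_leindler ht hs hts (hp.mul hu) (hp.mul hv) (hp.mul hw) fun x y => ?_
  simp only [Pi.mul_apply]
  rw [ENNReal.mul_rpow_of_nonneg _ _ ht.le, ENNReal.mul_rpow_of_nonneg _ _ hs.le,
    mul_mul_mul_comm, gaussianPDF_rpow_mul_rpow ht.le hs.le hts, mul_assoc]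
  gcongr
  rw [mul_comm]
  exact h x y

theorem PrekopaLeindler.prod {m : Measure X} {m' : Measure Y} [SFinite m] [SFinite m']
    {c : X → ℝ} {c' : Y → ℝ} (h : PrekopaLeindler t s m c) (h' : PrekopaLeindler t s m' c') :
    PrekopaLeindler t s (m.prod m') fun p => c p.1 + c' p.2 := by
  intro u v w hu hv hw huvw
  rw [lintegral_prod _ hu.aemeasurable, lintegral_prod _ hv.aemeasurable,
    lintegral_prod _ hw.aemeasurable]
  refine h hu.lintegral_prod_right' hv.lintegral_prod_right' hw.lintegral_prod_right' fun x x' => ?_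
  refine h'.mul_exp_le (by fun_prop) (by fun_prop) (w := fun y => w (t • x + s • x', y))
    (by fun_prop) _ fun y y' => ?_
  simpa [mul_add] using huvw (x, y) (x', y')

end Cost

/-! ### Tensorization over infinite products -/

section DominatesFinitary

variable {ι : Type*} {X : ι → Type*} [∀ i, AddCommGroup (X i)] [∀ i, Module ℝ (X i)] {t s : ℝ}
  {c : ∀ i, X i → ℝ} {u v w : (∀ i, X i) → ℝ≥0∞}

/-- The hypothesis of the Prékopa–Leindler inequality on a product, with the sum of the costs `c i`
as cost, for the pairs of points that differ in finitely many coordinates only. -/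
def DominatesFinitary (t s : ℝ) (c : ∀ i, X i → ℝ) (u v w : (∀ i, X i) → ℝ≥0∞) : Prop :=
  ∀ (J : Finset ι) (x y : ∀ i, X i), (∀ i ∉ J, x i = y i) →
    u x ^ t * v y ^ s * ENNReal.ofReal (Real.exp (-(t * s / 2) * ∑ i ∈ J, c i (x i - y i)))
      ≤ w (t • x + s • y)

lemma DominatesFinitary.update [DecidableEq ι] (huvw : DominatesFinitary t s c u v w)
    {J : Finset ι} {x y : ∀ i, X i} (hxy : ∀ i ∉ J, x i = y i) (j : ι) (p q : X j) :
    u (Function.update x j p) ^ t * v (Function.update y j q) ^ s *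
      ENNReal.ofReal (Real.exp (-(t * s / 2) * ∑ i ∈ J.erase j, c i (x i - y i) +
        -(t * s / 2) * c j (p - q))) ≤
      w (Function.update (t • x + s • y) j (t • p + s • q)) := by
  have hne : ∀ i ∉ insert j (J.erase j), Function.update x j p i = Function.update y j q i :=
    fun i hi => by
      have hij : i ≠ j := fun h => hi (by simp [h])
      simpa [hij] using hxy i fun h => hi (by simp [h, hij])
  have hsum : ∑ i ∈ insert j (J.erase j),
      c i (Function.update x j p i - Function.update y j q i) =
        c j (p - q) + ∑ i ∈ J.erase j, c i (x i - y i) := by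
    rw [Finset.sum_insert (by simp), Function.update_self, Function.update_self]
    exact congrArg _ (Finset.sum_congr rfl fun i hi => by simp [Finset.ne_of_mem_erase hi])
  have key := huvw _ _ _ hne
  rwa [hsum, mul_add, add_comm, ← Function.update_smul, ← Function.update_smul,
    ← Function.update_add] at key

end DominatesFinitary

section CoordAverage

variable {ι : Type*} [DecidableEq ι] {X : ι → Type*} [∀ i, MeasurableSpace (X i)]

lemma measurable_piecewise (J : Finset ι) :
    Measurable fun p : (∀ i, X i) × (∀ i, X i) => J.piecewise p.1 p.2 := by
  refine measurable_pi_iff.2 fun i => ?_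
  by_cases hi : i ∈ J
  · simp only [Finset.piecewise, hi, if_true]
    fun_prop
  · simp only [Finset.piecewise, hi, if_false]
    fun_prop

lemma measurable_piecewise_left (J : Finset ι) (x : ∀ i, X i) :
    Measurable fun r : ∀ i, X i => J.piecewise r x :=
  (measurable_piecewise J).comp (measurable_id.prodMk measurable_const)

variable (m : ∀ i, Measure (X i))

/-- The average of `u` over the coordinates in `J`, the other coordinates being those of `x`: the
conditional expectation of `u` given the coordinates outside of `J`. -/
def coordAverage (J : Finset ι) (u : (∀ i, X i) → ℝ≥0∞) (x : ∀ i, X i) : ℝ≥0∞ :=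
  ∫⁻ r, u (J.piecewise r x) ∂Measure.infinitePi m

variable {m} {u v w : (∀ i, X i) → ℝ≥0∞} (J : Finset ι)

lemma coordAverage_mono (huv : ∀ x, u x ≤ v x) (x : ∀ i, X i) :
    coordAverage m J u x ≤ coordAverage m J v x :=
  lintegral_mono fun _ => huv _

lemma coordAverage_add (hu : Measurable u) (x : ∀ i, X i) :
    coordAverage m J (fun x => u x + v x) x = coordAverage m J u x + coordAverage m J v x :=
  lintegral_add_left (hu.comp (measurable_piecewise_left J x)) _

lemma coordAverage_eq_lintegral_of_dependsOn (hu : DependsOn u J) (x : ∀ i, X i) :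
    coordAverage m J u x = ∫⁻ x, u x ∂Measure.infinitePi m :=
  lintegral_congr fun _ => hu fun _ hi => Finset.piecewise_eq_of_mem _ _ _ hi

variable [∀ i, IsProbabilityMeasure (m i)]

variable (m) in
lemma infinitePi_prod_map_piecewise :
    ((Measure.infinitePi m).prod (Measure.infinitePi m)).map (fun p => J.piecewise p.1 p.2) =
      Measure.infinitePi m := by
  refine Measure.eq_infinitePi _ fun S T hT => ?_
  have hpreimage : (fun p : (∀ i, X i) × (∀ i, X i) => J.piecewise p.1 p.2) ⁻¹' Set.pi S T =
      Set.pi (S.filter (· ∈ J) : Finset ι) T ×ˢ Set.pi (S.filter (· ∉ J) : Finset ι) T := by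
    ext p
    simp only [Set.mem_preimage, Set.mem_pi, Finset.mem_coe, Set.mem_prod, Finset.mem_filter,
      Finset.piecewise]
    grind
  rw [Measure.map_apply (measurable_piecewise J)
    (MeasurableSet.pi S.countable_toSet fun i _ => hT i), hpreimage, Measure.prod_prod,
    Measure.infinitePi_pi _ fun i _ => hT i, Measure.infinitePi_pi _ fun i _ => hT i,
    Finset.prod_filter_mul_prod_filter_not]

lemma measurable_coordAverage (hu : Measurable u) : Measurable (coordAverage m J u) :=
  (hu.comp ((measurable_piecewise J).comp measurable_swap)).lintegral_prod_right'

lemma lintegral_coordAverage (hu : Measurable u) :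
    ∫⁻ x, coordAverage m J u x ∂Measure.infinitePi m = ∫⁻ x, u x ∂Measure.infinitePi m := by
  conv_rhs => rw [← infinitePi_prod_map_piecewise m J, lintegral_map hu (measurable_piecewise J)]
  exact (lintegral_prod_symm' _ (hu.comp (measurable_piecewise J))).symm

lemma coordAverage_insert (hu : Measurable u) (j : ι) (x : ∀ i, X i) :
    coordAverage m (insert j J) u x = coordAverage m J (coordAverage m {j} u) x := by
  have hmeas : Measurable fun r => u ((insert j J).piecewise r x) :=
    hu.comp (measurable_piecewise_left (insert j J) x)
  rw [coordAverage, ← lintegral_coordAverage {j} hmeas]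
  refine lintegral_congr fun r => lintegral_congr fun q => congrArg u ?_
  ext i
  simp only [Finset.piecewise, Finset.mem_insert, Finset.mem_singleton]
  grind

lemma coordAverage_singleton (hu : Measurable u) (j : ι) (x : ∀ i, X i) :
    coordAverage m {j} u x = ∫⁻ q, u (Function.update x j q) ∂m j := by
  have hmeas : Measurable fun q => u (Function.update x j q) := hu.comp (measurable_update x)
  rw [← (measurePreserving_eval_infinitePi m j).lintegral_comp hmeas]
  exact lintegral_congr fun r => by rw [Finset.piecewise_singleton]

end CoordAverage

section Tensorization

variable {ι : Type*} {X : ι → Type*} [∀ i, MeasurableSpace (X i)]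
  {m : ∀ i, Measure (X i)} [∀ i, IsProbabilityMeasure (m i)]

open scoped symmDiff in
lemma exists_dependsOn_measure_symmDiff_le {S : Set (∀ i, X i)} (hS : MeasurableSet S) {ε : ℝ≥0∞}
    (hε : ε ≠ 0) : ∃ (T : Set (∀ i, X i)) (J : Finset ι), MeasurableSet T ∧
      DependsOn (· ∈ T) (J : Set ι) ∧ Measure.infinitePi m (S ∆ T) ≤ ε := by
  obtain ⟨δ, hδ, hδε⟩ := ENNReal.lt_iff_exists_nnreal_btwn.1 (pos_iff_ne_zero.2 hε)
  have hdense := Measure.MeasureDense.of_generateFrom_isSetAlgebra_finite (Measure.infinitePi m)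
    (𝒜 := measurableCylinders X) isSetAlgebra_measurableCylinders
    generateFrom_measurableCylinders.symm
  obtain ⟨T, hT, hST⟩ := hdense.approx S hS (measure_ne_top _ _) δ (by simpa using hδ)
  obtain ⟨J, T', -, rfl⟩ := (mem_measurableCylinders _).1 hT
  refine ⟨_, J, hdense.measurable _ hT, fun x y hxy => ?_,
    hST.le.trans (by simpa using hδε.le)⟩
  have hrestrict : J.restrict x = J.restrict y := funext fun i => hxy i i.2
  simp only [mem_cylinder, hrestrict]

open scoped symmDiff in
lemma exists_dependsOn_eLpNorm_sub_le {f : (∀ i, X i) → ℝ} (hf : MemLp f 1 (Measure.infinitePi m))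
    {ε : ℝ≥0∞} (hε : ε ≠ 0) :
    ∃ g : (∀ i, X i) → ℝ, eLpNorm (f - g) 1 (Measure.infinitePi m) ≤ ε ∧
      Measurable g ∧ ∃ J : Finset ι, DependsOn g J := by
  classical
  refine hf.induction_dense ENNReal.one_ne_top
    (fun g => Measurable g ∧ ∃ J : Finset ι, DependsOn g J) ?_ ?_
    (fun g hg => hg.1.aestronglyMeasurable) hε
  · intro c S hS _ δ hδ
    obtain ⟨T, J, hT, hTJ, hST⟩ := exists_dependsOn_measure_symmDiff_le (m := m) hS
      (ENNReal.div_ne_zero.2 ⟨hδ, enorm_ne_top (x := c)⟩)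
    refine ⟨T.indicator fun _ => c, ?_, measurable_const.indicator hT, J, fun x y hxy => ?_⟩
    · have hle : ∀ x, ‖(T.indicator (fun _ => c) - S.indicator fun _ => c : _ → ℝ) x‖ₑ ≤
          (S ∆ T).indicator (fun _ => ‖c‖ₑ) x := fun x => by
        by_cases hxS : x ∈ S <;> by_cases hxT : x ∈ T <;>
          simp [hxS, hxT, Set.indicator, Set.mem_symmDiff]
      rw [eLpNorm_one_eq_lintegral_enorm]
      calc _ ≤ ∫⁻ x, (S ∆ T).indicator (fun _ => ‖c‖ₑ) x ∂Measure.infinitePi m :=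
            lintegral_mono hle
        _ = ‖c‖ₑ * Measure.infinitePi m (S ∆ T) := by
            rw [lintegral_indicator (hS.symmDiff hT), setLIntegral_const]
        _ ≤ ‖c‖ₑ * (δ / ‖c‖ₑ) := by gcongr
        _ ≤ δ := ENNReal.mul_div_le
    · have hmem : x ∈ T ↔ y ∈ T := iff_of_eq (hTJ hxy)
      simp only [Set.indicator_apply, hmem]
  · rintro f g ⟨hf, I, hI⟩ ⟨hg, J, hJ⟩
    refine ⟨hf.add hg, I ∪ J, fun x y hxy => ?_⟩
    rw [Pi.add_apply, Pi.add_apply, hI fun i hi => hxy i (by simp [Finset.mem_coe.1 hi]),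
      hJ fun i hi => hxy i (by simp [Finset.mem_coe.1 hi])]

lemma measure_coordAverage_lt_le [DecidableEq ι] {u g h : (∀ i, X i) → ℝ≥0∞} (hu : Measurable u)
    (hg : Measurable g) (hh : Measurable h) {J : Finset ι} (hgJ : DependsOn g J)
    (hug : ∀ x, u x ≤ g x + h x) (hgu : ∀ x, g x ≤ u x + h x) {a κ ε : ℝ≥0∞} (hκ : κ ≠ 0)
    (hκ_top : κ ≠ ∞) (hε : ε ≤ 1) (ha : a + (κ + κ) ≤ ∫⁻ x, u x ∂Measure.infinitePi m)
    (hhε : ∫⁻ x, h x ∂Measure.infinitePi m ≤ κ * ε) :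
    Measure.infinitePi m {x | coordAverage m J u x < a} ≤ ε := by
  have hga : a + κ ≤ ∫⁻ x, g x ∂Measure.infinitePi m := by
    refine (ENNReal.add_le_add_iff_right hκ_top).1 ?_
    calc a + κ + κ ≤ ∫⁻ x, g x + h x ∂Measure.infinitePi m :=
          (add_assoc a κ κ).trans_le (ha.trans (lintegral_mono hug))
      _ = ∫⁻ x, g x ∂Measure.infinitePi m + ∫⁻ x, h x ∂Measure.infinitePi m :=
          lintegral_add_left hg _
      _ ≤ _ := by
          gcongr
          exact hhε.trans (mul_le_of_le_one_right' hε)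
  have hsubset : {x | coordAverage m J u x < a} ⊆ {x | κ ≤ coordAverage m J h x} := by
    intro x (hx : coordAverage m J u x < a)
    by_contra! hlt
    refine (ENNReal.add_lt_add hx (not_le.1 hlt)).not_ge ?_
    rw [← coordAverage_add J hu]
    exact hga.trans ((coordAverage_eq_lintegral_of_dependsOn J hgJ x).symm.trans_le
      (coordAverage_mono J hgu x))
  calc _ ≤ Measure.infinitePi m {x | κ ≤ coordAverage m J h x} := measure_mono hsubset
    _ ≤ (∫⁻ x, coordAverage m J h x ∂Measure.infinitePi m) / κ :=
        meas_ge_le_lintegral_div (measurable_coordAverage J hh).aemeasurable hκ hκ_top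
    _ ≤ ε := by
        rw [lintegral_coordAverage J hh]
        exact ENNReal.div_le_of_le_mul (hhε.trans_eq (mul_comm _ _))

lemma exists_measure_coordAverage_lt_le_of_le [DecidableEq ι] {u : (∀ i, X i) → ℝ≥0∞}
    (hu : Measurable u) {M : ℝ≥0∞} (hM : M ≠ ∞) (huM : ∀ x, u x ≤ M) {a : ℝ≥0∞}
    (ha : a < ∫⁻ x, u x ∂Measure.infinitePi m) {ε : ℝ≥0∞} (hε : ε ≠ 0) (hε1 : ε ≤ 1) :
    ∃ J₀ : Finset ι, ∀ J, J₀ ⊆ J →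
      Measure.infinitePi m {x | coordAverage m J u x < a} ≤ ε := by
  have hinteg : ∫⁻ x, u x ∂Measure.infinitePi m ≠ ∞ :=
    ne_top_of_le_ne_top hM ((lintegral_mono huM).trans (by simp))
  set κ := (∫⁻ x, u x ∂Measure.infinitePi m - a) / 2
  have hκ : κ ≠ 0 := by simpa [κ, tsub_eq_zero_iff_le] using ha
  have hκ_top : κ ≠ ∞ := ENNReal.div_ne_top (ENNReal.sub_ne_top hinteg) two_ne_zero
  have hmem : MemLp (fun x => (u x).toReal) 1 (Measure.infinitePi m) :=
    MemLp.of_bound hu.ennreal_toReal.aestronglyMeasurable M.toReal <| Eventually.of_forall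
      fun x => by simpa using ENNReal.toReal_mono hM (huM x)
  obtain ⟨g, hfg, hg, J₀, hgJ₀⟩ := exists_dependsOn_eLpNorm_sub_le hmem (mul_ne_zero hκ hε)
  have hu_enorm : ∀ x, ‖(u x).toReal‖ₑ = u x := fun x => by
    rw [Real.enorm_of_nonneg ENNReal.toReal_nonneg,
      ENNReal.ofReal_toReal (ne_top_of_le_ne_top hM (huM x))]
  refine ⟨J₀, fun J hJ => measure_coordAverage_lt_le (g := fun x => ‖g x‖ₑ)
    (h := fun x => ‖(u x).toReal - g x‖ₑ) hu hg.enorm (hu.ennreal_toReal.sub hg).enorm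
    (fun x y hxy => congrArg enorm (hgJ₀ fun i hi => hxy i (hJ hi))) (fun x => ?_) (fun x => ?_)
    hκ hκ_top hε1 ?_ ?_⟩
  · simpa [hu_enorm] using enorm_add_le (g x) ((u x).toReal - g x)
  · simpa [hu_enorm] using enorm_sub_le (a := (u x).toReal) (b := (u x).toReal - g x)
  · rw [ENNReal.add_halves, add_tsub_cancel_of_le ha.le]
  · simpa [eLpNorm_one_eq_lintegral_enorm] using hfg

/-- By density of the functions of finitely many coordinates, averaging over more and more
coordinates tends to the integral in probability. -/
lemma exists_measure_coordAverage_lt_le [DecidableEq ι] {u : (∀ i, X i) → ℝ≥0∞}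
    (hu : Measurable u) {a : ℝ≥0∞} (ha : a < ∫⁻ x, u x ∂Measure.infinitePi m) {ε : ℝ≥0∞}
    (hε : ε ≠ 0) (hε1 : ε ≤ 1) :
    ∃ J₀ : Finset ι, ∀ J, J₀ ⊆ J →
      Measure.infinitePi m {x | coordAverage m J u x < a} ≤ ε := by
  obtain ⟨n, hn⟩ := exists_nat_lt_lintegral_min hu ha
  obtain ⟨J₀, hJ₀⟩ := exists_measure_coordAverage_lt_le_of_le (hu.min measurable_const)
    (ENNReal.natCast_ne_top n) (fun x => min_le_right _ _) hn hε hε1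
  exact ⟨J₀, fun J hJ => (measure_mono fun x hx =>
    (coordAverage_mono J (fun x => min_le_left _ _) x).trans_lt hx).trans (hJ₀ J hJ)⟩

variable [∀ i, AddCommGroup (X i)] [∀ i, Module ℝ (X i)] {t s : ℝ} {c : ∀ i, X i → ℝ}
  {u v w : (∀ i, X i) → ℝ≥0∞}

lemma DominatesFinitary.coordAverage_singleton [DecidableEq ι] (ht : 0 < t) (hs : 0 < s)
    (h : ∀ i, PrekopaLeindler t s (m i) (c i)) (hc : ∀ i x, 0 ≤ c i x)
    (hu : Measurable u) (hv : Measurable v) (hw : Measurable w)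
    (huvw : DominatesFinitary t s c u v w) (j : ι) :
    DominatesFinitary t s c (coordAverage m {j} u) (coordAverage m {j} v)
      (coordAverage m {j} w) := by
  intro J x y hxy
  have herase : -(t * s / 2) * ∑ i ∈ J, c i (x i - y i) ≤
      -(t * s / 2) * ∑ i ∈ J.erase j, c i (x i - y i) :=
    mul_le_mul_of_nonpos_left (Finset.sum_le_sum_of_subset_of_nonneg (Finset.erase_subset _ _)
      fun _ _ _ => hc _ _) (neg_nonpos.2 (by positivity))
  rw [NLSGibbs.coordAverage_singleton hu, NLSGibbs.coordAverage_singleton hv,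
    NLSGibbs.coordAverage_singleton hw]
  calc _ ≤ (∫⁻ q, u (Function.update x j q) ∂m j) ^ t * (∫⁻ q, v (Function.update y j q) ∂m j) ^ s *
        ENNReal.ofReal (Real.exp (-(t * s / 2) * ∑ i ∈ J.erase j, c i (x i - y i))) := by gcongr
    _ ≤ _ := (h j).mul_exp_le (hu.comp (measurable_update x)) (hv.comp (measurable_update y))
        (hw.comp (measurable_update (t • x + s • y))) _ (huvw.update hxy j)

lemma DominatesFinitary.coordAverage_rpow_mul_le [DecidableEq ι] (ht : 0 < t) (hs : 0 < s)
    (hts : t + s = 1) (h : ∀ i, PrekopaLeindler t s (m i) (c i)) (hc : ∀ i x, 0 ≤ c i x)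
    (hu : Measurable u) (hv : Measurable v) (hw : Measurable w)
    (huvw : DominatesFinitary t s c u v w) (J : Finset ι) (x : ∀ i, X i) :
    coordAverage m J u x ^ t * coordAverage m J v x ^ s ≤ coordAverage m J w x := by
  induction J using Finset.induction_on generalizing u v w with
  | empty => simpa [coordAverage, ← add_smul, hts] using huvw ∅ x x fun _ _ => rfl
  | insert j J _ ih =>
    rw [coordAverage_insert J hu, coordAverage_insert J hv, coordAverage_insert J hw]
    exact ih (measurable_coordAverage _ hu) (measurable_coordAverage _ hv)
      (measurable_coordAverage _ hw) (huvw.coordAverage_singleton ht hs h hc hu hv hw j)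

theorem DominatesFinitary.lintegral_rpow_mul_le (ht : 0 < t) (hs : 0 < s) (hts : t + s = 1)
    (h : ∀ i, PrekopaLeindler t s (m i) (c i)) (hc : ∀ i x, 0 ≤ c i x)
    (hu : Measurable u) (hv : Measurable v) (hw : Measurable w)
    (huvw : DominatesFinitary t s c u v w) :
    (∫⁻ x, u x ∂Measure.infinitePi m) ^ t * (∫⁻ x, v x ∂Measure.infinitePi m) ^ s ≤
      ∫⁻ x, w x ∂Measure.infinitePi m := by
  classical
  refine rpow_mul_rpow_le_of_forall_lt ht hs fun a ha b hb => ?_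
  rw [← one_mul (a ^ t * b ^ s)]
  refine ENNReal.mul_le_of_forall_lt fun η hη k hk => ?_
  have hε : (1 - η) / 2 ≠ 0 := by simpa [tsub_eq_zero_iff_le] using hη
  have hε1 : (1 - η) / 2 ≤ 1 := ENNReal.half_le_self.trans tsub_le_self
  obtain ⟨I, hI⟩ := exists_measure_coordAverage_lt_le hu ha hε hε1
  obtain ⟨J, hJ⟩ := exists_measure_coordAverage_lt_le hv hb hε hε1
  set K := I ∪ J
  set A := {x | coordAverage m K u x < a}
  set B := {x | coordAverage m K v x < b}
  have hAB : MeasurableSet (A ∪ B) :=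
    (measurableSet_lt (measurable_coordAverage K hu) measurable_const).union
      (measurableSet_lt (measurable_coordAverage K hv) measurable_const)
  have hη_le : η ≤ Measure.infinitePi m (A ∪ B)ᶜ := by
    have hsmall : Measure.infinitePi m (A ∪ B) ≤ 1 - η :=
      (measure_union_le _ _).trans <| (add_le_add (hI K Finset.subset_union_left)
        (hJ K Finset.subset_union_right)).trans_eq (ENNReal.add_halves _)
    rw [prob_compl_eq_one_sub hAB]
    exact (ENNReal.sub_sub_cancel ENNReal.one_ne_top hη.le).symm.trans_le
      (tsub_le_tsub_left hsmall 1)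
  calc η * k ≤ a ^ t * b ^ s * Measure.infinitePi m (A ∪ B)ᶜ := by rw [mul_comm]; gcongr
    _ = ∫⁻ _ in (A ∪ B)ᶜ, a ^ t * b ^ s ∂Measure.infinitePi m := by rw [setLIntegral_const]
    _ ≤ ∫⁻ x in (A ∪ B)ᶜ, coordAverage m K w x ∂Measure.infinitePi m := by
        refine setLIntegral_mono (measurable_coordAverage K hw) fun x hx => ?_
        obtain ⟨hxA, hxB⟩ : a ≤ coordAverage m K u x ∧ b ≤ coordAverage m K v x := by
          simpa [A, B] using hx
        exact le_trans (by gcongr) (huvw.coordAverage_rpow_mul_le ht hs hts h hc hu hv hw K x)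
    _ ≤ ∫⁻ x, coordAverage m K w x ∂Measure.infinitePi m := setLIntegral_le_lintegral _ _
    _ = ∫⁻ x, w x ∂Measure.infinitePi m := lintegral_coordAverage K hw

end Tensorization

/-! ### The Prékopa–Leindler inequality along an embedded space -/

lemma smul_add_smul_shift {E : Type*} [AddCommGroup E] [Module ℝ E] {t s : ℝ} (hts : t + s = 1)
    (z d : E) : t • (z + s • d) + s • (z - t • d) = z := by
  obtain rfl : t = 1 - s := by linarith
  module

lemma shift_sub_shift {E : Type*} [AddCommGroup E] [Module ℝ E] {t s : ℝ} (hts : t + s = 1)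
    (z d : E) : (z + s • d) - (z - t • d) = d := by
  obtain rfl : t = 1 - s := by linarith
  module

lemma lintegral_restrict_withDensity {X : Type*} [MeasurableSpace X] {μ : Measure X} {Ω : Set X}
    (hΩ : MeasurableSet Ω) {W f : X → ℝ≥0∞} (hW : Measurable W) (hf : Measurable f) :
    ∫⁻ x, f x ∂(μ.restrict Ω).withDensity W = ∫⁻ x, Ω.indicator (fun z => W z * f z) x ∂μ := by
  rw [lintegral_withDensity_eq_lintegral_mul _ hW hf, lintegral_indicator hΩ]
  rfl

section CameronMartin

variable {H E : Type*} [NormedAddCommGroup H] [NormedSpace ℝ H] [NormedAddCommGroup E]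
  [NormedSpace ℝ E] [MeasurableSpace E] {T : H →L[ℝ] E} {κ : ℝ} {μ : Measure E}

/-- The Prékopa–Leindler inequality for `μ`, where only displacements in the image of `T` matter and
are penalized with the curvature `κ`. A Gaussian measure satisfies it with `κ = 1` when `T` is the
embedding of its Cameron–Martin space. -/
def CMPrekopaLeindler (T : H →L[ℝ] E) (κ : ℝ) (μ : Measure E) : Prop :=
  ∀ ⦃t s : ℝ⦄, 0 < t → 0 < s → t + s = 1 → ∀ ⦃u v w : E → ℝ≥0∞⦄,
    Measurable u → Measurable v → Measurable w →
    (∀ z c, u (z + s • T c) ^ t * v (z - t • T c) ^ s *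
      ENNReal.ofReal (Real.exp (-(κ * (t * s / 2 * ‖c‖ ^ 2)))) ≤ w z) →
    (∫⁻ x, u x ∂μ) ^ t * (∫⁻ x, v x ∂μ) ^ s ≤ ∫⁻ x, w x ∂μ

lemma CMPrekopaLeindler.smul (h : CMPrekopaLeindler T κ μ) (a : ℝ≥0∞) :
    CMPrekopaLeindler T κ (a • μ) := by
  intro t s ht hs hts u v w hu hv hw huvw
  simp only [lintegral_smul_measure, smul_eq_mul]
  calc (a * ∫⁻ x, u x ∂μ) ^ t * (a * ∫⁻ x, v x ∂μ) ^ s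
      = (a ^ t * a ^ s) * ((∫⁻ x, u x ∂μ) ^ t * (∫⁻ x, v x ∂μ) ^ s) := by
        rw [ENNReal.mul_rpow_of_nonneg _ _ ht.le, ENNReal.mul_rpow_of_nonneg _ _ hs.le]
        ring
    _ ≤ a * ∫⁻ x, w x ∂μ := by
        rw [rpow_mul_rpow_self ht.le hs.le hts]
        gcongr
        exact h ht hs hts hu hv hw huvw

/-- A perturbation `V` whose convexity defect along `T` is quadratic costs that much curvature. -/
theorem CMPrekopaLeindler.restrict_withDensity_exp (h : CMPrekopaLeindler T κ μ) {Ω : Set E}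
    (hΩ : Convex ℝ Ω) (hΩ_meas : MeasurableSet Ω) {V : E → ℝ} (hV : Measurable V) {α : ℝ}
    (hdefect : ∀ ⦃t s : ℝ⦄, 0 < t → 0 < s → t + s = 1 → ∀ x ∈ Ω, ∀ y ∈ Ω, ∀ c, x - y = T c →
      t * V x + s * V y ≤ V (t • x + s • y) + (κ - α) * (t * s / 2 * ‖c‖ ^ 2)) :
    CMPrekopaLeindler T α
      ((μ.restrict Ω).withDensity fun z => ENNReal.ofReal (Real.exp (V z))) := by
  intro t s ht hs hts u v w hu hv hw huvw
  have hW : Measurable fun z => ENNReal.ofReal (Real.exp (V z)) := hV.exp.ennreal_ofReal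
  simp only [lintegral_restrict_withDensity hΩ_meas hW, hu, hv, hw]
  refine h ht hs hts ((hW.mul hu).indicator hΩ_meas) ((hW.mul hv).indicator hΩ_meas)
    ((hW.mul hw).indicator hΩ_meas) fun z c => ?_
  by_cases hx : z + s • T c ∈ Ω
  swap; · simp [Set.indicator_of_notMem hx, ENNReal.zero_rpow_of_pos ht]
  by_cases hy : z - t • T c ∈ Ω
  swap; · simp [Set.indicator_of_notMem hy, ENNReal.zero_rpow_of_pos hs]
  have hVz := hdefect ht hs hts _ hx _ hy c (shift_sub_shift hts z (T c))
  have hz := hΩ hx hy ht.le hs.le hts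
  rw [smul_add_smul_shift hts] at hVz hz
  have hexp : ENNReal.ofReal (Real.exp (V (z + s • T c))) ^ t *
      ENNReal.ofReal (Real.exp (V (z - t • T c))) ^ s *
      ENNReal.ofReal (Real.exp (-(κ * (t * s / 2 * ‖c‖ ^ 2)))) ≤
      ENNReal.ofReal (Real.exp (V z)) *
        ENNReal.ofReal (Real.exp (-(α * (t * s / 2 * ‖c‖ ^ 2)))) := by
    simp only [ENNReal.ofReal_rpow_of_pos (Real.exp_pos _), ← Real.exp_mul,
      ← ENNReal.ofReal_mul (Real.exp_pos _).le, ← Real.exp_add]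
    exact ENNReal.ofReal_le_ofReal (Real.exp_le_exp.2 (by linarith))
  rw [Set.indicator_of_mem hx, Set.indicator_of_mem hy, Set.indicator_of_mem hz,
    ENNReal.mul_rpow_of_nonneg _ _ ht.le, ENNReal.mul_rpow_of_nonneg _ _ hs.le]
  calc _ = u (z + s • T c) ^ t * v (z - t • T c) ^ s *
        (ENNReal.ofReal (Real.exp (V (z + s • T c))) ^ t *
          ENNReal.ofReal (Real.exp (V (z - t • T c))) ^ s *
          ENNReal.ofReal (Real.exp (-(κ * (t * s / 2 * ‖c‖ ^ 2))))) := by ring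
    _ ≤ u (z + s • T c) ^ t * v (z - t • T c) ^ s * (ENNReal.ofReal (Real.exp (V z)) *
        ENNReal.ofReal (Real.exp (-(α * (t * s / 2 * ‖c‖ ^ 2))))) := by gcongr
    _ = ENNReal.ofReal (Real.exp (V z)) * (u (z + s • T c) ^ t * v (z - t • T c) ^ s *
        ENNReal.ofReal (Real.exp (-(α * (t * s / 2 * ‖c‖ ^ 2))))) := by ring
    _ ≤ _ := by gcongr; exact huvw z c

lemma CMPrekopaLeindler.measure_rpow_mul_measure_rpow_le (h : CMPrekopaLeindler T κ μ)
    (hκ : 0 ≤ κ) {t s : ℝ} (ht : 0 < t) (hs : 0 < s) (hts : t + s = 1) {A B C : Set E}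
    (hA : MeasurableSet A) (hB : MeasurableSet B) (hC : MeasurableSet C)
    (hABC : ∀ x ∈ A, ∀ y ∈ B, t • x + s • y ∈ C) : μ A ^ t * μ B ^ s ≤ μ C := by
  rw [← lintegral_indicator_one hA, ← lintegral_indicator_one hB, ← lintegral_indicator_one hC]
  refine h ht hs hts (measurable_one.indicator hA) (measurable_one.indicator hB)
    (measurable_one.indicator hC) fun z c => ?_
  by_cases hx : z + s • T c ∈ A
  swap; · simp [Set.indicator_of_notMem hx, ENNReal.zero_rpow_of_pos ht]
  by_cases hy : z - t • T c ∈ B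
  swap; · simp [Set.indicator_of_notMem hy, ENNReal.zero_rpow_of_pos hs]
  have hz := hABC _ hx _ hy
  rw [smul_add_smul_shift hts] at hz
  have hcost : 0 ≤ κ * (t * s / 2 * ‖c‖ ^ 2) := by positivity
  simpa [Set.indicator_of_mem hx, Set.indicator_of_mem hy, Set.indicator_of_mem hz] using hcost

lemma CMPrekopaLeindler.measure_closedBall_le [BorelSpace E] [μ.IsNegInvariant]
    (h : CMPrekopaLeindler T κ μ) (hκ : 0 ≤ κ) (x : E) (r : ℝ) :
    μ (Metric.closedBall x r) ≤ μ (Metric.closedBall 0 r) := by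
  have hmid : ∀ y ∈ Metric.closedBall x r, ∀ z ∈ Metric.closedBall (-x) r,
      (1 / 2 : ℝ) • y + (1 / 2 : ℝ) • z ∈ Metric.closedBall 0 r := fun y hy z hz => by
    rw [mem_closedBall_iff_norm] at hy hz
    rw [mem_closedBall_zero_iff]
    calc ‖(1 / 2 : ℝ) • y + (1 / 2 : ℝ) • z‖
        = ‖(1 / 2 : ℝ) • (y - x) + (1 / 2 : ℝ) • (z - -x)‖ := by congr 1; module
      _ ≤ 1 / 2 * r + 1 / 2 * r := by
          refine norm_add_le_of_le ?_ ?_ <;>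
            rw [norm_smul, Real.norm_of_nonneg one_half_pos.le] <;> gcongr
      _ = r := by ring
  have hsymm : μ (Metric.closedBall (-x) r) = μ (Metric.closedBall x r) := by
    rw [← neg_closedBall, Measure.measure_neg]
  have key := h.measure_rpow_mul_measure_rpow_le hκ one_half_pos one_half_pos (add_halves 1)
    Metric.isClosed_closedBall.measurableSet Metric.isClosed_closedBall.measurableSet
    Metric.isClosed_closedBall.measurableSet hmid
  rwa [hsymm, rpow_mul_rpow_self one_half_pos.le one_half_pos.le (add_halves 1)] at key

lemma CMPrekopaLeindler.measure_closedBall_zero_pos [BorelSpace E]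
    [TopologicalSpace.SeparableSpace E] [μ.IsNegInvariant] [NeZero μ]
    (h : CMPrekopaLeindler T κ μ) (hκ : 0 ≤ κ) {r : ℝ} (hr : 0 < r) :
    0 < μ (Metric.closedBall 0 r) := by
  by_contra! hnull
  have hcover : (Set.univ : Set E) ⊆
      ⋃ n, Metric.closedBall (TopologicalSpace.denseSeq E n) r := fun x _ => by
    obtain ⟨n, hn⟩ := (TopologicalSpace.denseRange_denseSeq E).exists_dist_lt x hr
    exact Set.mem_iUnion.2 ⟨n, hn.le⟩
  exact NeZero.ne μ <| Measure.measure_univ_eq_zero.1 <| measure_mono_null hcover <|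
    measure_iUnion_null fun n =>
      le_antisymm ((h.measure_closedBall_le hκ _ r).trans hnull) zero_le

lemma CMPrekopaLeindler.lintegral_ne_top [IsFiniteMeasure μ] (h : CMPrekopaLeindler T κ μ)
    {t s : ℝ} (ht : 0 < t) (hs : 0 < s) (hts : t + s = 1) {f : E → ℝ≥0∞} (hf : Measurable f)
    {A : Set E} (hA : MeasurableSet A) (hμA : μ A ≠ 0) {K : ℝ≥0∞} (hK : K ≠ ∞)
    (hfK : ∀ x, ∀ y ∈ A, ∀ c, x - y = T c →
      f x ^ t * ENNReal.ofReal (Real.exp (-(κ * (t * s / 2 * ‖c‖ ^ 2)))) ≤ K) :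
    ∫⁻ x, f x ∂μ ≠ ∞ := by
  have key := h ht hs hts hf (measurable_one.indicator hA) (measurable_const (a := K))
    fun z c => by
      by_cases hy : z - t • T c ∈ A
      swap; · simp [Set.indicator_of_notMem hy, ENNReal.zero_rpow_of_pos hs]
      simpa [Set.indicator_of_mem hy] using hfK _ _ hy c (shift_sub_shift hts z (T c))
  rw [lintegral_indicator_one hA, lintegral_const] at key
  intro htop
  rw [htop, ENNReal.top_rpow_of_pos ht, ENNReal.top_mul, top_le_iff] at key
  · exact ENNReal.mul_ne_top hK (measure_ne_top μ _) key
  · simp [ENNReal.rpow_eq_zero_iff, hμA, hs.not_gt]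

end CameronMartin

/-! ### Entropy -/

section Entropy

variable {X : Type*} [MeasurableSpace X] {ν : Measure X}

/-- The entropy `∫ f log f - (∫ f) log (∫ f)` of a nonnegative function `f`. -/
def entropy (ν : Measure X) (f : X → ℝ) : ℝ :=
  ∫ z, f z * Real.log (f z) ∂ν - (∫ z, f z ∂ν) * Real.log (∫ z, f z ∂ν)

lemma integrable_exp_of_abs_le [IsFiniteMeasure ν] {g : X → ℝ} (hg : Measurable g) {M : ℝ}
    (hM : ∀ z, |g z| ≤ M) : Integrable (fun z => Real.exp (g z)) ν :=
  .of_bound hg.exp.aestronglyMeasurable (Real.exp M) <| ae_of_all _ fun z => by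
    rw [Real.norm_of_nonneg (Real.exp_pos _).le]
    exact Real.exp_le_exp.2 (abs_le.1 (hM z)).2

/-- Jensen's inequality for the probability measure proportional to `exp g • ν`. -/
lemma integral_exp_mul_exp_le [NeZero ν] {g : X → ℝ} {r : ℝ}
    (hexp : Integrable (fun z => Real.exp (g z)) ν)
    (hmul : Integrable (fun z => Real.exp (g z) * g z) ν)
    (hexp_add : Integrable (fun z => Real.exp (g z + r * g z)) ν) :
    (∫ z, Real.exp (g z) ∂ν) *
        Real.exp (r * ((∫ z, Real.exp (g z) * g z ∂ν) / ∫ z, Real.exp (g z) ∂ν)) ≤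
      ∫ z, Real.exp (g z + r * g z) ∂ν := by
  set I := ∫ z, Real.exp (g z) ∂ν
  set m := (∫ z, Real.exp (g z) * g z ∂ν) / I with hm
  have hI : I ≠ 0 := (integral_exp_pos hexp).ne'
  have htangent : ∀ z, Real.exp (r * m) * (1 - r * m) * Real.exp (g z) +
      Real.exp (r * m) * r * (Real.exp (g z) * g z) ≤ Real.exp (g z + r * g z) := fun z => by
    calc _ = Real.exp (g z) * Real.exp (r * m) * (r * (g z - m) + 1) := by ring
      _ ≤ Real.exp (g z) * Real.exp (r * m) * Real.exp (r * (g z - m)) := by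
          gcongr; exact Real.add_one_le_exp _
      _ = Real.exp (g z + r * g z) := by simp only [← Real.exp_add]; ring_nf
  calc I * Real.exp (r * m)
      = Real.exp (r * m) * (1 - r * m) * I + Real.exp (r * m) * r * (m * I) := by ring
    _ = ∫ z, Real.exp (r * m) * (1 - r * m) * Real.exp (g z) +
          Real.exp (r * m) * r * (Real.exp (g z) * g z) ∂ν := by
        rw [hm, div_mul_cancel₀ _ hI, integral_add (hexp.const_mul _) (hmul.const_mul _),
          integral_const_mul, integral_const_mul]
    _ ≤ _ := integral_mono ((hexp.const_mul _).add (hmul.const_mul _)) hexp_add htangent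

/-- The entropy is the slope at `s = 0` of `s ↦ (∫ exp (g / (1 - s))) ^ (1 - s)`, which lies above
its tangent there. -/
lemma add_mul_entropy_exp_le [NeZero ν] [IsFiniteMeasure ν] {g : X → ℝ} (hg : Measurable g) {M : ℝ}
    (hM : ∀ z, |g z| ≤ M) {t s : ℝ} (ht : 0 < t) (hts : t + s = 1) :
    ∫ z, Real.exp (g z) ∂ν + s * entropy ν (fun z => Real.exp (g z)) ≤
      (∫ z, Real.exp (g z / t) ∂ν) ^ t := by
  have hdiv : ∀ z, g z + s / t * g z = g z / t := fun z => by
    obtain rfl : s = 1 - t := by linarith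
    field_simp
    ring
  have hexp : Integrable (fun z => Real.exp (g z)) ν := integrable_exp_of_abs_le hg hM
  have hexp_div : Integrable (fun z => Real.exp (g z / t)) ν :=
    integrable_exp_of_abs_le (hg.div_const t) fun z => by
      rw [abs_div, abs_of_pos ht]
      exact div_le_div_of_nonneg_right (hM z) ht.le
  have hjensen := integral_exp_mul_exp_le (r := s / t) hexp
    (hexp.mul_bdd (c := M) hg.aestronglyMeasurable (ae_of_all _ hM))
    (by simpa only [hdiv] using hexp_div)
  simp only [hdiv] at hjensen
  simp only [entropy, Real.log_exp]
  have hI : 0 < ∫ z, Real.exp (g z) ∂ν := integral_exp_pos hexp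
  set I := ∫ z, Real.exp (g z) ∂ν
  set K := ∫ z, Real.exp (g z) * g z ∂ν
  calc I + s * (K - I * Real.log I) = I * (s * (K / I - Real.log I) + 1) := by field_simp; ring
    _ ≤ I * Real.exp (s * (K / I - Real.log I)) := by gcongr; exact Real.add_one_le_exp _
    _ = (I * Real.exp (s / t * (K / I))) ^ t := by
        nth_rw 1 [← Real.exp_log hI]
        nth_rw 4 [← Real.exp_log hI]
        rw [← Real.exp_add, ← Real.exp_add, ← Real.exp_mul]
        obtain rfl : s = 1 - t := by linarith
        congr 1
        field_simp
        ring
    _ ≤ _ := by gcongr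

lemma mul_log_add_one_nonneg {x : ℝ} (hx : 0 ≤ x) : 0 ≤ x * Real.log x + 1 := by
  rcases hx.eq_or_lt with rfl | hx
  · simp
  · have h := mul_le_mul_of_nonneg_left (Real.one_sub_inv_le_log_of_pos hx) hx.le
    rw [mul_sub, mul_inv_cancel₀ hx.ne'] at h
    linarith

lemma integrable_mul_log_of_le [IsFiniteMeasure ν] {f : X → ℝ} (hf : Measurable f)
    (hf_nonneg : ∀ z, 0 ≤ f z) {B : ℝ} (hB : ∀ z, f z ≤ B) :
    Integrable (fun z => f z * Real.log (f z)) ν := by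
  obtain ⟨C, hC⟩ := (isCompact_Icc (a := (0 : ℝ)) (b := B)).exists_bound_of_continuousOn
    Real.continuous_mul_log.continuousOn
  exact .of_bound (Real.continuous_mul_log.measurable.comp hf).aestronglyMeasurable C
    (ae_of_all _ fun z => hC _ ⟨hf_nonneg z, hB z⟩)

lemma lintegral_mul_log_add_one_eq [IsProbabilityMeasure ν] {f : X → ℝ} (hf_nonneg : ∀ z, 0 ≤ f z)
    (hf : Integrable (fun z => f z * Real.log (f z)) ν) :
    ∫⁻ z, ENNReal.ofReal (f z * Real.log (f z) + 1) ∂ν =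
      ENNReal.ofReal (∫ z, f z * Real.log (f z) ∂ν + 1) := by
  have hadd : Integrable (fun z => f z * Real.log (f z) + 1) ν := hf.add (integrable_const 1)
  rw [← ofReal_integral_eq_lintegral_ofReal hadd
    (ae_of_all _ fun z => mul_log_add_one_nonneg (hf_nonneg z)),
    integral_add hf (integrable_const 1)]
  simp

lemma integrable_mul_log_of_lintegral_ne_top [IsFiniteMeasure ν] {f : X → ℝ}
    (hf : AEMeasurable f ν) (hf_nonneg : ∀ z, 0 ≤ f z)
    (h : ∫⁻ z, ENNReal.ofReal (f z * Real.log (f z) + 1) ∂ν ≠ ∞) :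
    Integrable (fun z => f z * Real.log (f z)) ν := by
  have hadd : Integrable (fun z => f z * Real.log (f z) + 1) ν := by
    refine ⟨((Real.continuous_mul_log.measurable.comp_aemeasurable hf).add_const
      1).aestronglyMeasurable, ?_⟩
    rw [hasFiniteIntegral_iff_ofReal (ae_of_all _ fun z => mul_log_add_one_nonneg (hf_nonneg z))]
    exact h.lt_top
  exact (hadd.sub (integrable_const 1)).congr (ae_of_all _ fun z => by simp)

lemma lintegral_mul_log_add_one_le_of_tendsto [IsProbabilityMeasure ν] {f : ℕ → X → ℝ} {k : X → ℝ}
    {R : ℕ → ℝ} {R₀ : ℝ} (hf : ∀ n, Measurable (f n)) (hf_nonneg : ∀ n z, 0 ≤ f n z)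
    (hB : ∀ n, ∃ B, ∀ z, f n z ≤ B) (hlim : ∀ᵐ z ∂ν, Tendsto (fun n => f n z) atTop (𝓝 (k z)))
    (hmean : Tendsto (fun n => ∫ z, f n z ∂ν) atTop (𝓝 (∫ z, k z ∂ν)))
    (hR : Tendsto R atTop (𝓝 R₀)) (hent : ∀ n, entropy ν (f n) ≤ R n) :
    ∫⁻ z, ENNReal.ofReal (k z * Real.log (k z) + 1) ∂ν ≤
      ENNReal.ofReal (R₀ + (∫ z, k z ∂ν) * Real.log (∫ z, k z ∂ν) + 1) := by
  set φ : ℝ → ℝ := fun x => x * Real.log x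
  have hφ : Continuous φ := Real.continuous_mul_log
  have hbound : ∀ n, ∫⁻ z, ENNReal.ofReal (φ (f n z) + 1) ∂ν ≤
      ENNReal.ofReal (R n + φ (∫ z, f n z ∂ν) + 1) := fun n => by
    obtain ⟨B, hB⟩ := hB n
    rw [lintegral_mul_log_add_one_eq (hf_nonneg n)
      (integrable_mul_log_of_le (hf n) (hf_nonneg n) hB)]
    exact ENNReal.ofReal_le_ofReal (add_le_add_left (sub_le_iff_le_add.1 (hent n)) 1)
  calc ∫⁻ z, ENNReal.ofReal (φ (k z) + 1) ∂ν
      = ∫⁻ z, liminf (fun n => ENNReal.ofReal (φ (f n z) + 1)) atTop ∂ν := by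
        refine lintegral_congr_ae ?_
        filter_upwards [hlim] with z hz
        exact (ENNReal.tendsto_ofReal
          (((hφ.tendsto _).comp hz).add_const 1)).liminf_eq.symm
    _ ≤ liminf (fun n => ∫⁻ z, ENNReal.ofReal (φ (f n z) + 1) ∂ν) atTop :=
        lintegral_liminf_le fun n => ((hφ.measurable.comp (hf n)).add_const 1).ennreal_ofReal
    _ ≤ liminf (fun n => ENNReal.ofReal (R n + φ (∫ z, f n z ∂ν) + 1)) atTop :=
        liminf_le_liminf (Eventually.of_forall hbound)
    _ = _ := (ENNReal.tendsto_ofReal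
        ((hR.add ((hφ.tendsto _).comp hmean)).add_const 1)).liminf_eq

theorem entropy_le_of_tendsto [IsProbabilityMeasure ν] {f : ℕ → X → ℝ} {k : X → ℝ} {R : ℕ → ℝ}
    {R₀ : ℝ} (hf : ∀ n, Measurable (f n)) (hf_nonneg : ∀ n z, 0 ≤ f n z)
    (hB : ∀ n, ∃ B, ∀ z, f n z ≤ B) (hk : AEMeasurable k ν) (hk_nonneg : ∀ z, 0 ≤ k z)
    (hlim : ∀ᵐ z ∂ν, Tendsto (fun n => f n z) atTop (𝓝 (k z)))
    (hmean : Tendsto (fun n => ∫ z, f n z ∂ν) atTop (𝓝 (∫ z, k z ∂ν)))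
    (hR : Tendsto R atTop (𝓝 R₀)) (hR_nonneg : ∀ n, 0 ≤ R n) (hent : ∀ n, entropy ν (f n) ≤ R n) :
    Integrable (fun z => k z * Real.log (k z)) ν ∧ entropy ν k ≤ R₀ := by
  have hfatou := lintegral_mul_log_add_one_le_of_tendsto hf hf_nonneg hB hlim hmean hR hent
  have hinteg := integrable_mul_log_of_lintegral_ne_top hk hk_nonneg
    (hfatou.trans_lt ENNReal.ofReal_lt_top).ne
  refine ⟨hinteg, ?_⟩
  have hmean_nonneg : 0 ≤ (∫ z, k z ∂ν) * Real.log (∫ z, k z ∂ν) + 1 :=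
    mul_log_add_one_nonneg (integral_nonneg hk_nonneg)
  rw [lintegral_mul_log_add_one_eq hk_nonneg hinteg,
    ENNReal.ofReal_le_ofReal_iff (by linarith [ge_of_tendsto' hR hR_nonneg])] at hfatou
  rw [entropy]
  linarith

lemma mul_log_div_integral_ae_eq {f : X → ℝ} (hf_nonneg : ∀ z, 0 ≤ f z) (hf : Integrable f ν) :
    (fun z => f z * Real.log (f z / ∫ v, f v ∂ν)) =ᵐ[ν]
      fun z => f z * Real.log (f z) - f z * Real.log (∫ v, f v ∂ν) := by
  have hne : ∀ᵐ z ∂ν, f z ≠ 0 → ∫ v, f v ∂ν ≠ 0 := by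
    by_cases hmean : ∫ v, f v ∂ν = 0
    · filter_upwards [(integral_eq_zero_iff_of_nonneg hf_nonneg hf).1 hmean] with z hz hz'
      exact (hz' hz).elim
    · exact ae_of_all _ fun _ _ => hmean
  filter_upwards [hne] with z hz
  by_cases hfz : f z = 0
  · simp [hfz]
  · rw [Real.log_div hfz (hz hfz), mul_sub]

lemma integrable_mul_log_div_integral {f : X → ℝ} (hf_nonneg : ∀ z, 0 ≤ f z) (hf : Integrable f ν)
    (hlog : Integrable (fun z => f z * Real.log (f z)) ν) :
    Integrable (fun z => f z * Real.log (f z / ∫ v, f v ∂ν)) ν :=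
  (hlog.sub (hf.mul_const _)).congr (mul_log_div_integral_ae_eq hf_nonneg hf).symm

lemma integral_mul_log_div_integral {f : X → ℝ} (hf_nonneg : ∀ z, 0 ≤ f z) (hf : Integrable f ν)
    (hlog : Integrable (fun z => f z * Real.log (f z)) ν) :
    ∫ z, f z * Real.log (f z / ∫ v, f v ∂ν) ∂ν = entropy ν f := by
  rw [integral_congr_ae (mul_log_div_integral_ae_eq hf_nonneg hf),
    integral_sub hlog (hf.mul_const _), integral_mul_const, entropy]

end Entropy

/-! ### Lipschitz constants and slopes along an embedded space -/

section Slope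

variable {H E : Type*} [NormedAddCommGroup H] [NormedSpace ℝ H] [NormedAddCommGroup E]
  [NormedSpace ℝ E] {T : H →L[ℝ] E} {Ω : Set E}

/-- `g` is Lipschitz on `Ω` with constant `L` along the image of `T`, where displacements `T c` are
measured by `‖c‖`. -/
def CMLipschitz (T : H →L[ℝ] E) (Ω : Set E) (L : ℝ) (g : E → ℝ) : Prop :=
  ∀ x ∈ Ω, ∀ c, x + T c ∈ Ω → |g (x + T c) - g x| ≤ L * ‖c‖

/-- At the point `z`, the slope of `g` on `Ω` along the image of `T` is at most `a`. -/
def CMSlopeLE (T : H →L[ℝ] E) (Ω : Set E) (g : E → ℝ) (z : E) (a : ℝ) : Prop :=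
  ∀ ε > 0, ∀ᶠ c in 𝓝[(fun c => z + T c) ⁻¹' Ω] 0, |g (z + T c) - g z| ≤ (a + ε) * ‖c‖

lemma CMLipschitz.comp {L : ℝ} {g : E → ℝ} (hg : CMLipschitz T Ω L g) {φ : ℝ → ℝ} {K : ℝ}
    (hK : 0 ≤ K) (hφ : ∀ x y, |φ x - φ y| ≤ K * |x - y|) :
    CMLipschitz T Ω (K * L) (φ ∘ g) := fun x hx c hc =>
  calc |φ (g (x + T c)) - φ (g x)| ≤ K * |g (x + T c) - g x| := hφ _ _
    _ ≤ K * (L * ‖c‖) := by gcongr; exact hg x hx c hc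
    _ = K * L * ‖c‖ := by ring

lemma CMSlopeLE.tendsto {g : E → ℝ} {z : E} {a : ℝ} (h : CMSlopeLE T Ω g z a) :
    Tendsto (fun c => g (z + T c)) (𝓝[(fun c => z + T c) ⁻¹' Ω] 0) (𝓝 (g z)) := by
  have hbound : Tendsto (fun c : H => (a + 1) * ‖c‖) (𝓝[(fun c => z + T c) ⁻¹' Ω] 0) (𝓝 0) := by
    have hcont : Continuous fun c : H => (a + 1) * ‖c‖ := by fun_prop
    simpa using (hcont.tendsto 0).mono_left nhdsWithin_le_nhds
  exact tendsto_iff_norm_sub_tendsto_zero.2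
    (squeeze_zero' (.of_forall fun _ => norm_nonneg _) (h 1 one_pos) hbound)

lemma CMSlopeLE.of_tendsto {g : E → ℝ} {z : E} {a : ℝ} {b : ℝ → ℝ}
    (hb : Tendsto b (𝓝[>] 0) (𝓝 a))
    (h : ∀ ε > 0, ∀ᶠ c in 𝓝[(fun c => z + T c) ⁻¹' Ω] 0, |g (z + T c) - g z| ≤ b ε * ‖c‖) :
    CMSlopeLE T Ω g z a := fun ε hε => by
  obtain ⟨η, hη, hη_pos⟩ := ((hb.eventually_lt_const (lt_add_of_pos_right a hε)).and
    self_mem_nhdsWithin).exists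
  filter_upwards [h η hη_pos] with c hc
  exact hc.trans (by gcongr)

lemma CMSlopeLE.comp_hasDerivAt {g : E → ℝ} {z : E} {a : ℝ} (h : CMSlopeLE T Ω g z a) {φ : ℝ → ℝ}
    {φ' : ℝ} (hφ : HasDerivAt φ φ' (g z)) : CMSlopeLE T Ω (φ ∘ g) z (|φ'| * a) := by
  have hb : Tendsto (fun ε : ℝ => (|φ'| + ε) * (a + ε)) (𝓝[>] 0) (𝓝 (|φ'| * a)) := by
    have hcont : Continuous fun ε : ℝ => (|φ'| + ε) * (a + ε) := by fun_prop
    simpa using (hcont.tendsto 0).mono_left nhdsWithin_le_nhds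
  refine .of_tendsto hb fun ε hε => ?_
  filter_upwards [h ε hε, h.tendsto.eventually (hφ.isLittleO.def hε)] with c hc hφc
  simp only [Real.norm_eq_abs, smul_eq_mul] at hφc
  have htri := abs_add_le (φ (g (z + T c)) - φ (g z) - (g (z + T c) - g z) * φ')
    ((g (z + T c) - g z) * φ')
  rw [sub_add_cancel, abs_mul] at htri
  calc |φ (g (z + T c)) - φ (g z)|
      ≤ (|φ'| + ε) * |g (z + T c) - g z| := by linarith
    _ ≤ (|φ'| + ε) * ((a + ε) * ‖c‖) := by gcongr
    _ = (|φ'| + ε) * (a + ε) * ‖c‖ := by ring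

lemma mem_closure_add_mem_interior (hΩ : StrictConvex ℝ Ω) {z : E} (hz : z ∈ Ω) {c : H}
    (hc : z + T c ∈ Ω) (hTc : T c ≠ 0) : c ∈ closure {d | z + T d ∈ interior Ω} := by
  have hlim : Tendsto (fun η : ℝ => (1 - η) • c) (𝓝[>] 0) (𝓝 c) := by
    have hcont : Continuous fun η : ℝ => (1 - η) • c := by fun_prop
    simpa using (hcont.tendsto 0).mono_left nhdsWithin_le_nhds
  refine mem_closure_of_tendsto hlim ?_
  filter_upwards [Ioo_mem_nhdsGT (zero_lt_one (α := ℝ))] with η hη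
  have hseg : z + T ((1 - η) • c) = η • z + (1 - η) • (z + T c) := by rw [map_smul]; module
  rw [hseg]
  exact hΩ hz hc (by simpa using hTc) hη.1 (sub_pos.2 hη.2) (by ring)

end Slope

/-! ### The sup-convolution -/

section SupConv

variable {H E : Type*} [NormedAddCommGroup H] [NormedSpace ℝ H] [TopologicalSpace.SeparableSpace H]
  [NormedAddCommGroup E] [NormedSpace ℝ E] {T : H →L[ℝ] E} {Ω : Set E} {g : E → ℝ}
  {κ L a : ℝ} {z : E}

/-- The exponential of the sup-convolution `sup_c (g (z + T c) - κ ‖c‖² / 2)` over the `c` with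
`z + T c ∈ Ω`. To keep it measurable, the supremum only runs over a countable dense set of
directions `c`, and over `c = 0`. -/
def supConv (T : H →L[ℝ] E) (Ω : Set E) (κ : ℝ) (g : E → ℝ) (z : E) : ℝ≥0∞ :=
  ENNReal.ofReal (Real.exp (g z)) ⊔ ⨆ n : ℕ, Ω.indicator
    (fun x => ENNReal.ofReal (Real.exp (g x - κ / 2 * ‖TopologicalSpace.denseSeq H n‖ ^ 2)))
    (z + T (TopologicalSpace.denseSeq H n))

lemma measurable_supConv [MeasurableSpace E] [BorelSpace E] (T : H →L[ℝ] E)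
    (hΩ : MeasurableSet Ω) (κ : ℝ) (hg : Measurable g) : Measurable (supConv T Ω κ g) := by
  refine hg.exp.ennreal_ofReal.sup (.iSup fun n => ?_)
  exact (((hg.sub_const _).exp.ennreal_ofReal).indicator hΩ).comp
    (continuous_id.add continuous_const).measurable

lemma le_supConv_self : ENNReal.ofReal (Real.exp (g z)) ≤ supConv T Ω κ g z := le_sup_left

lemma supConv_le {y : ℝ} (hy : 0 ≤ y)
    (h : ∀ c, z + T c ∈ Ω → g (z + T c) - κ / 2 * ‖c‖ ^ 2 ≤ g z + y) :
    supConv T Ω κ g z ≤ ENNReal.ofReal (Real.exp (g z + y)) := by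
  refine sup_le (ENNReal.ofReal_le_ofReal (Real.exp_le_exp.2 (by linarith)))
    (iSup_le fun n => Set.indicator_apply_le' (fun hn => ?_) fun _ => zero_le)
  exact ENNReal.ofReal_le_ofReal (Real.exp_le_exp.2 (h _ hn))

lemma le_supConv (hΩ : StrictConvex ℝ Ω) (hκ : 0 ≤ κ) (hL : CMLipschitz T Ω L g) (hz : z ∈ Ω)
    {c : H} (hc : z + T c ∈ Ω) :
    ENNReal.ofReal (Real.exp (g (z + T c) - κ / 2 * ‖c‖ ^ 2)) ≤ supConv T Ω κ g z := by
  by_cases hTc : T c = 0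
  · refine le_trans (ENNReal.ofReal_le_ofReal (Real.exp_le_exp.2 ?_)) le_supConv_self
    rw [hTc, add_zero]
    exact sub_le_self _ (by positivity)
  -- By strict convexity the segment from `z` to `z + T c` runs through the interior of `Ω`, so `c`
  -- is a limit of dense directions which stay in `Ω`.
  have hc_closure : c ∈ closure ({d | z + T d ∈ interior Ω} ∩
      Set.range (TopologicalSpace.denseSeq H)) := by
    have hopen : IsOpen {d | z + T d ∈ interior Ω} :=
      isOpen_interior.preimage (continuous_const.add T.continuous)
    have hdense : Dense (Set.range (TopologicalSpace.denseSeq H)) :=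
      TopologicalSpace.denseRange_denseSeq H
    exact closure_minimal (hdense.open_subset_closure_inter hopen) isClosed_closure
      (mem_closure_add_mem_interior hΩ hz hc hTc)
  have hcont : Continuous fun d : H => ENNReal.ofReal
      (Real.exp (g (z + T c) - L * ‖d - c‖ - κ / 2 * ‖d‖ ^ 2)) :=
    ENNReal.continuous_ofReal.comp (by fun_prop)
  have hclosed := isClosed_le hcont (continuous_const (y := supConv T Ω κ g z))
  have hmem := closure_minimal (fun d hd => ?_) hclosed hc_closure
  · simpa using hmem
  obtain ⟨hd, n, rfl⟩ := hd
  have hdΩ := interior_subset hd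
  have hshift : z + T c + T (TopologicalSpace.denseSeq H n - c) =
      z + T (TopologicalSpace.denseSeq H n) := by rw [map_sub]; abel
  have hLip := hL _ hc _ (hshift ▸ hdΩ)
  rw [hshift] at hLip
  rw [Set.mem_ofPred_eq]
  refine le_sup_of_le_right (le_iSup_of_le n ?_)
  rw [Set.indicator_of_mem hdΩ]
  exact ENNReal.ofReal_le_ofReal (Real.exp_le_exp.2 (by linarith [(abs_le.1 hLip).1]))

lemma mul_sub_half_mul_sq_le (hκ : 0 < κ) (a x : ℝ) : a * x - κ / 2 * x ^ 2 ≤ a ^ 2 / (2 * κ) := by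
  rw [le_div_iff₀ (by positivity)]
  linarith [sq_nonneg (a - κ * x)]

lemma CMLipschitz.supConv_le (hκ : 0 < κ) (hL : CMLipschitz T Ω L g) (hz : z ∈ Ω) :
    supConv T Ω κ g z ≤ ENNReal.ofReal (Real.exp (g z + L ^ 2 / (2 * κ))) :=
  NLSGibbs.supConv_le (by positivity) fun c hc => by
    linarith [(abs_le.1 (hL z hz c hc)).2, mul_sub_half_mul_sq_le hκ L ‖c‖]

lemma CMSlopeLE.eventually_supConv_le (hL : CMLipschitz T Ω L g) (hz : z ∈ Ω)
    (h : CMSlopeLE T Ω g z a) {ε : ℝ} (hε : 0 < ε) :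
    ∀ᶠ κ in atTop,
      supConv T Ω κ g z ≤ ENNReal.ofReal (Real.exp (g z + (a + ε) ^ 2 / (2 * κ))) := by
  obtain ⟨δ, hδ, hnear⟩ := Metric.eventually_nhds_iff.1 (eventually_nhdsWithin_iff.1 (h ε hε))
  filter_upwards [eventually_ge_atTop (2 * L / δ), eventually_gt_atTop 0] with κ hκ hκ_pos
  refine NLSGibbs.supConv_le (by positivity) fun c hc => ?_
  rcases lt_or_ge ‖c‖ δ with hcδ | hcδ
  · linarith [(abs_le.1 (hnear (by simpa using hcδ) hc)).2,
      mul_sub_half_mul_sq_le hκ_pos (a + ε) ‖c‖]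
  · have hfar : 2 * L ≤ κ * ‖c‖ := ((div_le_iff₀ hδ).1 hκ).trans (by gcongr)
    have hpos : 0 ≤ (a + ε) ^ 2 / (2 * κ) := by positivity
    nlinarith [(abs_le.1 (hL z hz c hc)).2, norm_nonneg c]

lemma CMPrekopaLeindler.lintegral_exp_rpow_le_lintegral_supConv [MeasurableSpace E] [BorelSpace E]
    {ν : Measure E} [IsProbabilityMeasure ν] {α : ℝ} (h : CMPrekopaLeindler T α ν) (hα : 0 ≤ α)
    (hΩ : StrictConvex ℝ Ω) (hΩ_meas : MeasurableSet Ω) (hνΩ : ∀ᵐ z ∂ν, z ∈ Ω) {t s : ℝ}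
    (ht : 0 < t) (hs : 0 < s) (hts : t + s = 1) (hg : Measurable g) (hL : CMLipschitz T Ω L g) :
    (∫⁻ z, ENNReal.ofReal (Real.exp (g z / t)) ∂ν) ^ t ≤
      ∫⁻ z, supConv T Ω (α * t / s) g z ∂ν := by
  have hexp : Measurable fun z => ENNReal.ofReal (Real.exp (g z / t)) :=
    (hg.div_const t).exp.ennreal_ofReal
  have key := h ht hs hts (hexp.indicator hΩ_meas) (measurable_one.indicator hΩ_meas)
    (measurable_supConv T hΩ_meas (α * t / s) hg) fun z c => by
      by_cases hx : z + s • T c ∈ Ω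
      swap; · simp [Set.indicator_of_notMem hx, ENNReal.zero_rpow_of_pos ht]
      by_cases hy : z - t • T c ∈ Ω
      swap; · simp [Set.indicator_of_notMem hy, ENNReal.zero_rpow_of_pos hs]
      have hz := hΩ.convex hx hy ht.le hs.le hts
      rw [smul_add_smul_shift hts] at hz
      rw [← map_smul] at hx ⊢
      refine le_trans (le_of_eq ?_) (le_supConv hΩ (by positivity) hL hz hx)
      rw [Set.indicator_of_mem hx, Set.indicator_of_mem hy, Pi.one_apply, ENNReal.one_rpow,
        mul_one, ENNReal.ofReal_rpow_of_pos (Real.exp_pos _), ← Real.exp_mul,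
        ← ENNReal.ofReal_mul (Real.exp_pos _).le, ← Real.exp_add, norm_smul,
        Real.norm_of_nonneg hs.le]
      congr 2
      field_simp
      ring
  rwa [lintegral_indicator_one hΩ_meas, lintegral_indicator hΩ_meas,
    Measure.restrict_eq_self_of_ae_mem hνΩ, prob_compl_eq_zero_iff hΩ_meas |>.1 hνΩ,
    ENNReal.one_rpow, mul_one] at key

end SupConv

/-! ### The logarithmic Sobolev inequality along an embedded space -/

section LogSqAddSq

variable {e : ℝ}

lemma hasDerivAt_log_sq_add_sq (he : 0 < e) (x : ℝ) :
    HasDerivAt (fun x => Real.log (x ^ 2 + e ^ 2)) (2 * x / (x ^ 2 + e ^ 2)) x := by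
  have h := (((hasDerivAt_id x).pow 2).add_const (e ^ 2)).log (by positivity : (x ^ 2 + e ^ 2) ≠ 0)
  simpa using h

lemma abs_log_sq_add_sq_sub_le (he : 0 < e) (x y : ℝ) :
    |Real.log (x ^ 2 + e ^ 2) - Real.log (y ^ 2 + e ^ 2)| ≤ 1 / e * |x - y| := by
  refine convex_univ.norm_image_sub_le_of_norm_hasDerivWithin_le
    (fun x _ => (hasDerivAt_log_sq_add_sq he x).hasDerivWithinAt) (fun x _ => ?_)
    (Set.mem_univ y) (Set.mem_univ x)
  rw [Real.norm_eq_abs, abs_div, abs_of_pos (by positivity : 0 < x ^ 2 + e ^ 2), abs_mul,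
    abs_two, div_le_div_iff₀ (by positivity) he, one_mul, ← sq_abs x]
  nlinarith [sq_nonneg (|x| - e)]

end LogSqAddSq

section LogSobolev

variable {H E : Type*} [NormedAddCommGroup H] [NormedSpace ℝ H] [TopologicalSpace.SeparableSpace H]
  [NormedAddCommGroup E] [NormedSpace ℝ E] {T : H →L[ℝ] E} {Ω : Set E} {g : E → ℝ}
  {α L M : ℝ} {z : E}

/-- The difference quotient `(exp (sup-convolution of g) - exp g) / s` at `s = 1 / (n + 2)`, for the
cost with curvature `κ = α (1 - s) / s = α (n + 1)`. -/
def supConvQuotient (T : H →L[ℝ] E) (Ω : Set E) (α : ℝ) (g : E → ℝ) (n : ℕ) (z : E) : ℝ≥0∞ :=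
  (n + 2) * (supConv T Ω (α * (n + 1)) g z - ENNReal.ofReal (Real.exp (g z)))

lemma measurable_supConvQuotient [MeasurableSpace E] [BorelSpace E] (T : H →L[ℝ] E)
    (hΩ : MeasurableSet Ω) (hg : Measurable g) (n : ℕ) :
    Measurable (supConvQuotient T Ω α g n) :=
  ((measurable_supConv T hΩ _ hg).sub hg.exp.ennreal_ofReal).const_mul _

lemma exp_sub_one_le_mul_exp (y : ℝ) : Real.exp y - 1 ≤ y * Real.exp y := by
  have h := mul_le_mul_of_nonneg_left (Real.add_one_le_exp (-y)) (Real.exp_pos y).le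
  rw [← Real.exp_add, add_neg_cancel, Real.exp_zero] at h
  linarith

lemma supConvQuotient_le {n : ℕ} {r : ℝ}
    (h : supConv T Ω (α * (n + 1)) g z ≤ ENNReal.ofReal (Real.exp (g z + r))) :
    supConvQuotient T Ω α g n z ≤
      ENNReal.ofReal ((n + 2) * (Real.exp (g z) * (r * Real.exp r))) := by
  have hcast : ((n : ℝ≥0∞) + 2) = ENNReal.ofReal (n + 2) := by
    rw [ENNReal.ofReal_add (by positivity) zero_le_two]
    simp
  have hexp : Real.exp (g z + r) - Real.exp (g z) ≤ Real.exp (g z) * (r * Real.exp r) := by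
    rw [Real.exp_add]
    linarith [mul_le_mul_of_nonneg_left (exp_sub_one_le_mul_exp r) (Real.exp_pos (g z)).le]
  rw [supConvQuotient, hcast, ENNReal.ofReal_mul (by positivity)]
  gcongr
  calc _ ≤ ENNReal.ofReal (Real.exp (g z + r)) - ENNReal.ofReal (Real.exp (g z)) := by gcongr
    _ ≤ _ := by
        rw [← ENNReal.ofReal_sub _ (Real.exp_pos _).le]
        exact ENNReal.ofReal_le_ofReal hexp

lemma CMLipschitz.supConvQuotient_le (hα : 0 < α) (hL : CMLipschitz T Ω L g) (hz : z ∈ Ω) (n : ℕ) :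
    supConvQuotient T Ω α g n z ≤
      ENNReal.ofReal (Real.exp (g z) * (L ^ 2 / α * Real.exp (L ^ 2 / α))) := by
  refine (NLSGibbs.supConvQuotient_le (hL.supConv_le (by positivity) hz)).trans
    (ENNReal.ofReal_le_ofReal ?_)
  have hquot : (n + 2) * (L ^ 2 / (2 * (α * (n + 1)))) ≤ L ^ 2 / α := by
    rw [mul_div_assoc', div_le_div_iff₀ (by positivity) hα]
    nlinarith [mul_nonneg (mul_nonneg (sq_nonneg L) hα.le) n.cast_nonneg]
  have hle : L ^ 2 / (2 * (α * (n + 1))) ≤ L ^ 2 / α := by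
    refine le_trans (le_mul_of_one_le_left (by positivity) ?_) hquot
    linarith [n.cast_nonneg (α := ℝ)]
  calc _ = Real.exp (g z) * ((n + 2) * (L ^ 2 / (2 * (α * (n + 1)))) *
        Real.exp (L ^ 2 / (2 * (α * (n + 1))))) := by ring
    _ ≤ _ := by gcongr

lemma tendsto_quotient_mul_exp (α D b : ℝ) :
    Tendsto (fun n : ℕ => ((n : ℝ) + 2) *
      (b * (D / (2 * (α * (n + 1))) * Real.exp (D / (2 * (α * (n + 1))))))) atTop
      (𝓝 (b * (D / (2 * α)))) := by
  have hinv : Tendsto (fun n : ℕ => 1 / ((n : ℝ) + 1)) atTop (𝓝 0) :=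
    tendsto_one_div_add_atTop_nhds_zero_nat
  have hcont : Continuous fun x : ℝ =>
      (1 + x) * (b * (D / (2 * α) * Real.exp (D / (2 * α) * x))) := by fun_prop
  have hlim := (hcont.tendsto 0).comp hinv
  simp only [add_zero, one_mul, mul_zero, Real.exp_zero, mul_one] at hlim
  refine hlim.congr fun n => ?_
  have hquot : D / (2 * (α * (n + 1))) = D / (2 * α) * (1 / ((n : ℝ) + 1)) := by
    rw [div_mul_div_comm, mul_one, mul_assoc]
  rw [hquot, Function.comp_apply]
  field_simp
  ring

lemma CMSlopeLE.limsup_supConvQuotient_le (hα : 0 < α) (hL : CMLipschitz T Ω L g) (hz : z ∈ Ω)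
    {a : ℝ} (h : CMSlopeLE T Ω g z a) :
    limsup (fun n => supConvQuotient T Ω α g n z) atTop ≤
      ENNReal.ofReal (Real.exp (g z) * (a ^ 2 / (2 * α))) := by
  have hκ : Tendsto (fun n : ℕ => α * ((n : ℝ) + 1)) atTop atTop :=
    (tendsto_atTop_add_const_right _ _ tendsto_natCast_atTop_atTop).const_mul_atTop hα
  have hle : ∀ ε > 0, limsup (fun n => supConvQuotient T Ω α g n z) atTop ≤
      ENNReal.ofReal (Real.exp (g z) * ((a + ε) ^ 2 / (2 * α))) := fun ε hε => by
    rw [← (ENNReal.tendsto_ofReal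
      (tendsto_quotient_mul_exp α ((a + ε) ^ 2) (Real.exp (g z)))).limsup_eq]
    refine limsup_le_limsup ?_
    filter_upwards [hκ.eventually (h.eventually_supConv_le hL hz hε)] with n hn
    exact supConvQuotient_le hn
  have hlim : Tendsto (fun ε : ℝ => ENNReal.ofReal (Real.exp (g z) * ((a + ε) ^ 2 / (2 * α))))
      (𝓝[>] 0) (𝓝 (ENNReal.ofReal (Real.exp (g z) * (a ^ 2 / (2 * α))))) := by
    have hcont : Continuous fun ε : ℝ =>
        ENNReal.ofReal (Real.exp (g z) * ((a + ε) ^ 2 / (2 * α))) :=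
      ENNReal.continuous_ofReal.comp (by fun_prop)
    simpa using (hcont.tendsto 0).mono_left nhdsWithin_le_nhds
  exact ge_of_tendsto hlim (eventually_nhdsWithin_of_forall hle)

variable [MeasurableSpace E] [BorelSpace E] {ν : Measure E} [IsProbabilityMeasure ν]

lemma CMPrekopaLeindler.ofReal_integral_exp_add_mul_entropy_le_lintegral_supConv
    (h : CMPrekopaLeindler T α ν) (hα : 0 ≤ α) (hΩ : StrictConvex ℝ Ω) (hΩ_meas : MeasurableSet Ω)
    (hνΩ : ∀ᵐ z ∂ν, z ∈ Ω) (hg : Measurable g) (hM : ∀ z, |g z| ≤ M) (hL : CMLipschitz T Ω L g)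
    {t s : ℝ} (ht : 0 < t) (hs : 0 < s) (hts : t + s = 1) :
    ENNReal.ofReal (∫ z, Real.exp (g z) ∂ν + s * entropy ν fun z => Real.exp (g z)) ≤
      ∫⁻ z, supConv T Ω (α * t / s) g z ∂ν := by
  have hexp_div := integrable_exp_of_abs_le (ν := ν) (hg.div_const t) fun z =>
    (abs_div (g z) t).trans_le (div_le_div_of_nonneg_right (hM z) (abs_nonneg t))
  have hPL := h.lintegral_exp_rpow_le_lintegral_supConv hα hΩ hΩ_meas hνΩ ht hs hts hg hL
  rw [← ofReal_integral_eq_lintegral_ofReal hexp_div (ae_of_all _ fun z => (Real.exp_pos _).le),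
    ENNReal.ofReal_rpow_of_nonneg (integral_nonneg fun z => (Real.exp_pos _).le) ht.le] at hPL
  exact (ENNReal.ofReal_le_ofReal (add_mul_entropy_exp_le hg hM ht hts)).trans hPL

lemma CMPrekopaLeindler.ofReal_entropy_exp_le_lintegral_supConvQuotient
    (h : CMPrekopaLeindler T α ν) (hα : 0 ≤ α) (hΩ : StrictConvex ℝ Ω) (hΩ_meas : MeasurableSet Ω)
    (hνΩ : ∀ᵐ z ∂ν, z ∈ Ω) (hg : Measurable g) (hM : ∀ z, |g z| ≤ M) (hL : CMLipschitz T Ω L g)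
    (n : ℕ) :
    ENNReal.ofReal (entropy ν fun z => Real.exp (g z)) ≤ ∫⁻ z, supConvQuotient T Ω α g n z ∂ν := by
  have hs : 0 < (n + 2 : ℝ)⁻¹ := by positivity
  have hsup := h.ofReal_integral_exp_add_mul_entropy_le_lintegral_supConv hα hΩ hΩ_meas hνΩ hg hM hL
    (t := (n + 1) * (n + 2 : ℝ)⁻¹) (by positivity) hs (by field_simp; ring)
  have hκ : α * ((n + 1) * (n + 2 : ℝ)⁻¹) / (n + 2 : ℝ)⁻¹ = α * (n + 1) := by field_simp
  have hs_inv : ((n : ℝ≥0∞) + 2) = (ENNReal.ofReal (n + 2 : ℝ)⁻¹)⁻¹ := by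
    rw [← ENNReal.ofReal_inv_of_pos hs, inv_inv, ENNReal.ofReal_add (by positivity) zero_le_two]
    simp
  have hexp : ENNReal.ofReal (∫ z, Real.exp (g z) ∂ν) =
      ∫⁻ z, ENNReal.ofReal (Real.exp (g z)) ∂ν :=
    ofReal_integral_eq_lintegral_ofReal (integrable_exp_of_abs_le hg hM)
      (ae_of_all _ fun z => (Real.exp_pos _).le)
  have hmeas : Measurable fun z =>
      supConv T Ω (α * (n + 1)) g z - ENNReal.ofReal (Real.exp (g z)) :=
    (measurable_supConv T hΩ_meas _ hg).sub hg.exp.ennreal_ofReal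
  simp only [supConvQuotient]
  rw [lintegral_const_mul _ hmeas, lintegral_sub hg.exp.ennreal_ofReal
    (hexp ▸ ENNReal.ofReal_ne_top) (ae_of_all _ fun z => le_supConv_self), ← hexp, hs_inv, mul_comm,
    ← div_eq_mul_inv, ENNReal.le_div_iff_mul_le (.inl (by simpa using hs))
    (.inl ENNReal.ofReal_ne_top), mul_comm, ← ENNReal.ofReal_mul hs.le]
  rw [hκ] at hsup
  refine le_trans (le_of_eq ?_) (tsub_le_tsub_right hsup _)
  rw [← ENNReal.ofReal_sub _ (integral_nonneg fun z => (Real.exp_pos _).le), add_sub_cancel_left]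

theorem CMPrekopaLeindler.ofReal_entropy_exp_le (h : CMPrekopaLeindler T α ν) (hα : 0 < α)
    (hΩ : StrictConvex ℝ Ω) (hΩ_meas : MeasurableSet Ω) (hνΩ : ∀ᵐ z ∂ν, z ∈ Ω) (hg : Measurable g)
    (hM : ∀ z, |g z| ≤ M) (hL : CMLipschitz T Ω L g) {G : E → ℝ}
    (hG : ∀ z ∈ Ω, CMSlopeLE T Ω g z (G z)) :
    ENNReal.ofReal (entropy ν fun z => Real.exp (g z)) ≤
      ∫⁻ z, ENNReal.ofReal (Real.exp (g z) * (G z ^ 2 / (2 * α))) ∂ν := by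
  have hbound : ∀ n, ∀ᵐ z ∂ν, supConvQuotient T Ω α g n z ≤
      ENNReal.ofReal (Real.exp M * (L ^ 2 / α * Real.exp (L ^ 2 / α))) := fun n => by
    filter_upwards [hνΩ] with z hz
    refine (hL.supConvQuotient_le hα hz n).trans (ENNReal.ofReal_le_ofReal ?_)
    gcongr
    exact (abs_le.1 (hM z)).2
  calc ENNReal.ofReal (entropy ν fun z => Real.exp (g z))
      ≤ limsup (fun n => ∫⁻ z, supConvQuotient T Ω α g n z ∂ν) atTop :=
        le_limsup_of_frequently_le (.of_forall
          (h.ofReal_entropy_exp_le_lintegral_supConvQuotient hα.le hΩ hΩ_meas hνΩ hg hM hL))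
    _ ≤ ∫⁻ z, limsup (fun n => supConvQuotient T Ω α g n z) atTop ∂ν :=
        limsup_lintegral_le _ (measurable_supConvQuotient T hΩ_meas hg) hbound (by simp)
    _ ≤ _ := by
        refine lintegral_mono_ae ?_
        filter_upwards [hνΩ] with z hz
        exact (hG z hz).limsup_supConvQuotient_le hα hL hz

lemma CMPrekopaLeindler.entropy_sq_add_sq_le (h : CMPrekopaLeindler T α ν) (hα : 0 < α)
    (hΩ : StrictConvex ℝ Ω) (hΩ_meas : MeasurableSet Ω) (hνΩ : ∀ᵐ z ∂ν, z ∈ Ω) {f G : E → ℝ}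
    (hf : Measurable f) (hM : ∀ z, |f z| ≤ M) (hL : CMLipschitz T Ω L f)
    (hG : ∀ z ∈ Ω, CMSlopeLE T Ω f z (G z)) (hG_sq : Integrable (fun z => G z ^ 2) ν) {e : ℝ}
    (he : 0 < e) :
    entropy ν (fun z => f z ^ 2 + e ^ 2) ≤ 2 / α * ∫ z, G z ^ 2 ∂ν := by
  have hpos : ∀ z, 0 < f z ^ 2 + e ^ 2 := fun z => by positivity
  have hlog_bound : ∀ z, |Real.log (f z ^ 2 + e ^ 2)| ≤
      max |Real.log (e ^ 2)| |Real.log (M ^ 2 + e ^ 2)| := fun z => by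
    have hfM : f z ^ 2 ≤ M ^ 2 := sq_le_sq' (abs_le.1 (hM z)).1 (abs_le.1 (hM z)).2
    exact abs_le_max_abs_abs (Real.log_le_log (by positivity) (le_add_of_nonneg_left (sq_nonneg _)))
      (Real.log_le_log (hpos z) (by gcongr))
  have hent := h.ofReal_entropy_exp_le hα hΩ hΩ_meas hνΩ (by fun_prop) hlog_bound
    (hL.comp (by positivity) (abs_log_sq_add_sq_sub_le he))
    fun z hz => (hG z hz).comp_hasDerivAt (hasDerivAt_log_sq_add_sq he _)
  simp only [Real.exp_log (hpos _)] at hent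
  rw [← integral_const_mul, ← ENNReal.ofReal_le_ofReal_iff
    (integral_nonneg fun z => mul_nonneg (by positivity) (sq_nonneg (G z))),
    ofReal_integral_eq_lintegral_ofReal (hG_sq.const_mul _)
      (ae_of_all _ fun z => mul_nonneg (by positivity) (sq_nonneg (G z)))]
  refine hent.trans (lintegral_mono fun z => ENNReal.ofReal_le_ofReal ?_)
  have hdiv : f z ^ 2 / (f z ^ 2 + e ^ 2) ≤ 1 :=
    (div_le_one (hpos z)).2 (le_add_of_nonneg_right (sq_nonneg e))
  calc (f z ^ 2 + e ^ 2) * ((|2 * f z / (f z ^ 2 + e ^ 2)| * G z) ^ 2 / (2 * α))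
      = 2 / α * G z ^ 2 * (f z ^ 2 / (f z ^ 2 + e ^ 2)) := by
        rw [mul_pow, sq_abs]
        have := (hpos z).ne'
        field_simp
    _ ≤ 2 / α * G z ^ 2 := mul_le_of_le_one_right (by positivity) hdiv

theorem CMPrekopaLeindler.entropy_sq_le_of_tendsto (h : CMPrekopaLeindler T α ν) (hα : 0 < α)
    (hΩ : StrictConvex ℝ Ω) (hΩ_meas : MeasurableSet Ω) (hνΩ : ∀ᵐ z ∂ν, z ∈ Ω)
    {f G : ℕ → E → ℝ} (hf : ∀ n, Measurable (f n)) (hM : ∀ n, ∃ M, ∀ z, |f n z| ≤ M)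
    (hL : ∀ n, ∃ L, CMLipschitz T Ω L (f n)) (hG : ∀ n, ∀ z ∈ Ω, CMSlopeLE T Ω (f n) z (G n z))
    (hG_meas : ∀ n, AEStronglyMeasurable (G n) ν) {D : E → ℝ} (hD : MemLp D 2 ν)
    (hfD : ∀ n, ∀ᵐ z ∂ν, |f n z| ≤ D z) (hGD : ∀ n, ∀ᵐ z ∂ν, |G n z| ≤ D z) {F₀ G₀ : E → ℝ}
    (hf_lim : ∀ᵐ z ∂ν, Tendsto (f · z) atTop (𝓝 (F₀ z)))
    (hG_lim : ∀ᵐ z ∂ν, Tendsto (G · z) atTop (𝓝 (G₀ z))) :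
    Integrable (fun z => F₀ z ^ 2 * Real.log (F₀ z ^ 2)) ν ∧
      entropy ν (fun z => F₀ z ^ 2) ≤ 2 / α * ∫ z, G₀ z ^ 2 ∂ν := by
  set e : ℕ → ℝ := fun n => 1 / ((n : ℝ) + 1)
  have he_pos : ∀ n, 0 < e n := fun n => by positivity
  have he_le : ∀ n, e n ^ 2 ≤ 1 := fun n =>
    pow_le_one₀ (he_pos n).le ((div_le_one (by positivity)).2 (by simp))
  have he_lim : Tendsto e atTop (𝓝 0) := tendsto_one_div_add_atTop_nhds_zero_nat
  have hG_memLp : ∀ n, MemLp (G n) 2 ν := fun n => hD.mono' (hG_meas n) (hGD n)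
  have hsq_lim : ∀ᵐ z ∂ν, Tendsto (fun n => f n z ^ 2 + e n ^ 2) atTop (𝓝 (F₀ z ^ 2)) := by
    filter_upwards [hf_lim] with z hz
    simpa using (hz.pow 2).add (he_lim.pow 2)
  have hD_sq : Integrable (fun z => D z ^ 2 + 1) ν := hD.integrable_sq.add (integrable_const 1)
  refine NLSGibbs.entropy_le_of_tendsto (R := fun n => 2 / α * ∫ z, G n z ^ 2 ∂ν)
    (fun n => ((hf n).pow_const 2).add_const _) (fun n z => by positivity) (fun n => ?_)
    ((aemeasurable_of_tendsto_metrizable_ae' (fun n => (hf n).aemeasurable) hf_lim).pow_const 2)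
    (fun z => sq_nonneg _) hsq_lim ?_ (.const_mul _ ?_)
    (fun n => mul_nonneg (by positivity) (integral_nonneg fun z => sq_nonneg _)) fun n => ?_
  · obtain ⟨M, hM⟩ := hM n
    exact ⟨M ^ 2 + e n ^ 2, fun z =>
      add_le_add_left (sq_le_sq' (abs_le.1 (hM z)).1 (abs_le.1 (hM z)).2) _⟩
  · refine tendsto_integral_of_dominated_convergence _
      (fun n => (((hf n).pow_const 2).add_const _).aestronglyMeasurable) hD_sq (fun n => ?_) hsq_lim
    filter_upwards [hfD n] with z hz
    rw [Real.norm_of_nonneg (by positivity)]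
    exact add_le_add (sq_le_sq' (abs_le.1 hz).1 (abs_le.1 hz).2) (he_le n)
  · refine tendsto_integral_of_dominated_convergence (fun z => D z ^ 2)
      (fun n => (hG_meas n).pow 2) hD.integrable_sq (fun n => ?_)
      (hG_lim.mono fun z hz => hz.pow 2)
    filter_upwards [hGD n] with z hz
    rw [Real.norm_of_nonneg (by positivity)]
    exact sq_le_sq' (abs_le.1 hz).1 (abs_le.1 hz).2
  · obtain ⟨M, hM⟩ := hM n
    obtain ⟨L, hL⟩ := hL n
    exact h.entropy_sq_add_sq_le hα hΩ hΩ_meas hνΩ (hf n) hM hL (hG n) (hG_memLp n).integrable_sq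
      (he_pos n)

end LogSobolev

/-! ### The Cameron–Martin embedding of the Brownian loop -/

/-- Square summable complex sequences indexed by `ℤ`, which parametrize the Cameron–Martin space of
the Brownian loop; the coordinate `j = 0` is redundant. -/
abbrev EllTwo : Type := lp (fun _ : ℤ => ℂ) 2

lemma hasSum_ellTwo_norm_sq (c : EllTwo) : HasSum (fun j => ‖c j‖ ^ 2) (‖c‖ ^ 2) := by
  simpa using lp.hasSum_norm (p := 2) (by norm_num) c

instance : Fact ((2 : ℝ≥0∞) ≠ ∞) := ⟨ENNReal.ofNat_ne_top⟩

instance : TopologicalSpace.SeparableSpace EllTwo :=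
  (fourierBasis (T := 2 * Real.pi)).repr.surjective.denseRange.separableSpace
    (fourierBasis (T := 2 * Real.pi)).repr.continuous

/-- `1 / j` for `j ≠ 0`, and `0` for `j = 0`. -/
def invFreq (j : ℤ) : ℂ := if j = 0 then 0 else 1 / (j : ℂ)

lemma norm_invFreq (j : ℤ) : ‖invFreq j‖ = |(j : ℝ)|⁻¹ := by
  unfold invFreq
  split_ifs with h <;> simp [h]

lemma norm_invFreq_le_one (j : ℤ) : ‖invFreq j‖ ≤ 1 := by
  rw [norm_invFreq]
  simpa using Nat.cast_inv_le_one (α := ℝ) j.natAbs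

/-- The embedding `c ↦ ∑ j, invFreq j * c j * e^{ijθ}` of `ℓ²` into `L²`. Its image is the space of
mean zero functions in `H¹`, the Cameron–Martin space of the Brownian loop. -/
def cmEmbed : EllTwo →L[ℝ] LTwo :=
  ((fourierBasis.repr.symm.toContinuousLinearEquiv.toContinuousLinearMap : EllTwo →L[ℂ] LTwo) ∘L
    lp.mapCLM 2 (fun j => ContinuousLinearMap.mul ℂ ℂ (invFreq j)) zero_le_one
      fun j => (ContinuousLinearMap.opNorm_mul_apply_le ℂ ℂ _).trans
        (norm_invFreq_le_one j)).restrictScalars ℝ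

lemma fourierCoeff_cmEmbed (c : EllTwo) (j : ℤ) :
    fourierCoeff (cmEmbed c) j = invFreq j * c j := by
  rw [← fourierBasis_repr]
  simp [cmEmbed]

lemma hasSum_cmEmbed (c : EllTwo) :
    HasSum (fun j : ℤ => (invFreq j * c j) • (fourierLp 2 j : LTwo)) (cmEmbed c) := by
  simpa only [fourierBasis_repr, fourierCoeff_cmEmbed, coe_fourierBasis] using
    fourierBasis.hasSum_repr (cmEmbed c)

/-! ### The Prékopa–Leindler inequality for the Brownian loop -/

lemma loopCoeff_eq (γ : ℤ → ℝ × ℝ) (j : ℤ) :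
    loopCoeff γ j = invFreq j * Complex.equivRealProdCLM.symm (γ j) := by
  rw [loopCoeff, invFreq, Complex.equivRealProdCLM_symm_apply]
  split_ifs
  · simp
  · ring

lemma norm_equivRealProdCLM_symm_sq (p : ℝ × ℝ) :
    ‖Complex.equivRealProdCLM.symm p‖ ^ 2 = p.1 ^ 2 + p.2 ^ 2 := by
  rw [Complex.equivRealProdCLM_symm_apply, Complex.sq_norm, Complex.normSq_add_mul_I]

section Shift

variable {γ δ : ℤ → ℝ × ℝ} {c : EllTwo}

lemma loopCoeff_add_smul_fourierLp (hc : ∀ j, c j = Complex.equivRealProdCLM.symm (δ j)) (j : ℤ) :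
    loopCoeff (γ + δ) j • (fourierLp 2 j : LTwo) =
      loopCoeff γ j • (fourierLp 2 j : LTwo) + (invFreq j * c j) • (fourierLp 2 j : LTwo) := by
  rw [← add_smul, loopCoeff_eq, loopCoeff_eq, hc, Pi.add_apply, map_add, mul_add]

lemma summable_loop_add_iff (hc : ∀ j, c j = Complex.equivRealProdCLM.symm (δ j)) :
    (Summable fun j : ℤ => loopCoeff (γ + δ) j • (fourierLp 2 j : LTwo)) ↔
      Summable fun j : ℤ => loopCoeff γ j • (fourierLp 2 j : LTwo) := by
  simp only [loopCoeff_add_smul_fourierLp hc]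
  exact ⟨fun h => by simpa using h.sub (hasSum_cmEmbed c).summable,
    fun h => h.add (hasSum_cmEmbed c).summable⟩

lemma brownianLoop_add (hc : ∀ j, c j = Complex.equivRealProdCLM.symm (δ j))
    (hγ : Summable fun j : ℤ => loopCoeff γ j • (fourierLp 2 j : LTwo)) :
    brownianLoop (γ + δ) = brownianLoop γ + cmEmbed c := by
  simp only [brownianLoop, loopCoeff_add_smul_fourierLp hc]
  rw [hγ.tsum_add (hasSum_cmEmbed c).summable, (hasSum_cmEmbed c).tsum_eq]

end Shift

lemma exists_ellTwo_eq_of_support_subset {δ : ℤ → ℝ × ℝ} {J : Finset ℤ} (hδ : ∀ j ∉ J, δ j = 0) :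
    ∃ c : EllTwo, (∀ j, c j = Complex.equivRealProdCLM.symm (δ j)) ∧
      ‖c‖ ^ 2 = ∑ j ∈ J, ((δ j).1 ^ 2 + (δ j).2 ^ 2) := by
  refine ⟨∑ j ∈ J, lp.single 2 j (Complex.equivRealProdCLM.symm (δ j)), fun j => ?_, ?_⟩
  · rw [lp.coeFn_sum, Finset.sum_apply]
    by_cases hj : j ∈ J <;> simp [hj, hδ]
  · have h := lp.norm_sum_single (p := 2) (by norm_num)
      (fun j => Complex.equivRealProdCLM.symm (δ j)) J
    simpa only [ENNReal.toReal_ofNat, Real.rpow_ofNat, norm_equivRealProdCLM_symm_sq] using h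

lemma dominatesFinitary_comp_brownianLoop {t s : ℝ} (ht : 0 < t) (hs : 0 < s) (hts : t + s = 1)
    {u v w : LTwo → ℝ≥0∞}
    (huvw : ∀ z c, u (z + s • cmEmbed c) ^ t * v (z - t • cmEmbed c) ^ s *
      ENNReal.ofReal (Real.exp (-(t * s / 2 * ‖c‖ ^ 2))) ≤ w z) :
    DominatesFinitary t s (fun (_ : ℤ) (p : ℝ × ℝ) => p.1 ^ 2 + p.2 ^ 2)
      (u ∘ brownianLoop) (v ∘ brownianLoop) (w ∘ brownianLoop) := by
  intro J x y hxy
  obtain ⟨c, hc, hc_norm⟩ := exists_ellTwo_eq_of_support_subset (δ := x - y)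
    fun j hj => sub_eq_zero.2 (hxy j hj)
  set z := t • x + s • y with hz
  have hx : brownianLoop x = brownianLoop (z + s • (x - y)) := by
    congr 1
    rw [hz, eq_sub_of_add_eq hts]
    module
  have hy : brownianLoop y = brownianLoop (z + (-t) • (x - y)) := by
    congr 1
    rw [hz, eq_sub_of_add_eq' hts]
    module
  have hshift : ∀ (a : ℝ) (j : ℤ), (a • c) j = Complex.equivRealProdCLM.symm ((a • (x - y)) j) :=
    fun a j => by simp [hc]
  simp only [Function.comp_apply, neg_mul]
  simp only [Pi.sub_apply] at hc_norm
  rw [← hc_norm]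
  by_cases hsum : Summable fun j : ℤ => loopCoeff z j • (fourierLp 2 j : LTwo)
  · rw [hx, hy, brownianLoop_add (hshift s) hsum, brownianLoop_add (hshift (-t)) hsum]
    simpa [sub_eq_add_neg] using huvw (brownianLoop z) c
  · have hzero : ∀ a : ℝ, brownianLoop (z + a • (x - y)) = 0 := fun a =>
      tsum_eq_zero_of_not_summable (mt (summable_loop_add_iff (hshift a)).1 hsum)
    rw [hx, hy, hzero, hzero, show brownianLoop z = 0 from tsum_eq_zero_of_not_summable hsum]
    refine le_trans (mul_le_of_le_one_right' ?_) (by simpa using huvw 0 0)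
    rw [ENNReal.ofReal_le_one, Real.exp_le_one_iff, neg_nonpos]
    positivity

theorem cmPrekopaLeindler_loopMeasure : CMPrekopaLeindler cmEmbed 1 loopMeasure := by
  intro t s ht hs hts u v w hu hv hw huvw
  simp only [one_mul] at huvw
  rw [loopMeasure, lintegral_map hu measurable_brownianLoop,
    lintegral_map hv measurable_brownianLoop, lintegral_map hw measurable_brownianLoop]
  exact (dominatesFinitary_comp_brownianLoop ht hs hts huvw).lintegral_rpow_mul_le ht hs hts
    (fun _ => (prekopaLeindler_gaussianReal ht hs hts).prod
      (prekopaLeindler_gaussianReal ht hs hts)) (fun _ p => by positivity)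
    (hu.comp measurable_brownianLoop) (hv.comp measurable_brownianLoop)
    (hw.comp measurable_brownianLoop)

instance : IsProbabilityMeasure gaussianLaw := by unfold gaussianLaw; infer_instance

instance : IsProbabilityMeasure loopMeasure :=
  Measure.isProbabilityMeasure_map measurable_brownianLoop.aemeasurable

lemma gaussianLaw_map_neg : gaussianLaw.map (-·) = gaussianLaw := by
  have hpair : ((gaussianReal 0 1).prod (gaussianReal 0 1)).map (-·) =
      (gaussianReal 0 1).prod (gaussianReal 0 1) := by
    have h := Measure.map_prod_map (gaussianReal 0 1) (gaussianReal 0 1)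
      (f := (-·)) (g := (-·)) measurable_neg measurable_neg
    rw [gaussianReal_map_neg, neg_zero] at h
    exact h.symm
  have h := Measure.infinitePi_map_pi (fun _ : ℤ => (gaussianReal 0 1).prod (gaussianReal 0 1))
    (f := fun _ => (-·)) fun _ => measurable_neg
  rwa [hpair] at h

lemma brownianLoop_neg (γ : ℤ → ℝ × ℝ) : brownianLoop (-γ) = -brownianLoop γ := by
  simp only [brownianLoop, ← tsum_neg, ← neg_smul, loopCoeff_eq, Pi.neg_apply, map_neg, mul_neg]

instance : loopMeasure.IsNegInvariant where
  neg_eq_self := by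
    rw [Measure.neg_def, loopMeasure, Measure.map_map measurable_neg measurable_brownianLoop]
    conv_rhs => rw [← gaussianLaw_map_neg, Measure.map_map measurable_brownianLoop measurable_neg]
    congr 1
    ext1 γ
    exact (brownianLoop_neg γ).symm

/-! ### Convexity defect of the quartic functional -/

section Quartic

section Normed

variable {V : Type*} [NormedAddCommGroup V] {X : Type*} [MeasurableSpace X] {m : Measure X}
  {f g : X → V} {B : ℝ}

lemma sq_norm_sq_sub_norm_sq_le (a b : V) :
    (‖a‖ ^ 2 - ‖b‖ ^ 2) ^ 2 ≤ ‖a - b‖ ^ 2 * (2 * (‖a‖ ^ 2 + ‖b‖ ^ 2)) := by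
  have hsub : (‖a‖ - ‖b‖) ^ 2 ≤ ‖a - b‖ ^ 2 :=
    sq_le_sq.2 (by simpa using abs_norm_sub_norm_le a b)
  calc (‖a‖ ^ 2 - ‖b‖ ^ 2) ^ 2 = (‖a‖ - ‖b‖) ^ 2 * (‖a‖ + ‖b‖) ^ 2 := by ring
    _ ≤ ‖a - b‖ ^ 2 * (2 * (‖a‖ ^ 2 + ‖b‖ ^ 2)) := by
        gcongr
        exact add_sq_le

lemma norm_pow_four_le {a b : V} (h : ‖a - b‖ ≤ B) :
    ‖a‖ ^ 4 ≤ 3 * B ^ 2 * ‖a‖ ^ 2 + 9 * ‖b‖ ^ 4 := by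
  have htri : ‖a‖ ≤ ‖b‖ + B := (norm_le_norm_add_norm_sub' a b).trans (by gcongr)
  have hsq : ‖a‖ ^ 2 ≤ 3 * ‖b‖ ^ 2 + 3 / 2 * B ^ 2 :=
    calc ‖a‖ ^ 2 ≤ (‖b‖ + B) ^ 2 := by gcongr
      _ ≤ 3 * ‖b‖ ^ 2 + 3 / 2 * B ^ 2 := by nlinarith [sq_nonneg (2 * ‖b‖ - B)]
  nlinarith [mul_le_mul_of_nonneg_left hsq (sq_nonneg ‖a‖), sq_nonneg (‖a‖ ^ 2 - 3 * ‖b‖ ^ 2)]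

lemma integrable_norm_pow_four_of_sub_le (hf2 : MemLp f 2 m) (hfg : ∀ᵐ x ∂m, ‖f x - g x‖ ≤ B)
    (hg : Integrable (fun x => ‖g x‖ ^ 4) m) : Integrable (fun x => ‖f x‖ ^ 4) m := by
  refine ((hf2.norm.integrable_sq.const_mul (3 * B ^ 2)).add (hg.const_mul 9)).mono'
    (hf2.aestronglyMeasurable.norm.pow 4) ?_
  filter_upwards [hfg] with x hx
  rw [Real.norm_of_nonneg (by positivity)]
  exact norm_pow_four_le hx

lemma integrable_norm_pow_four_iff (hf2 : MemLp f 2 m) (hg2 : MemLp g 2 m)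
    (hfg : ∀ᵐ x ∂m, ‖f x - g x‖ ≤ B) :
    Integrable (fun x => ‖f x‖ ^ 4) m ↔ Integrable (fun x => ‖g x‖ ^ 4) m :=
  ⟨integrable_norm_pow_four_of_sub_le hg2 (by simpa only [norm_sub_rev] using hfg),
    integrable_norm_pow_four_of_sub_le hf2 hfg⟩

-- `f` and `g` lie in `L⁴` together or not at all; in the latter case both integrals are `0`.
lemma integral_norm_pow_four_le (hf2 : MemLp f 2 m) (hg2 : MemLp g 2 m)
    (hfg : ∀ᵐ x ∂m, ‖f x - g x‖ ≤ B) :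
    ∫ x, ‖f x‖ ^ 4 ∂m ≤ 3 * B ^ 2 * (∫ x, ‖f x‖ ^ 2 ∂m) + 9 * ∫ x, ‖g x‖ ^ 4 ∂m := by
  by_cases hg : Integrable (fun x => ‖g x‖ ^ 4) m
  · have hf := integrable_norm_pow_four_of_sub_le hf2 hfg hg
    have hf2' := hf2.norm.integrable_sq.const_mul (3 * B ^ 2)
    rw [← integral_const_mul, ← integral_const_mul, ← integral_add hf2' (hg.const_mul 9)]
    exact integral_mono_ae hf (hf2'.add (hg.const_mul 9)) (hfg.mono fun x hx => norm_pow_four_le hx)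
  · rw [integral_undef hg, integral_undef (mt (integrable_norm_pow_four_iff hf2 hg2 hfg).1 hg)]
    positivity

end Normed

variable {V : Type*} [NormedAddCommGroup V] [InnerProductSpace ℝ V]

lemma norm_smul_add_smul_sq {t s : ℝ} (hts : t + s = 1) (a b : V) :
    ‖t • a + s • b‖ ^ 2 = t * ‖a‖ ^ 2 + s * ‖b‖ ^ 2 - t * s * ‖a - b‖ ^ 2 := by
  obtain rfl : s = 1 - t := by linarith
  rw [norm_add_sq_real, norm_sub_sq_real, norm_smul, norm_smul, mul_pow, mul_pow, Real.norm_eq_abs,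
    Real.norm_eq_abs, sq_abs, sq_abs, real_inner_smul_left, real_inner_smul_right]
  ring

lemma norm_pow_four_convexity_defect {t s : ℝ} (ht : 0 < t) (hs : 0 < s) (hts : t + s = 1)
    (a b : V) :
    t * ‖a‖ ^ 4 + s * ‖b‖ ^ 4 ≤ ‖t • a + s • b‖ ^ 4 +
      t * s * ‖a - b‖ ^ 2 * (2 * (t * ‖a‖ ^ 2 + s * ‖b‖ ^ 2) + 2 * (‖a‖ ^ 2 + ‖b‖ ^ 2)) := by
  set m := t * ‖a‖ ^ 2 + s * ‖b‖ ^ 2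
  set d := t * s * ‖a - b‖ ^ 2
  have hvariance : t * ‖a‖ ^ 4 + s * ‖b‖ ^ 4 = m ^ 2 + t * s * (‖a‖ ^ 2 - ‖b‖ ^ 2) ^ 2 := by
    obtain rfl : s = 1 - t := by linarith
    ring
  have hspread := mul_le_mul_of_nonneg_left (sq_norm_sq_sub_norm_sq_le a b) (mul_pos ht hs).le
  calc t * ‖a‖ ^ 4 + s * ‖b‖ ^ 4 ≤ m ^ 2 + d * (2 * (‖a‖ ^ 2 + ‖b‖ ^ 2)) := by
        rw [hvariance, mul_assoc (t * s)]
        gcongr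
    _ ≤ (m - d) ^ 2 + d * (2 * m + 2 * (‖a‖ ^ 2 + ‖b‖ ^ 2)) := by nlinarith [sq_nonneg d]
    _ = ‖t • a + s • b‖ ^ 4 + d * (2 * m + 2 * (‖a‖ ^ 2 + ‖b‖ ^ 2)) := by
        rw [← norm_smul_add_smul_sq hts]
        ring

variable {X : Type*} [MeasurableSpace X] {m : Measure X} {f g : X → V} {B : ℝ}

lemma integrable_norm_pow_four_smul_add_smul {t s : ℝ} (hts : t + s = 1) (hf2 : MemLp f 2 m)
    (hg2 : MemLp g 2 m) (hfg : ∀ᵐ x ∂m, ‖f x - g x‖ ≤ B)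
    (hg : Integrable (fun x => ‖g x‖ ^ 4) m) :
    Integrable (fun x => ‖t • f x + s • g x‖ ^ 4) m := by
  have hcomb : MemLp (fun x => t • f x + s • g x) 2 m := (hf2.const_smul t).add (hg2.const_smul s)
  refine integrable_norm_pow_four_of_sub_le (B := ‖t‖ * B) hcomb (hfg.mono fun x hx => ?_) hg
  have hsub : t • f x + s • g x - g x = t • (f x - g x) := by
    obtain rfl : s = 1 - t := by linarith
    module
  rw [hsub, norm_smul]
  gcongr

lemma integral_norm_pow_four_convexity_defect {t s : ℝ} (ht : 0 < t) (hs : 0 < s)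
    (hts : t + s = 1) (hf2 : MemLp f 2 m) (hg2 : MemLp g 2 m)
    (hfg : ∀ᵐ x ∂m, ‖f x - g x‖ ≤ B) {N : ℝ} (hfN : ∫ x, ‖f x‖ ^ 2 ∂m ≤ N)
    (hgN : ∫ x, ‖g x‖ ^ 2 ∂m ≤ N) :
    t * (∫ x, ‖f x‖ ^ 4 ∂m) + s * (∫ x, ‖g x‖ ^ 4 ∂m) ≤
      (∫ x, ‖t • f x + s • g x‖ ^ 4 ∂m) + t * s * (6 * N * B ^ 2) := by
  have hN : 0 ≤ N := (integral_nonneg fun x => by positivity).trans hfN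
  by_cases hg : Integrable (fun x => ‖g x‖ ^ 4) m
  swap
  · rw [integral_undef hg, integral_undef (mt (integrable_norm_pow_four_iff hf2 hg2 hfg).1 hg)]
    have hcomb : 0 ≤ ∫ x, ‖t • f x + s • g x‖ ^ 4 ∂m := integral_nonneg fun x => by positivity
    have hdefect : 0 ≤ t * s * (6 * N * B ^ 2) := by positivity
    linarith
  have hf := integrable_norm_pow_four_of_sub_le hf2 hfg hg
  have hconv := integrable_norm_pow_four_smul_add_smul hts hf2 hg2 hfg hg
  have hf2' := hf2.norm.integrable_sq
  have hg2' := hg2.norm.integrable_sq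
  have hpoint : ∀ᵐ x ∂m, t * ‖f x‖ ^ 4 + s * ‖g x‖ ^ 4 ≤ ‖t • f x + s • g x‖ ^ 4 +
      t * s * B ^ 2 * (2 * (t * ‖f x‖ ^ 2 + s * ‖g x‖ ^ 2) + 2 * (‖f x‖ ^ 2 + ‖g x‖ ^ 2)) := by
    filter_upwards [hfg] with x hx
    refine (norm_pow_four_convexity_defect ht hs hts (f x) (g x)).trans ?_
    gcongr
  have hinteg := integral_mono_ae (by fun_prop) (by fun_prop) hpoint
  rw [integral_add (by fun_prop) (by fun_prop), integral_add hconv (by fun_prop),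
    integral_const_mul, integral_const_mul, integral_const_mul,
    integral_add (by fun_prop) (by fun_prop), integral_const_mul, integral_const_mul,
    integral_add (by fun_prop) (by fun_prop), integral_add hf2' hg2', integral_const_mul,
    integral_const_mul] at hinteg
  refine hinteg.trans ?_
  have hsum : 2 * (t * (∫ x, ‖f x‖ ^ 2 ∂m) + s * ∫ x, ‖g x‖ ^ 2 ∂m) +
      2 * ((∫ x, ‖f x‖ ^ 2 ∂m) + ∫ x, ‖g x‖ ^ 2 ∂m) ≤ 6 * N :=
    calc _ ≤ 2 * (t * N + s * N) + 2 * (N + N) := by gcongr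
      _ = 6 * N := by rw [← add_mul, hts]; ring
  nlinarith [mul_le_mul_of_nonneg_left hsum (by positivity : 0 ≤ t * s * B ^ 2)]

end Quartic

/-! ### The supremum bound on the Cameron–Martin space -/

lemma hasSum_inv_int_sq : HasSum (fun j : ℤ => 1 / (j : ℝ) ^ 2) (Real.pi ^ 2 / 3) := by
  have hneg : HasSum (fun n : ℕ => 1 / ((-((n : ℤ) + 1) : ℤ) : ℝ) ^ 2) (Real.pi ^ 2 / 6) := by
    simpa only [Finset.range_one, Finset.sum_singleton, Nat.cast_zero, ne_eq, OfNat.ofNat_ne_zero,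
      not_false_eq_true, zero_pow, div_zero, sub_zero, Int.cast_neg, Int.cast_add,
      Int.cast_natCast, Int.cast_one, neg_sq, Nat.cast_add, Nat.cast_one] using
      (hasSum_nat_add_iff' 1).2 hasSum_zeta_two
  convert HasSum.of_nat_of_neg_add_one (f := fun j : ℤ => 1 / (j : ℝ) ^ 2)
    (by simpa using hasSum_zeta_two) hneg using 1
  ring

lemma hasSum_norm_invFreq_sq : HasSum (fun j => ‖invFreq j‖ ^ 2) (Real.pi ^ 2 / 3) := by
  simpa only [norm_invFreq, inv_pow, sq_abs, one_div] using hasSum_inv_int_sq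

lemma norm_cmEmbed_apply_le (c : EllTwo) :
    ∀ᵐ θ ∂arc, ‖cmEmbed c θ‖ ≤ √(Real.pi ^ 2 / 3) * ‖c‖ := by
  obtain ⟨C, -, hC, hsum⟩ := Real.inner_le_Lp_mul_Lq_hasSum_of_nonneg
    (f := fun j => ‖invFreq j‖) (g := fun j => ‖c j‖) Real.HolderConjugate.two_two
    (Real.sqrt_nonneg (Real.pi ^ 2 / 3)) (norm_nonneg c) (fun _ => norm_nonneg _)
    (fun _ => norm_nonneg _)
    (by simpa only [Real.rpow_two, Real.sq_sqrt (by positivity : 0 ≤ Real.pi ^ 2 / 3)] using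
      hasSum_norm_invFreq_sq)
    (by simpa only [Real.rpow_two] using hasSum_ellTwo_norm_sq c)
  have hterm : ∀ j, ‖(invFreq j * c j) • (fourier j : C(Circ, ℂ))‖ ≤ ‖invFreq j‖ * ‖c j‖ := by
    intro j
    rw [norm_smul, fourier_norm, mul_one, norm_mul]
  have hseries : HasSum (fun j => (invFreq j * c j) • (fourierLp 2 j : LTwo))
      (ContinuousMap.toLp 2 arc ℂ (∑' j, (invFreq j * c j) • (fourier j : C(Circ, ℂ)))) := by
    simpa [fourierLp] using (Summable.of_norm_bounded hsum.summable hterm).hasSum.mapL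
      (ContinuousMap.toLp (E := ℂ) 2 arc ℂ)
  rw [(hasSum_cmEmbed c).unique hseries]
  filter_upwards [ContinuousMap.coeFn_toLp (p := 2) (𝕜 := ℂ) arc
    (∑' j, (invFreq j * c j) • (fourier j : C(Circ, ℂ)))] with θ hθ
  rw [hθ]
  exact (ContinuousMap.norm_coe_le_norm _ θ).trans ((tsum_of_norm_bounded hsum hterm).trans hC)

lemma norm_sub_le_of_sub_eq_cmEmbed {x y : LTwo} {c : EllTwo} (h : x - y = cmEmbed c) :
    ∀ᵐ θ ∂arc, ‖x θ - y θ‖ ≤ √(Real.pi ^ 2 / 3) * ‖c‖ := by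
  filter_upwards [Lp.coeFn_sub x y, norm_cmEmbed_apply_le c] with θ hsub hle
  rw [h, Pi.sub_apply] at hsub
  rwa [← hsub]

/-! ### The Gibbs measure -/

lemma integral_norm_sq_eq (u : LTwo) : ∫ θ, ‖u θ‖ ^ 2 ∂arc = ‖u‖ ^ 2 := by
  rw [← inner_self_eq_norm_sq (𝕜 := ℝ) u, L2.inner_def]
  simp

lemma mem_ball_iff {N : ℝ} {u : LTwo} : u ∈ Ball N ↔ ‖u‖ ^ 2 ≤ N := by
  rw [Ball, Set.mem_ofPred_eq, integral_norm_sq_eq]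

lemma ball_eq_closedBall {N : ℝ} (hN : 0 ≤ N) : Ball N = Metric.closedBall 0 (√N) := by
  ext u
  rw [mem_ball_iff, mem_closedBall_zero_iff, Real.le_sqrt (norm_nonneg _) hN]

lemma isClosed_ball (N : ℝ) : IsClosed (Ball N) := by
  have hBall : Ball N = {u : LTwo | ‖u‖ ^ 2 ≤ N} := by ext u; exact mem_ball_iff
  rw [hBall]
  exact isClosed_le (by fun_prop) continuous_const

lemma measurableSet_ball (N : ℝ) : MeasurableSet (Ball N) := (isClosed_ball N).measurableSet

lemma strictConvex_ball {N : ℝ} (hN : 0 ≤ N) : StrictConvex ℝ (Ball N) := by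
  rw [ball_eq_closedBall hN]
  exact strictConvex_closedBall ℝ 0 (√N)

lemma lowerSemicontinuous_lintegral_enorm_pow_four :
    LowerSemicontinuous fun u : LTwo => ∫⁻ θ, ‖u θ‖ₑ ^ 4 ∂arc := by
  refine lowerSemicontinuous_iff_isClosed_preimage.2 fun a =>
    IsSeqClosed.isClosed fun x u hx hu => ?_
  obtain ⟨φ, -, hφ⟩ := (tendstoInMeasure_of_tendsto_Lp hu).exists_seq_tendsto_ae
  calc ∫⁻ θ, ‖u θ‖ₑ ^ 4 ∂arc ≤ ∫⁻ θ, liminf (fun n => ‖x (φ n) θ‖ₑ ^ 4) atTop ∂arc := by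
        refine lintegral_mono_ae ?_
        filter_upwards [hφ] with θ hθ
        exact (((ENNReal.continuous_pow 4).tendsto _).comp hθ.enorm).liminf_eq.ge
    _ ≤ liminf (fun n => ∫⁻ θ, ‖x (φ n) θ‖ₑ ^ 4 ∂arc) atTop :=
        lintegral_liminf_le' fun n => (Lp.aestronglyMeasurable _).enorm.pow_const 4
    _ ≤ a := liminf_le_of_frequently_le' (Frequently.of_forall fun n => hx (φ n))

lemma measurable_integral_norm_pow_four :
    Measurable fun u : LTwo => ∫ θ, ‖u θ‖ ^ 4 ∂arc := by
  have heq : ∀ u : LTwo, ∫ θ, ‖u θ‖ ^ 4 ∂arc = (∫⁻ θ, ‖u θ‖ₑ ^ 4 ∂arc).toReal := fun u => by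
    rw [integral_eq_lintegral_of_nonneg_ae (f := fun θ => ‖u θ‖ ^ 4)
      (ae_of_all _ fun θ => by positivity) ((Lp.aestronglyMeasurable u).norm.pow 4)]
    simp only [ENNReal.ofReal_pow (norm_nonneg _), ofReal_norm]
  simpa only [heq] using lowerSemicontinuous_lintegral_enorm_pow_four.measurable.ennreal_toReal

lemma measurable_weight (lam : ℝ) : Measurable (weight lam) :=
  (measurable_integral_norm_pow_four.const_mul (lam / 4)).exp.ennreal_ofReal

lemma weight_rpow (lam : ℝ) (u : LTwo) (p : ℝ) :
    weight lam u ^ p = ENNReal.ofReal (Real.exp (p * (lam / 4 * ∫ θ, ‖u θ‖ ^ 4 ∂arc))) := by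
  rw [weight, ENNReal.ofReal_rpow_of_pos (Real.exp_pos _), ← Real.exp_mul, mul_comm p]

lemma exists_loopMeasure_integral_norm_pow_four_le_ne_zero :
    ∃ r : ℕ, loopMeasure {u | ∫ θ, ‖u θ‖ ^ 4 ∂arc ≤ r} ≠ 0 := by
  by_contra! hnull
  have hcover : (Set.univ : Set LTwo) ⊆ ⋃ r : ℕ, {u | ∫ θ, ‖u θ‖ ^ 4 ∂arc ≤ r} :=
    fun u _ => by
      simpa only [Set.mem_iUnion, Set.mem_ofPred_eq] using exists_nat_ge (∫ θ, ‖u θ‖ ^ 4 ∂arc)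
  simpa using measure_mono_null hcover (measure_iUnion_null hnull)

section Gibbs

variable {N lam α : ℝ}

lemma lam_mul_integral_norm_pow_four_le (hlam : 0 ≤ lam) (hlamN : Real.pi ^ 2 * (lam * N) ≤ 1)
    {x y : LTwo} (hx : x ∈ Ball N) {c : EllTwo} (hxy : x - y = cmEmbed c) :
    lam * ∫ θ, ‖x θ‖ ^ 4 ∂arc ≤ ‖c‖ ^ 2 + 9 * lam * ∫ θ, ‖y θ‖ ^ 4 ∂arc := by
  have hsq : (√(Real.pi ^ 2 / 3) * ‖c‖) ^ 2 = Real.pi ^ 2 / 3 * ‖c‖ ^ 2 := by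
    rw [mul_pow, Real.sq_sqrt (by positivity)]
  have hx' : ∫ θ, ‖x θ‖ ^ 2 ∂arc ≤ N := hx
  calc lam * ∫ θ, ‖x θ‖ ^ 4 ∂arc
      ≤ lam * (3 * (√(Real.pi ^ 2 / 3) * ‖c‖) ^ 2 * (∫ θ, ‖x θ‖ ^ 2 ∂arc) +
          9 * ∫ θ, ‖y θ‖ ^ 4 ∂arc) := by
        gcongr
        exact integral_norm_pow_four_le (Lp.memLp x) (Lp.memLp y)
          (norm_sub_le_of_sub_eq_cmEmbed hxy)
    _ ≤ lam * (3 * (√(Real.pi ^ 2 / 3) * ‖c‖) ^ 2 * N + 9 * ∫ θ, ‖y θ‖ ^ 4 ∂arc) := by gcongr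
    _ = Real.pi ^ 2 * (lam * N) * ‖c‖ ^ 2 + 9 * lam * ∫ θ, ‖y θ‖ ^ 4 ∂arc := by rw [hsq]; ring
    _ ≤ 1 * ‖c‖ ^ 2 + 9 * lam * ∫ θ, ‖y θ‖ ^ 4 ∂arc := by gcongr
    _ = _ := by rw [one_mul]

lemma partitionFunction_ne_top (hlam : 0 ≤ lam) (hlamN : Real.pi ^ 2 * (lam * N) ≤ 1) :
    partitionFunction N lam ≠ ∞ := by
  obtain ⟨r, hr⟩ := exists_loopMeasure_integral_norm_pow_four_le_ne_zero
  rw [partitionFunction, ← lintegral_indicator (measurableSet_ball N)]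
  refine cmPrekopaLeindler_loopMeasure.lintegral_ne_top (t := 1 / 2) (s := 1 / 2) (by norm_num)
    (by norm_num) (by norm_num) ((measurable_weight lam).indicator (measurableSet_ball N))
    (measurable_integral_norm_pow_four measurableSet_Iic) hr
    (K := ENNReal.ofReal (Real.exp (9 * lam * r / 8))) ENNReal.ofReal_ne_top fun x y hy c hxy => ?_
  by_cases hx : x ∈ Ball N
  swap; · simp [Set.indicator_of_notMem hx]
  rw [Set.indicator_of_mem hx, weight_rpow, ← ENNReal.ofReal_mul (Real.exp_pos _).le,
    ← Real.exp_add]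
  gcongr
  have hle := lam_mul_integral_norm_pow_four_le hlam hlamN hx hxy
  have hyr : 9 * lam * ∫ θ, ‖y θ‖ ^ 4 ∂arc ≤ 9 * lam * r :=
    mul_le_mul_of_nonneg_left hy (by positivity)
  linarith

lemma partitionFunction_ne_zero (hN : 0 < N) : partitionFunction N lam ≠ 0 := by
  have hball : loopMeasure (Ball N) ≠ 0 := by
    rw [ball_eq_closedBall hN.le]
    exact (cmPrekopaLeindler_loopMeasure.measure_closedBall_zero_pos zero_le_one
      (Real.sqrt_pos.2 hN)).ne'
  rw [partitionFunction, ne_eq, lintegral_eq_zero_iff (measurable_weight lam)]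
  intro h
  have hfalse : ∀ᵐ _ ∂loopMeasure.restrict (Ball N), False := h.mono fun _ hu =>
    (ENNReal.ofReal_pos.2 (Real.exp_pos _)).ne' hu
  exact hball (by simpa using hfalse)

lemma isProbabilityMeasure_gibbs (hN : 0 < N) (hlam : 0 ≤ lam)
    (hlamN : Real.pi ^ 2 * (lam * N) ≤ 1) : IsProbabilityMeasure (gibbs N lam) := by
  constructor
  rw [gibbs, Measure.smul_apply, withDensity_apply _ MeasurableSet.univ, Measure.restrict_univ,
    smul_eq_mul]
  exact ENNReal.inv_mul_cancel (partitionFunction_ne_zero hN) (partitionFunction_ne_top hlam hlamN)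

lemma gibbs_absolutelyContinuous_restrict : gibbs N lam ≪ loopMeasure.restrict (Ball N) :=
  (withDensity_absolutelyContinuous _ _).smul_left _

lemma ae_mem_ball_gibbs : ∀ᵐ u ∂gibbs N lam, u ∈ Ball N :=
  gibbs_absolutelyContinuous_restrict.ae_le (ae_restrict_mem (measurableSet_ball N))

-- The supremum bound gives the convexity defect `(λ / 4) t s 6 N (π² / 3) ‖c‖²`.
theorem cmPrekopaLeindler_gibbs (hN : 0 ≤ N) (hlam : 0 ≤ lam)
    (hα : α ≤ 1 - Real.pi ^ 2 * (lam * N)) : CMPrekopaLeindler cmEmbed α (gibbs N lam) := by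
  refine CMPrekopaLeindler.smul (cmPrekopaLeindler_loopMeasure.restrict_withDensity_exp
    (strictConvex_ball hN).convex (measurableSet_ball N)
    (measurable_integral_norm_pow_four.const_mul (lam / 4)) ?_) _
  intro t s ht hs hts x hx y hy c hxy
  have hsq : (√(Real.pi ^ 2 / 3) * ‖c‖) ^ 2 = Real.pi ^ 2 / 3 * ‖c‖ ^ 2 := by
    rw [mul_pow, Real.sq_sqrt (by positivity)]
  have hcomb : ∫ θ, ‖(t • x + s • y) θ‖ ^ 4 ∂arc = ∫ θ, ‖t • x θ + s • y θ‖ ^ 4 ∂arc := by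
    refine integral_congr_ae ?_
    filter_upwards [Lp.coeFn_add (t • x) (s • y), Lp.coeFn_smul t x, Lp.coeFn_smul s y]
      with θ hadd hx hy
    simp only [hadd, Pi.add_apply, hx, hy, Pi.smul_apply]
  calc t * (lam / 4 * ∫ θ, ‖x θ‖ ^ 4 ∂arc) + s * (lam / 4 * ∫ θ, ‖y θ‖ ^ 4 ∂arc)
      = lam / 4 * (t * (∫ θ, ‖x θ‖ ^ 4 ∂arc) + s * ∫ θ, ‖y θ‖ ^ 4 ∂arc) := by ring
    _ ≤ lam / 4 * ((∫ θ, ‖(t • x + s • y) θ‖ ^ 4 ∂arc) +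
          t * s * (6 * N * (√(Real.pi ^ 2 / 3) * ‖c‖) ^ 2)) := by
        rw [hcomb]
        exact mul_le_mul_of_nonneg_left (integral_norm_pow_four_convexity_defect ht hs hts
          (Lp.memLp x) (Lp.memLp y) (norm_sub_le_of_sub_eq_cmEmbed hxy) hx hy) (by positivity)
    _ = lam / 4 * (∫ θ, ‖(t • x + s • y) θ‖ ^ 4 ∂arc) +
          Real.pi ^ 2 * (lam * N) * (t * s / 2 * ‖c‖ ^ 2) := by rw [hsq]; ring
    _ ≤ lam / 4 * (∫ θ, ‖(t • x + s • y) θ‖ ^ 4 ∂arc) + (1 - α) * (t * s / 2 * ‖c‖ ^ 2) := by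
        gcongr
        linarith

end Gibbs

/-! ### Sobolev norms -/

/-- The weight of the frequency `k` in the square of the norm of `H^s`. -/
def sobolevWeight (s : ℝ) (k : ℤ) : ℝ := if k = 0 then 1 else |(k : ℝ)| ^ (2 * s)

lemma sobolevWeight_zero (s : ℝ) : sobolevWeight s 0 = 1 := if_pos rfl

lemma sobolevWeight_of_ne_zero (s : ℝ) {k : ℤ} (hk : k ≠ 0) :
    sobolevWeight s k = |(k : ℝ)| ^ (2 * s) := if_neg hk

lemma sobolevWeight_pos (s : ℝ) (k : ℤ) : 0 < sobolevWeight s k := by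
  unfold sobolevWeight
  split_ifs with hk <;> positivity

lemma one_le_sobolevWeight {s : ℝ} (hs : 0 ≤ s) (k : ℤ) : 1 ≤ sobolevWeight s k := by
  rcases eq_or_ne k 0 with rfl | hk
  · rw [sobolevWeight_zero]
  · rw [sobolevWeight_of_ne_zero s hk]
    exact Real.one_le_rpow (by exact_mod_cast Int.one_le_abs hk) (by positivity)

lemma sobolevWeight_le_one {s : ℝ} (hs : s ≤ 0) (k : ℤ) : sobolevWeight s k ≤ 1 := by
  rcases eq_or_ne k 0 with rfl | hk
  · rw [sobolevWeight_zero]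
  · rw [sobolevWeight_of_ne_zero s hk]
    exact Real.rpow_le_one_of_one_le_of_nonpos (by exact_mod_cast Int.one_le_abs hk) (by linarith)

lemma tendsto_sobolevWeight {s : ℝ} (hs : 0 < s) : Tendsto (sobolevWeight s) cofinite atTop := by
  have hpow : Tendsto (fun k : ℤ => |(k : ℝ)| ^ (2 * s)) cofinite atTop :=
    (tendsto_rpow_atTop (by positivity)).comp
      ((tendsto_norm_cocompact_atTop (E := ℝ)).comp Int.tendsto_coe_cofinite)
  refine hpow.congr' ?_
  filter_upwards [(Set.finite_singleton (0 : ℤ)).compl_mem_cofinite] with k hk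
  exact (sobolevWeight_of_ne_zero s hk).symm

lemma sobolevWeight_mul_norm_invFreq_sq (s : ℝ) {k : ℤ} (hk : k ≠ 0) :
    sobolevWeight s k * ‖invFreq k‖ ^ 2 = |(k : ℝ)| ^ (2 * s - 2) := by
  have hk' : 0 < |(k : ℝ)| := by positivity
  rw [sobolevWeight_of_ne_zero s hk, norm_invFreq, Real.rpow_sub hk', Real.rpow_two, inv_pow,
    div_eq_mul_inv]

lemma sobolevWeight_mul_norm_invFreq_sq_le_one {s : ℝ} (hs : s ≤ 1) (k : ℤ) :
    sobolevWeight s k * ‖invFreq k‖ ^ 2 ≤ 1 := by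
  rcases eq_or_ne k 0 with rfl | hk
  · simp [invFreq]
  · rw [sobolevWeight_mul_norm_invFreq_sq s hk]
    exact Real.rpow_le_one_of_one_le_of_nonpos (by exact_mod_cast Int.one_le_abs hk) (by linarith)

lemma summable_sobolevWeight_mul_norm_invFreq_sq {s : ℝ} (hs : s < 1 / 2) :
    Summable fun k => sobolevWeight s k * ‖invFreq k‖ ^ 2 := by
  refine Summable.of_nonneg_of_le (fun k => mul_nonneg (sobolevWeight_pos s k).le (sq_nonneg _))
    (fun k => ?_) (Real.summable_abs_int_rpow (b := 2 - 2 * s) (by linarith))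
  rcases eq_or_ne k 0 with rfl | hk
  · simpa [invFreq] using Real.zero_rpow_nonneg _
  · rw [sobolevWeight_mul_norm_invFreq_sq s hk, neg_sub]

lemma sobolevENorm_sq (s : ℝ) (u : LTwo) : sobolevENorm s u ^ 2 =
    ∑' k : ℤ, ENNReal.ofReal (sobolevWeight s k) * ‖fourierCoeff u k‖ₑ ^ 2 := by
  rw [sobolevENorm, ← ENNReal.rpow_two, ← ENNReal.rpow_mul, one_div, inv_mul_cancel₀ two_ne_zero,
    ENNReal.rpow_one]
  rfl

lemma fourierCoeff_eq_inner (u : LTwo) (k : ℤ) :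
    fourierCoeff u k = inner ℂ (fourierLp 2 k : LTwo) u := by
  rw [← fourierBasis_repr, HilbertBasis.repr_apply_apply, coe_fourierBasis]

lemma continuous_fourierCoeff (k : ℤ) : Continuous fun u : LTwo => fourierCoeff u k := by
  simp only [fourierCoeff_eq_inner]
  fun_prop

lemma measurable_sobolevENorm (s : ℝ) : Measurable (sobolevENorm s) :=
  (Measurable.tsum fun k =>
    ((continuous_fourierCoeff k).measurable.enorm.pow_const 2).const_mul _).pow_const _

lemma sobolevENorm_eq_lintegral_count (s : ℝ) (u : LTwo) : sobolevENorm s u =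
    (∫⁻ k, (ENNReal.ofReal (sobolevWeight s k) ^ (1 / 2 : ℝ) * ‖fourierCoeff u k‖ₑ) ^ (2 : ℝ)
      ∂Measure.count) ^ (1 / 2 : ℝ) := by
  have hterm : ∀ k, (ENNReal.ofReal (sobolevWeight s k) ^ (1 / 2 : ℝ) *
      ‖fourierCoeff u k‖ₑ) ^ (2 : ℝ) =
        ENNReal.ofReal (sobolevWeight s k) * ‖fourierCoeff u k‖ₑ ^ 2 := fun k => by
    rw [ENNReal.mul_rpow_of_nonneg _ _ zero_le_two, ← ENNReal.rpow_mul, one_div,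
      inv_mul_cancel₀ two_ne_zero, ENNReal.rpow_one, ENNReal.rpow_two]
  simp only [hterm, lintegral_count]
  rfl

lemma sobolevENorm_add_le (s : ℝ) (u v : LTwo) :
    sobolevENorm s (u + v) ≤ sobolevENorm s u + sobolevENorm s v := by
  simp only [sobolevENorm_eq_lintegral_count]
  refine le_trans ?_ (ENNReal.lintegral_Lp_add_le (measurable_of_countable _).aemeasurable
    (measurable_of_countable _).aemeasurable one_le_two)
  gcongr with k
  rw [Pi.add_apply, ← mul_add]
  simp only [fourierCoeff_eq_inner, inner_add_right]
  gcongr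
  exact enorm_add_le _ _

lemma tsum_ellTwo_enorm_sq (c : EllTwo) : ∑' k, ‖c k‖ₑ ^ 2 = ‖c‖ₑ ^ 2 := by
  have hsum := hasSum_ellTwo_norm_sq c
  simp only [← ofReal_norm, ← ENNReal.ofReal_pow (norm_nonneg _)]
  rw [← ENNReal.ofReal_tsum_of_nonneg (fun _ => sq_nonneg _) hsum.summable, hsum.tsum_eq]

lemma tsum_enorm_fourierCoeff_sq (u : LTwo) : ∑' k, ‖fourierCoeff u k‖ₑ ^ 2 = ‖u‖ₑ ^ 2 := by
  have h := tsum_ellTwo_enorm_sq (fourierBasis.repr u)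
  simpa only [LinearIsometryEquiv.enorm_map, fourierBasis_repr] using h

lemma enorm_le_sobolevENorm {s : ℝ} (hs : 0 ≤ s) (u : LTwo) : ‖u‖ₑ ≤ sobolevENorm s u := by
  rw [← ENNReal.pow_le_pow_left_iff two_ne_zero, sobolevENorm_sq, ← tsum_enorm_fourierCoeff_sq]
  exact ENNReal.tsum_le_tsum fun k =>
    le_mul_of_one_le_left' (ENNReal.one_le_ofReal.2 (one_le_sobolevWeight hs k))

lemma sobolevENorm_le_enorm {s : ℝ} (hs : s ≤ 0) (u : LTwo) : sobolevENorm s u ≤ ‖u‖ₑ := by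
  rw [← ENNReal.pow_le_pow_left_iff two_ne_zero, sobolevENorm_sq, ← tsum_enorm_fourierCoeff_sq]
  exact ENNReal.tsum_le_tsum fun k =>
    mul_le_of_le_one_left' (ENNReal.ofReal_le_one.2 (sobolevWeight_le_one hs k))

lemma ofReal_sobolevWeight_mul_enorm_sq (s : ℝ) (k : ℤ) (z : ℂ) :
    ENNReal.ofReal (sobolevWeight s k) * ‖z‖ₑ ^ 2 =
      ENNReal.ofReal (sobolevWeight s k * ‖z‖ ^ 2) := by
  rw [ENNReal.ofReal_mul (sobolevWeight_pos s k).le, ENNReal.ofReal_pow (norm_nonneg _),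
    ofReal_norm]

lemma sobolevENorm_cmEmbed_le {s : ℝ} (hs : s ≤ 1) (c : EllTwo) :
    sobolevENorm s (cmEmbed c) ≤ ‖c‖ₑ := by
  rw [← ENNReal.pow_le_pow_left_iff two_ne_zero, sobolevENorm_sq, ← tsum_ellTwo_enorm_sq]
  refine ENNReal.tsum_le_tsum fun k => ?_
  rw [fourierCoeff_cmEmbed, enorm_mul, mul_pow, ← mul_assoc, ofReal_sobolevWeight_mul_enorm_sq]
  exact mul_le_of_le_one_left'
    (ENNReal.ofReal_le_one.2 (sobolevWeight_mul_norm_invFreq_sq_le_one hs k))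

/-! ### Almost sure regularity of the Brownian loop -/

lemma enorm_fourierCoeff_brownianLoop_le (γ : ℤ → ℝ × ℝ) (k : ℤ) :
    ‖fourierCoeff (brownianLoop γ) k‖ₑ ≤ ‖loopCoeff γ k‖ₑ := by
  by_cases h : Summable fun j : ℤ => loopCoeff γ j • (fourierLp 2 j : LTwo)
  · have hmem : Memℓp (loopCoeff γ) (2 : ℝ≥0∞) :=
      memℓp_gen (by simpa using (summable_loop_iff γ).1 h)
    have hrepr := (fourierBasis (T := 2 * Real.pi)).hasSum_repr_symm (⟨_, hmem⟩ : EllTwo)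
    rw [coe_fourierBasis] at hrepr
    rw [← fourierBasis_repr, show brownianLoop γ = _ from hrepr.tsum_eq,
      LinearIsometryEquiv.apply_symm_apply]
  · rw [show brownianLoop γ = 0 from tsum_eq_zero_of_not_summable h, fourierCoeff_eq_inner,
      inner_zero_right, enorm_zero]
    exact zero_le

lemma lintegral_enorm_loopCoeff_sq (k : ℤ) : ∫⁻ γ, ‖loopCoeff γ k‖ₑ ^ 2 ∂gaussianLaw =
    ‖invFreq k‖ₑ ^ 2 * ∫⁻ p, ‖Complex.equivRealProdCLM.symm p‖ₑ ^ 2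
      ∂((gaussianReal 0 1).prod (gaussianReal 0 1)) := by
  have hmeas : Measurable fun p : ℝ × ℝ => ‖Complex.equivRealProdCLM.symm p‖ₑ ^ 2 := by fun_prop
  rw [← lintegral_const_mul _ hmeas, ← (measurePreserving_eval_infinitePi
    (fun _ : ℤ => (gaussianReal 0 1).prod (gaussianReal 0 1)) k).lintegral_comp
      (hmeas.const_mul _)]
  refine lintegral_congr fun γ => ?_
  rw [loopCoeff_eq, enorm_mul, mul_pow]

lemma lintegral_enorm_sq_gaussianReal_prod_ne_top :
    ∫⁻ p, ‖Complex.equivRealProdCLM.symm p‖ₑ ^ 2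
      ∂((gaussianReal 0 1).prod (gaussianReal 0 1)) ≠ ∞ := by
  have hsq : Integrable (fun x : ℝ => x ^ 2) (gaussianReal 0 1) :=
    (memLp_id_gaussianReal' 2 ENNReal.ofNat_ne_top).integrable_sq
  have hsum : Integrable (fun p : ℝ × ℝ => p.1 ^ 2 + p.2 ^ 2)
      ((gaussianReal 0 1).prod (gaussianReal 0 1)) :=
    (hsq.comp_fst (gaussianReal 0 1)).add (hsq.comp_snd (gaussianReal 0 1))
  refine ne_of_eq_of_ne (lintegral_congr fun p => ?_) hsum.lintegral_lt_top.ne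
  rw [← norm_equivRealProdCLM_symm_sq, ENNReal.ofReal_pow (norm_nonneg _), ofReal_norm]

lemma sobolevENorm_brownianLoop_sq_le (s : ℝ) (γ : ℤ → ℝ × ℝ) :
    sobolevENorm s (brownianLoop γ) ^ 2 ≤
      ∑' k : ℤ, ENNReal.ofReal (sobolevWeight s k) * ‖loopCoeff γ k‖ₑ ^ 2 := by
  rw [sobolevENorm_sq]
  gcongr with k
  exact enorm_fourierCoeff_brownianLoop_le γ k

lemma lintegral_sobolevENorm_sq_loopMeasure_ne_top {s : ℝ} (hs : s < 1 / 2) :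
    ∫⁻ u, sobolevENorm s u ^ 2 ∂loopMeasure ≠ ∞ := by
  have hmeas : ∀ k : ℤ, Measurable fun γ => ‖loopCoeff γ k‖ₑ ^ 2 := fun k =>
    (continuous_loopCoeff k).measurable.enorm.pow_const 2
  rw [loopMeasure, lintegral_map ((measurable_sobolevENorm s).pow_const 2) measurable_brownianLoop]
  refine ne_top_of_le_ne_top ?_ (lintegral_mono (sobolevENorm_brownianLoop_sq_le s))
  rw [lintegral_tsum fun k => ((hmeas k).const_mul _).aemeasurable]
  simp only [lintegral_const_mul _ (hmeas _), lintegral_enorm_loopCoeff_sq]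
  simp only [← mul_assoc, ofReal_sobolevWeight_mul_enorm_sq]
  rw [ENNReal.tsum_mul_right]
  exact ENNReal.mul_ne_top (summable_sobolevWeight_mul_norm_invFreq_sq hs).tsum_ofReal_ne_top
    lintegral_enorm_sq_gaussianReal_prod_ne_top

lemma ae_sobolevENorm_ne_top {s : ℝ} (hs : s < 1 / 2) :
    ∀ᵐ u ∂loopMeasure, sobolevENorm s u ≠ ∞ := by
  filter_upwards [ae_lt_top ((measurable_sobolevENorm s).pow_const 2)
    (lintegral_sobolevENorm_sq_loopMeasure_ne_top hs)] with u hu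
  exact (ENNReal.pow_lt_top_iff.1 hu).resolve_right two_ne_zero |>.ne

/-! ### Compactness of Sobolev balls -/

lemma totallyBounded_of_approx {X : Type*} [PseudoMetricSpace X] {A : Set X}
    (h : ∀ ε > 0, ∃ B, TotallyBounded B ∧ ∀ x ∈ A, ∃ y ∈ B, dist x y < ε) : TotallyBounded A := by
  refine Metric.totallyBounded_iff.2 fun ε hε => ?_
  obtain ⟨B, hB, hAB⟩ := h (ε / 2) (half_pos hε)
  obtain ⟨t, ht, hBt⟩ := Metric.totallyBounded_iff.1 hB (ε / 2) (half_pos hε)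
  refine ⟨t, ht, fun x hx => ?_⟩
  obtain ⟨y, hy, hxy⟩ := hAB x hx
  obtain ⟨z, hz, hyz⟩ := Set.mem_iUnion₂.1 (hBt hy)
  exact Set.mem_iUnion₂.2 ⟨z, hz, Metric.mem_ball.2
    (by linarith [dist_triangle x y z, Metric.mem_ball.1 hyz])⟩

lemma fourierCoeff_sub_sum (u : LTwo) (J : Finset ℤ) (k : ℤ) :
    fourierCoeff (u - ∑ j ∈ J, fourierCoeff u j • (fourierLp 2 j : LTwo) : LTwo) k =
      if k ∈ J then 0 else fourierCoeff u k := by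
  classical
  rw [fourierCoeff_eq_inner, inner_sub_right, ← fourierCoeff_eq_inner, inner_sum]
  simp only [inner_smul_right, orthonormal_iff_ite.1 (orthonormal_fourier (T := 2 * Real.pi))]
  split_ifs with hk <;> simp [hk]

lemma mul_enorm_sub_sum_sq_le {s w : ℝ} {J : Finset ℤ} (hJ : ∀ k ∉ J, w ≤ sobolevWeight s k)
    (u : LTwo) :
    ENNReal.ofReal w * ‖u - ∑ j ∈ J, fourierCoeff u j • (fourierLp 2 j : LTwo)‖ₑ ^ 2 ≤
      sobolevENorm s u ^ 2 := by
  rw [← tsum_enorm_fourierCoeff_sq, ← ENNReal.tsum_mul_left, sobolevENorm_sq]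
  refine ENNReal.tsum_le_tsum fun k => ?_
  rw [fourierCoeff_sub_sum]
  split_ifs with hk
  · simp
  · gcongr
    exact hJ k hk

lemma norm_fourierCoeff_le (u : LTwo) (k : ℤ) : ‖fourierCoeff u k‖ ≤ ‖u‖ := by
  have h := norm_inner_le_norm (𝕜 := ℂ) (fourierLp 2 k : LTwo) u
  rwa [orthonormal_fourier.norm_eq_one, one_mul, ← fourierCoeff_eq_inner] at h

lemma isCompact_image_trigPolynomial (J : Finset ℤ) (R : ℝ) :
    IsCompact ((fun x : J → ℂ => ∑ k, x k • (fourierLp 2 (k : ℤ) : LTwo)) ''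
      Metric.closedBall 0 R) :=
  (isCompact_closedBall 0 R).image (by fun_prop)

lemma exists_finset_norm_sub_sum_lt {s : ℝ} (hs : 0 < s) {R : ℝ} (hR : 0 ≤ R) {ε : ℝ}
    (hε : 0 < ε) : ∃ J : Finset ℤ, ∀ u, sobolevENorm s u ≤ ENNReal.ofReal R →
      ‖u - ∑ j ∈ J, fourierCoeff u j • (fourierLp 2 j : LTwo)‖ < ε := by
  set w := (R / ε) ^ 2 + 1 with hw
  have hfin : {k | ¬ w ≤ sobolevWeight s k}.Finite :=
    (tendsto_sobolevWeight hs).eventually_ge_atTop w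
  refine ⟨hfin.toFinset, fun u hu => ?_⟩
  set d := ‖u - ∑ j ∈ hfin.toFinset, fourierCoeff u j • (fourierLp 2 j : LTwo)‖
  have hweight : ∀ k ∉ hfin.toFinset, w ≤ sobolevWeight s k := fun k hk => by simpa using hk
  have htail := (mul_enorm_sub_sum_sq_le hweight u).trans (pow_le_pow_left' hu 2)
  have htail_real : w * d ^ 2 ≤ R ^ 2 := by
    rwa [← ofReal_norm, ← ENNReal.ofReal_pow (norm_nonneg _), ← ENNReal.ofReal_mul (by positivity),
      ← ENNReal.ofReal_pow hR, ENNReal.ofReal_le_ofReal_iff (by positivity)] at htail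
  by_contra! hle
  have hsq : ε ^ 2 ≤ d ^ 2 := by gcongr
  have hlower : R ^ 2 + ε ^ 2 ≤ w * d ^ 2 :=
    calc R ^ 2 + ε ^ 2 = w * ε ^ 2 := by rw [hw]; field_simp
      _ ≤ w * d ^ 2 := by gcongr
  linarith [pow_pos hε 2]

lemma isCompact_closure_sobolevENorm_le {s : ℝ} (hs : 0 < s) {R : ℝ} (hR : 0 ≤ R) :
    IsCompact (closure {u | sobolevENorm s u ≤ ENNReal.ofReal R}) := by
  refine (TotallyBounded.closure (totallyBounded_of_approx fun ε hε => ?_)).isCompact_of_isClosed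
    isClosed_closure
  obtain ⟨J, hJ⟩ := exists_finset_norm_sub_sum_lt hs hR hε
  refine ⟨_, (isCompact_image_trigPolynomial J R).totallyBounded, fun u hu => ⟨_,
    ⟨fun k => fourierCoeff u k, ?_, rfl⟩, ?_⟩⟩
  · have hu_norm : ‖u‖ ≤ R := by
      have h := (enorm_le_sobolevENorm hs.le u).trans hu
      rwa [← ofReal_norm, ENNReal.ofReal_le_ofReal_iff hR] at h
    rw [mem_closedBall_zero_iff, pi_norm_le_iff_of_nonneg hR]
    exact fun k => (norm_fourierCoeff_le u k).trans hu_norm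
  · beta_reduce
    rw [dist_eq_norm, Finset.sum_coe_sort J fun j => fourierCoeff u j • (fourierLp 2 j : LTwo)]
    exact hJ u hu

/-! ### Multiplication by a Lipschitz cutoff -/

lemma abs_mul_sub_mul_le {a b x y : ℝ} (hy : |y| ≤ 1) :
    |b * y - a * x| ≤ |b - a| + |a| * |y - x| :=
  calc |b * y - a * x| = |(b - a) * y + a * (y - x)| := by ring_nf
    _ ≤ |b - a| * |y| + |a| * |y - x| := by
      rw [← abs_mul, ← abs_mul]
      exact abs_add_le _ _
    _ ≤ |b - a| + |a| * |y - x| := by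
      gcongr
      exact mul_le_of_le_one_right (abs_nonneg _) hy

lemma abs_mul_le_of_support_subset {E : Type*} {Ω K : Set E} {F χ : E → ℝ} {B : ℝ}
    (hF : ∀ x ∈ K, |F x| ≤ B) (hχ_supp : ∀ x ∈ Ω, χ x ≠ 0 → x ∈ K) {x : E}
    (hx : x ∈ Ω) : |F x * χ x| ≤ B * |χ x| := by
  rw [abs_mul]
  rcases eq_or_ne (χ x) 0 with h | h
  · simp [h]
  · gcongr
    exact hF x (hχ_supp x hx h)

section Mul

variable {H E : Type*} [NormedAddCommGroup H] [NormedSpace ℝ H] [NormedAddCommGroup E]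
  [NormedSpace ℝ E] {T : H →L[ℝ] E} {Ω : Set E} {F χ : E → ℝ} {κ : ℝ}

lemma CMLipschitz.congr {f g : E → ℝ} {L : ℝ} (h : CMLipschitz T Ω L f) (hfg : Set.EqOn f g Ω) :
    CMLipschitz T Ω L g := fun x hx c hc => by
  rw [← hfg hx, ← hfg hc]
  exact h x hx c hc

lemma CMSlopeLE.congr {f g : E → ℝ} {z : E} {a : ℝ} (h : CMSlopeLE T Ω f z a) (hz : z ∈ Ω)
    (hfg : Set.EqOn f g Ω) : CMSlopeLE T Ω g z a := fun ε hε => by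
  filter_upwards [h ε hε, self_mem_nhdsWithin] with c hc hcΩ
  rwa [← hfg hz, ← hfg hcΩ]

lemma CMSlopeLE.mul {z : E} {a : ℝ} (hF : CMSlopeLE T Ω F z a) (hz : z ∈ Ω)
    (hχ : CMLipschitz T Ω κ χ) (hχ_le : ∀ x, |χ x| ≤ 1) :
    CMSlopeLE T Ω (fun x => F x * χ x) z (a + |F z| * κ) := fun ε hε => by
  filter_upwards [hF ε hε, self_mem_nhdsWithin] with c hc hcΩ
  calc |F (z + T c) * χ (z + T c) - F z * χ z|
      ≤ |F (z + T c) - F z| + |F z| * |χ (z + T c) - χ z| := abs_mul_sub_mul_le (hχ_le _)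
    _ ≤ (a + ε) * ‖c‖ + |F z| * (κ * ‖c‖) := by gcongr; exact hχ z hz c hcΩ
    _ = (a + |F z| * κ + ε) * ‖c‖ := by ring

lemma cmLipschitz_mul_of_lipschitzOnWith {K : Set E} {L : NNReal} (hF : LipschitzOnWith L F K)
    {B : ℝ} (hB : 0 ≤ B) (hFB : ∀ x ∈ K, |F x| ≤ B) (hχ : CMLipschitz T Ω κ χ)
    (hχ_le : ∀ x, |χ x| ≤ 1) (hχ_supp : ∀ x ∈ Ω, χ x ≠ 0 → x ∈ K) :
    CMLipschitz T Ω (L * ‖T‖ + B * κ) fun x => F x * χ x := by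
  intro x hx c hc
  have hcut : B * |χ (x + T c) - χ x| ≤ B * (κ * ‖c‖) := by gcongr; exact hχ x hx c hc
  have hbound := fun {y} => abs_mul_le_of_support_subset hFB hχ_supp (x := y)
  suffices |F (x + T c) * χ (x + T c) - F x * χ x| ≤
      L * (‖T‖ * ‖c‖) + B * |χ (x + T c) - χ x| by linarith
  have hnonneg : 0 ≤ L * (‖T‖ * ‖c‖) := by positivity
  rcases eq_or_ne (χ x) 0 with hχx | hχx
  · rw [hχx, mul_zero, sub_zero, sub_zero]
    linarith [hbound hc]
  rcases eq_or_ne (χ (x + T c)) 0 with hχc | hχc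
  · rw [hχc, mul_zero, zero_sub, zero_sub, abs_neg, abs_neg]
    linarith [hbound hx]
  have hxK := hχ_supp x hx hχx
  refine (abs_mul_sub_mul_le (hχ_le _)).trans ?_
  gcongr
  · have h := hF.dist_le_mul _ (hχ_supp _ hc hχc) _ hxK
    rw [Real.dist_eq, dist_eq_norm, add_sub_cancel_left] at h
    exact h.trans (by gcongr; exact T.le_opNorm c)
  · exact hFB x hxK

end Mul

/-! ### Localization to compact sets -/

/-- A cutoff function that is `1` where the norm of `H^{1/4}` is at most `R`, and `0` where it is at
least `2 R`. The exponent `1 / 4` can be any number in `(0, 1 / 2)`: balls of `H^{1/4}` are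
relatively compact in `L²`, and the Brownian loop is in `H^{1/4}` almost surely. The subtraction is
truncated, so that the value is `0` outside of `H^{1/4}`. -/
def cutoff (R : ℝ) (u : LTwo) : ℝ :=
  (min 1 (2 - sobolevENorm (1 / 4) u / ENNReal.ofReal R)).toReal

lemma measurable_cutoff (R : ℝ) : Measurable (cutoff R) :=
  (measurable_const.min (measurable_const.sub
    ((measurable_sobolevENorm _).div_const _))).ennreal_toReal

lemma abs_cutoff_le_one (R : ℝ) (u : LTwo) : |cutoff R u| ≤ 1 := by
  rw [abs_of_nonneg (show 0 ≤ cutoff R u from ENNReal.toReal_nonneg)]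
  exact ENNReal.toReal_le_of_le_ofReal zero_le_one (by simp)

lemma sobolevENorm_le_of_cutoff_ne_zero {R : ℝ} (hR : 0 < R) {u : LTwo} (h : cutoff R u ≠ 0) :
    sobolevENorm (1 / 4) u ≤ ENNReal.ofReal (2 * R) := by
  contrapose! h
  have hle : 2 ≤ sobolevENorm (1 / 4) u / ENNReal.ofReal R := by
    rw [ENNReal.le_div_iff_mul_le (by simp [hR]) (by simp)]
    simpa [ENNReal.ofReal_mul] using h.le
  rw [cutoff, tsub_eq_zero_of_le hle, min_eq_right zero_le_one, ENNReal.toReal_zero]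

lemma cutoff_le_cutoff_add_cmEmbed {R : ℝ} (hR : 0 < R) (x : LTwo) (c : EllTwo) :
    cutoff R x ≤ cutoff R (x + cmEmbed c) + R⁻¹ * ‖c‖ := by
  have hnorm : sobolevENorm (1 / 4) (x + cmEmbed c) / ENNReal.ofReal R ≤
      sobolevENorm (1 / 4) x / ENNReal.ofReal R + ‖c‖ₑ / ENNReal.ofReal R := by
    rw [← ENNReal.add_div]
    gcongr
    exact (sobolevENorm_add_le _ _ _).trans
      (by gcongr; exact sobolevENorm_cmEmbed_le (by norm_num) c)
  have hsub : 2 - sobolevENorm (1 / 4) x / ENNReal.ofReal R ≤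
      2 - sobolevENorm (1 / 4) (x + cmEmbed c) / ENNReal.ofReal R + ‖c‖ₑ / ENNReal.ofReal R := by
    rw [tsub_le_iff_right, add_assoc, add_comm (‖c‖ₑ / _)]
    exact le_tsub_add.trans (by gcongr)
  have hmin : min 1 (2 - sobolevENorm (1 / 4) x / ENNReal.ofReal R) ≤
      min 1 (2 - sobolevENorm (1 / 4) (x + cmEmbed c) / ENNReal.ofReal R) +
        ‖c‖ₑ / ENNReal.ofReal R := by
    rw [← min_add_add_right]
    exact min_le_min le_self_add hsub
  refine (ENNReal.toReal_le_add hmin (by simp) (by simp [ENNReal.div_eq_top, hR])).trans_eq ?_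
  rw [ENNReal.toReal_div, toReal_enorm, ENNReal.toReal_ofReal hR.le, inv_mul_eq_div, cutoff]

lemma cmLipschitz_cutoff {R : ℝ} (hR : 0 < R) (Ω : Set LTwo) :
    CMLipschitz cmEmbed Ω R⁻¹ (cutoff R) := fun x _ c _ => by
  have hle := cutoff_le_cutoff_add_cmEmbed hR x c
  have hge := cutoff_le_cutoff_add_cmEmbed hR (x + cmEmbed c) (-c)
  rw [map_neg, add_neg_cancel_right, norm_neg] at hge
  rw [abs_le]
  constructor <;> linarith

lemma tendsto_cutoff {u : LTwo} (h : sobolevENorm (1 / 4) u ≠ ∞) :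
    Tendsto (fun n : ℕ => cutoff (n + 1) u) atTop (𝓝 1) := by
  obtain ⟨m, hm⟩ := ENNReal.exists_nat_gt h
  refine tendsto_const_nhds.congr' ?_
  filter_upwards [eventually_ge_atTop m] with n hn
  have hle : sobolevENorm (1 / 4) u / ENNReal.ofReal (n + 1) ≤ 1 := by
    refine ENNReal.div_le_of_le_mul ?_
    rw [one_mul]
    refine hm.le.trans ?_
    rw [← ENNReal.ofReal_natCast]
    gcongr
    exact_mod_cast hn.trans n.le_succ
  have hge : 1 ≤ 2 - sobolevENorm (1 / 4) u / ENNReal.ofReal (n + 1) := by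
    rw [← one_add_one_eq_two]
    exact ENNReal.le_sub_of_add_le_right (ne_top_of_le_ne_top ENNReal.one_ne_top hle) (by gcongr)
  rw [cutoff, min_eq_left hge, ENNReal.toReal_one]

/-- The localization of `F`, which vanishes outside of `Ω_N` and of a compact set. -/
def localize (N R : ℝ) (F : LTwo → ℝ) (u : LTwo) : ℝ := (Ball N).indicator F u * cutoff R u

section Localize

variable {N R : ℝ} {F : LTwo → ℝ}

lemma measurable_localize (hF : ContinuousOn F (Ball N)) : Measurable (localize N R F) := by
  classical
  have hind : Measurable ((Ball N).indicator F) := by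
    rw [← Set.piecewise_eq_indicator]
    exact hF.measurable_piecewise continuousOn_const (measurableSet_ball N)
  exact hind.mul (measurable_cutoff R)

lemma eqOn_localize : Set.EqOn (fun u => F u * cutoff R u) (localize N R F) (Ball N) :=
  fun u hu => by rw [localize, Set.indicator_of_mem hu]

lemma abs_localize_le (u : LTwo) : |localize N R F u| ≤ |F u| := by
  rw [localize, abs_mul]
  exact (mul_le_of_le_one_right (abs_nonneg _) (abs_cutoff_le_one R u)).trans
    (norm_indicator_le_norm_self F u)

lemma exists_isCompact_cutoff_ne_zero_subset (hR : 0 < R) (N : ℝ) :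
    ∃ K : Set LTwo, IsCompact K ∧ K ⊆ Ball N ∧ ∀ u ∈ Ball N, cutoff R u ≠ 0 → u ∈ K :=
  ⟨_, (isCompact_closure_sobolevENorm_le (s := 1 / 4) (by norm_num)
      (by positivity : 0 ≤ 2 * R)).inter_right (isClosed_ball N), Set.inter_subset_right,
    fun _ hu h => ⟨subset_closure (sobolevENorm_le_of_cutoff_ne_zero hR h), hu⟩⟩

lemma exists_abs_localize_le (hR : 0 < R) (hF : ContinuousOn F (Ball N)) :
    ∃ M, ∀ u, |localize N R F u| ≤ M := by
  obtain ⟨K, hK, hKN, hsupp⟩ := exists_isCompact_cutoff_ne_zero_subset hR N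
  obtain ⟨B, hB⟩ := hK.exists_bound_of_continuousOn (hF.mono hKN)
  refine ⟨max B 0, fun u => ?_⟩
  by_cases hu : u ∈ Ball N
  · rw [← eqOn_localize hu]
    refine (abs_mul_le_of_support_subset (fun x hx => (hB x hx).trans (le_max_left B 0)) hsupp
      hu).trans (mul_le_of_le_one_right (le_max_right B 0) (abs_cutoff_le_one R u))
  · simp [localize, hu]

lemma exists_cmLipschitz_localize (hR : 0 < R) (hF : LocallyLipschitzOn (Ball N) F) :
    ∃ L, CMLipschitz cmEmbed (Ball N) L (localize N R F) := by
  obtain ⟨K, hK, hKN, hsupp⟩ := exists_isCompact_cutoff_ne_zero_subset hR N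
  obtain ⟨L, hL⟩ := (hF.mono hKN).exists_lipschitzOnWith_of_compact hK
  obtain ⟨B, hB⟩ := hK.exists_bound_of_continuousOn hL.continuousOn
  exact ⟨_, (cmLipschitz_mul_of_lipschitzOnWith hL (le_max_right B 0)
    (fun x hx => (hB x hx).trans (le_max_left B 0))
    (cmLipschitz_cutoff hR _) (abs_cutoff_le_one R) hsupp).congr eqOn_localize⟩

lemma CMSlopeLE.localize (hR : 0 < R) {z : LTwo} (hz : z ∈ Ball N) {a : ℝ}
    (h : CMSlopeLE cmEmbed (Ball N) F z a) :
    CMSlopeLE cmEmbed (Ball N) (localize N R F) z (a + |F z| * R⁻¹) :=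
  (h.mul hz (cmLipschitz_cutoff hR _) (abs_cutoff_le_one R)).congr hz eqOn_localize

end Localize

/-! ### The logarithmic Sobolev inequality for locally Lipschitz functions -/

lemma tendsto_localize_ae_gibbs (N lam : ℝ) (F : LTwo → ℝ) :
    ∀ᵐ u ∂gibbs N lam, Tendsto (fun n : ℕ => localize N (n + 1) F u) atTop (𝓝 (F u)) := by
  have hreg : ∀ᵐ u ∂gibbs N lam, sobolevENorm (1 / 4) u ≠ ∞ :=
    gibbs_absolutelyContinuous_restrict.ae_le
      (ae_restrict_of_ae (ae_sobolevENorm_ne_top (by norm_num)))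
  filter_upwards [ae_mem_ball_gibbs, hreg] with u hu hu_reg
  simpa only [mul_one, eqOn_localize hu] using (tendsto_cutoff hu_reg).const_mul (F u)

theorem logSobolev_of_cmSlopeLE {N lam α : ℝ} (hN : 0 < N) (hlam : 0 ≤ lam) (hα : 0 < α)
    (hα_le : α ≤ 1 - Real.pi ^ 2 * (lam * N)) {F G : LTwo → ℝ}
    (hF : LocallyLipschitzOn (Ball N) F) (hF_memLp : MemLp F 2 (gibbs N lam))
    (hG_memLp : MemLp G 2 (gibbs N lam)) (hG_nonneg : ∀ z, 0 ≤ G z)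
    (hG : ∀ z ∈ Ball N, CMSlopeLE cmEmbed (Ball N) F z (G z)) : LogSobolev (gibbs N lam) α F G := by
  have : IsProbabilityMeasure (gibbs N lam) := isProbabilityMeasure_gibbs hN hlam (by linarith)
  have hpos : ∀ n : ℕ, (0 : ℝ) < n + 1 := fun n => by positivity
  have hG_le : ∀ (n : ℕ) z, |G z + |F z| * (n + 1 : ℝ)⁻¹| ≤ G z + |F z| := fun n z => by
    have hinv : (n + 1 : ℝ)⁻¹ ≤ 1 := inv_le_one_of_one_le₀ (by simp)
    rw [abs_of_nonneg (add_nonneg (hG_nonneg z) (by positivity))]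
    gcongr
    exact mul_le_of_le_one_right (abs_nonneg _) hinv
  have hG_lim : ∀ z, Tendsto (fun n : ℕ => G z + |F z| * (n + 1 : ℝ)⁻¹) atTop (𝓝 (G z)) :=
    fun z => by
      simpa using (tendsto_one_div_add_atTop_nhds_zero_nat.const_mul |F z|).const_add (G z)
  obtain ⟨hlog, hentropy⟩ := (cmPrekopaLeindler_gibbs hN.le hlam hα_le).entropy_sq_le_of_tendsto hα
    (strictConvex_ball hN.le) (measurableSet_ball N) ae_mem_ball_gibbs
    (fun n => measurable_localize hF.continuousOn)
    (fun n => exists_abs_localize_le (hpos n) hF.continuousOn)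
    (fun n => exists_cmLipschitz_localize (hpos n) hF)
    (fun n z hz => (hG z hz).localize (hpos n) hz)
    (fun n => hG_memLp.1.add (hF_memLp.abs.1.mul_const _)) (hG_memLp.add hF_memLp.abs)
    (fun n => ae_of_all _ fun z =>
      (abs_localize_le z).trans (le_add_of_nonneg_left (hG_nonneg z)))
    (fun n => ae_of_all _ (hG_le n)) (tendsto_localize_ae_gibbs N lam F) (ae_of_all _ hG_lim)
  have hF_int := hF_memLp.integrable_sq
  refine ⟨integrable_mul_log_div_integral (fun z => sq_nonneg _) hF_int hlog, ?_⟩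
  rwa [integral_mul_log_div_integral (fun z => sq_nonneg _) hF_int hlog]

/-! ### The metric slope of a locally Lipschitz function -/

section Slope

variable {N : ℝ} {F : LTwo → ℝ} {z : LTwo}

lemma comap_sobolevENorm_sub_le_nhds {s : ℝ} (hs : 0 ≤ s) (z : LTwo) :
    comap (fun v => sobolevENorm s (v - z)) (𝓝 0) ≤ 𝓝 z := by
  refine tendsto_id'.1 (tendsto_iff_edist_tendsto_0.2 ?_)
  refine tendsto_of_tendsto_of_tendsto_of_le_of_le tendsto_const_nhds tendsto_comap
    (fun _ => zero_le) fun v => ?_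
  rw [edist_eq_enorm_sub]
  exact enorm_le_sobolevENorm hs _

lemma slope_ne_top (hF : LocallyLipschitzOn (Ball N) F) (hz : z ∈ Ball N) : slope N F z ≠ ∞ := by
  obtain ⟨K, U, hU, hK⟩ := hF hz
  have hfilter : comap (fun v => sobolevENorm 1 (v - z)) (𝓝 0) ⊓ 𝓟 (Ball N \ {z}) ≤ 𝓝[Ball N] z :=
    inf_le_inf (comap_sobolevENorm_sub_le_nhds zero_le_one z) (principal_mono.2 Set.sdiff_subset)
  refine ne_top_of_le_ne_top (ENNReal.coe_ne_top (r := K))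
    (limsup_le_of_le (by isBoundedDefault) ?_)
  filter_upwards [hfilter hU] with v hv
  refine ENNReal.div_le_of_le_mul ?_
  calc ‖F v - F z‖ₑ = edist (F v) (F z) := (edist_eq_enorm_sub _ _).symm
    _ ≤ K * edist v z := hK hv (mem_of_mem_nhdsWithin hz hU)
    _ = K * ‖v - z‖ₑ := by rw [edist_eq_enorm_sub]
    _ ≤ K * sobolevENorm 1 (v - z) := by gcongr; exact enorm_le_sobolevENorm zero_le_one _

lemma tendsto_sobolevENorm_cmEmbed {s : ℝ} (hs : s ≤ 1) :
    Tendsto (fun c => sobolevENorm s (cmEmbed c)) (𝓝 0) (𝓝 0) :=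
  tendsto_of_tendsto_of_tendsto_of_le_of_le tendsto_const_nhds
    (by simpa using (continuous_enorm (E := EllTwo)).tendsto 0) (fun _ => zero_le)
    fun c => sobolevENorm_cmEmbed_le hs c

lemma eventually_enorm_sub_div_sobolevENorm_cmEmbed_lt {b : ℝ≥0∞} (hb : slope N F z < b) :
    ∀ᶠ c in 𝓝[(fun c => z + cmEmbed c) ⁻¹' Ball N] 0, cmEmbed c ≠ 0 →
      ‖F (z + cmEmbed c) - F z‖ₑ / sobolevENorm 1 (cmEmbed c) < b := by
  have hnear := eventually_inf_principal.1 (eventually_lt_of_limsup_lt hb)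
  have hlim : Tendsto (fun c => z + cmEmbed c) (𝓝[(fun c => z + cmEmbed c) ⁻¹' Ball N] 0)
      (comap (fun v => sobolevENorm 1 (v - z)) (𝓝 0)) := by
    rw [tendsto_comap_iff]
    simpa only [Function.comp_def, add_sub_cancel_left] using
      (tendsto_sobolevENorm_cmEmbed le_rfl).mono_left nhdsWithin_le_nhds
  filter_upwards [hlim.eventually hnear, self_mem_nhdsWithin] with c hc hcN hc0
  simpa only [add_sub_cancel_left] using hc ⟨hcN, by simpa using hc0⟩

lemma cmSlopeLE_slope (hF : LocallyLipschitzOn (Ball N) F) (hz : z ∈ Ball N) :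
    CMSlopeLE cmEmbed (Ball N) F z (slope N F z).toReal := by
  intro ε hε
  have htop := slope_ne_top hF hz
  have hlt := ENNReal.lt_add_right htop (ENNReal.ofReal_pos.2 hε).ne'
  filter_upwards [eventually_enorm_sub_div_sobolevENorm_cmEmbed_lt hlt] with c hc
  rcases eq_or_ne (cmEmbed c) 0 with h0 | h0
  · rw [h0, add_zero, sub_self, abs_zero]
    positivity
  have hpos : 0 < sobolevENorm 1 (cmEmbed c) :=
    (enorm_pos.2 h0).trans_le (enorm_le_sobolevENorm zero_le_one _)
  have hnorm : sobolevENorm 1 (cmEmbed c) ≤ ‖c‖ₑ := sobolevENorm_cmEmbed_le le_rfl c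
  have henorm : ‖F (z + cmEmbed c) - F z‖ₑ ≤ (slope N F z + ENNReal.ofReal ε) * ‖c‖ₑ := by
    have hdiv := (hc h0).le
    rw [ENNReal.div_le_iff hpos.ne' (ne_top_of_le_ne_top enorm_ne_top hnorm)] at hdiv
    exact hdiv.trans (by gcongr)
  rwa [← ENNReal.ofReal_toReal htop, ← ENNReal.ofReal_add ENNReal.toReal_nonneg hε.le,
    ← ofReal_norm, ← ofReal_norm, ← ENNReal.ofReal_mul (by positivity),
    ENNReal.ofReal_le_ofReal_iff (by positivity), Real.norm_eq_abs] at henorm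

end Slope

/-! ### The gradient of a differentiable function -/

lemma norm_invFreq_sq_le_sobolevWeight (k : ℤ) : ‖invFreq k‖ ^ 2 ≤ sobolevWeight (-1) k := by
  rcases eq_or_ne k 0 with rfl | hk
  · simp [invFreq, sobolevWeight_zero]
  · rw [sobolevWeight_of_ne_zero _ hk, norm_invFreq, mul_neg_one, Real.rpow_neg (abs_nonneg _),
      Real.rpow_two, inv_pow]

lemma norm_cmEmbed_repr_le (u : LTwo) :
    ‖cmEmbed (fourierBasis.repr u)‖ ≤ (sobolevENorm (-1) u).toReal := by
  have htop : sobolevENorm (-1) u ≠ ∞ :=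
    ne_top_of_le_ne_top enorm_ne_top (sobolevENorm_le_enorm (by norm_num) u)
  rw [← toReal_enorm, ENNReal.toReal_le_toReal enorm_ne_top htop,
    ← ENNReal.pow_le_pow_left_iff two_ne_zero, sobolevENorm_sq, ← tsum_enorm_fourierCoeff_sq]
  refine ENNReal.tsum_le_tsum fun k => ?_
  rw [fourierCoeff_cmEmbed, fourierBasis_repr, enorm_mul, mul_pow, ← ofReal_norm (invFreq k),
    ← ENNReal.ofReal_pow (norm_nonneg _)]
  gcongr
  exact norm_invFreq_sq_le_sobolevWeight k

lemma conj_invFreq (k : ℤ) : starRingEnd ℂ (invFreq k) = invFreq k := by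
  unfold invFreq
  split_ifs <;> simp

lemma inner_cmEmbed_repr (u : LTwo) (c : EllTwo) :
    inner ℂ (cmEmbed (fourierBasis.repr u)) (fourierBasis.repr.symm c) =
      inner ℂ u (cmEmbed c) := by
  rw [← fourierBasis.repr.inner_map_map, ← fourierBasis.repr.inner_map_map u,
    LinearIsometryEquiv.apply_symm_apply, lp.inner_eq_tsum, lp.inner_eq_tsum]
  refine tsum_congr fun k => ?_
  simp only [fourierBasis_repr, fourierCoeff_cmEmbed, RCLike.inner_apply, map_mul, conj_invFreq]
  ring

lemma real_inner_eq_re_inner (u v : LTwo) : inner ℝ u v = (inner ℂ u v).re := by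
  rw [L2.inner_def, L2.inner_def, ← RCLike.re_eq_complex_re,
    ← integral_re (L2.integrable_inner u v)]
  rfl

lemma abs_inner_cmEmbed_le (u : LTwo) (c : EllTwo) :
    |inner ℝ u (cmEmbed c)| ≤ (sobolevENorm (-1) u).toReal * ‖c‖ :=
  calc |inner ℝ u (cmEmbed c)|
      = |(inner ℂ (cmEmbed (fourierBasis.repr u)) (fourierBasis.repr.symm c)).re| := by
        rw [real_inner_eq_re_inner, inner_cmEmbed_repr]
    _ ≤ ‖inner ℂ (cmEmbed (fourierBasis.repr u)) (fourierBasis.repr.symm c)‖ :=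
        Complex.abs_re_le_norm _
    _ ≤ ‖cmEmbed (fourierBasis.repr u)‖ * ‖c‖ := by
        simpa only [LinearIsometryEquiv.norm_map] using
          norm_inner_le_norm (𝕜 := ℂ) (cmEmbed (fourierBasis.repr u)) (fourierBasis.repr.symm c)
    _ ≤ (sobolevENorm (-1) u).toReal * ‖c‖ := by gcongr; exact norm_cmEmbed_repr_le u

lemma cmSlopeLE_of_hasFDerivWithinAt {H E : Type*} [NormedAddCommGroup H] [NormedSpace ℝ H]
    [NormedAddCommGroup E] [NormedSpace ℝ E] {T : H →L[ℝ] E} {Ω : Set E} {g : E → ℝ} {z : E}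
    {g' : E →L[ℝ] ℝ} (hg : HasFDerivWithinAt g g' Ω z) {a : ℝ} (ha : ∀ c, |g' (T c)| ≤ a * ‖c‖) :
    CMSlopeLE T Ω g z a := by
  intro ε hε
  have hz : z + T 0 = z := by rw [map_zero, add_zero]
  have hcomp : HasFDerivWithinAt (fun c => g (z + T c)) (g' ∘L T) ((fun c => z + T c) ⁻¹' Ω) 0 :=
    HasFDerivWithinAt.comp (t := Ω) 0 (by rwa [hz])
      (T.hasFDerivAt.const_add z).hasFDerivWithinAt (Set.mapsTo_preimage _ _)
  filter_upwards [hcomp.isLittleO.def hε] with c hc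
  simp only [hz, sub_zero, ContinuousLinearMap.comp_apply, Real.norm_eq_abs] at hc
  calc |g (z + T c) - g z| ≤ |g (z + T c) - g z - g' (T c)| + |g' (T c)| := by
        simpa using abs_add_le (g (z + T c) - g z - g' (T c)) (g' (T c))
    _ ≤ ε * ‖c‖ + a * ‖c‖ := add_le_add hc (ha c)
    _ = (a + ε) * ‖c‖ := by ring

lemma cmSlopeLE_gradientWithin {Ω : Set LTwo} {F : LTwo → ℝ} {z : LTwo}
    (hF : DifferentiableWithinAt ℝ F Ω z) :
    CMSlopeLE cmEmbed Ω F z (sobolevENorm (-1) (gradientWithin F Ω z)).toReal :=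
  cmSlopeLE_of_hasFDerivWithinAt hF.hasGradientWithinAt.hasFDerivWithinAt
    (abs_inner_cmEmbed_le (gradientWithin F Ω z))

lemma locallyLipschitzOn_of_contDiffOn {E : Type*} [NormedAddCommGroup E] [NormedSpace ℝ E]
    {Ω : Set E} (hΩ : Convex ℝ Ω) {F : E → ℝ} (hF : ContDiffOn ℝ 1 F Ω) :
    LocallyLipschitzOn Ω F := fun z hz => (hF z hz).exists_lipschitzOnWith hΩ

end NLSGibbs

end

theorem proposition3p1_general (N lam α : ℝ) (hN : 0 < N) (h0 : 0 ≤ lam * N) (hα : 0 < α)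
    (hα_le : α ≤ 1 - Real.pi ^ 2 * (lam * N)) :
    MeasureTheory.IsProbabilityMeasure (NLSGibbs.gibbs N lam) ∧
    (∀ F : NLSGibbs.LTwo → ℝ, ContDiffOn ℝ 1 F (NLSGibbs.Ball N) →
      MeasureTheory.MemLp F 2 (NLSGibbs.gibbs N lam) →
      MeasureTheory.MemLp
        (fun u => (NLSGibbs.sobolevENorm (-1) (gradientWithin F (NLSGibbs.Ball N) u)).toReal) 2
        (NLSGibbs.gibbs N lam) →
      NLSGibbs.LogSobolev (NLSGibbs.gibbs N lam) α F
        (fun u => (NLSGibbs.sobolevENorm (-1) (gradientWithin F (NLSGibbs.Ball N) u)).toReal)) ∧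
    (∀ F : NLSGibbs.LTwo → ℝ, LocallyLipschitzOn (NLSGibbs.Ball N) F →
      MeasureTheory.MemLp F 2 (NLSGibbs.gibbs N lam) →
      MeasureTheory.MemLp (fun u => (NLSGibbs.slope N F u).toReal) 2 (NLSGibbs.gibbs N lam) →
      NLSGibbs.LogSobolev (NLSGibbs.gibbs N lam) α F
        (fun u => (NLSGibbs.slope N F u).toReal)) := by
  have hlam : 0 ≤ lam := nonneg_of_mul_nonneg_left h0 hN
  refine ⟨NLSGibbs.isProbabilityMeasure_gibbs hN hlam (by linarith),
    fun F hF hF_memLp hG_memLp => ?_, fun F hF hF_memLp hG_memLp => ?_⟩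
  · exact NLSGibbs.logSobolev_of_cmSlopeLE hN hlam hα hα_le
      (NLSGibbs.locallyLipschitzOn_of_contDiffOn (NLSGibbs.strictConvex_ball hN.le).convex hF)
      hF_memLp hG_memLp (fun _ => ENNReal.toReal_nonneg) fun z hz =>
        NLSGibbs.cmSlopeLE_gradientWithin (hF.differentiableOn one_ne_zero z hz)
  · exact NLSGibbs.logSobolev_of_cmSlopeLE hN hlam hα hα_le hF hF_memLp hG_memLp
      (fun _ => ENNReal.toReal_nonneg) fun z hz => NLSGibbs.cmSlopeLE_slope hF hz

theorem proposition3p1 (N lam : ℝ) (hN : 0 < N) (h0 : 0 ≤ lam * N)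
    (h1 : lam * N < 3 / (14 * Real.pi ^ 2)) :
    MeasureTheory.IsProbabilityMeasure (NLSGibbs.gibbs N lam) ∧
    -- `C¹` functions on the ball, with the `H⁻¹` norm of the gradient
    (∀ F : NLSGibbs.LTwo → ℝ, ContDiffOn ℝ 1 F (NLSGibbs.Ball N) →
      MeasureTheory.MemLp F 2 (NLSGibbs.gibbs N lam) →
      MeasureTheory.MemLp
        (fun u => (NLSGibbs.sobolevENorm (-1) (gradientWithin F (NLSGibbs.Ball N) u)).toReal) 2
        (NLSGibbs.gibbs N lam) →
      NLSGibbs.LogSobolev (NLSGibbs.gibbs N lam) (1 - 14 * Real.pi ^ 2 * N * lam / 3) F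
        (fun u => (NLSGibbs.sobolevENorm (-1) (gradientWithin F (NLSGibbs.Ball N) u)).toReal)) ∧
    -- locally Lipschitz functions on the ball, with the metric norm of the gradient
    (∀ F : NLSGibbs.LTwo → ℝ, LocallyLipschitzOn (NLSGibbs.Ball N) F →
      MeasureTheory.MemLp F 2 (NLSGibbs.gibbs N lam) →
      MeasureTheory.MemLp (fun u => (NLSGibbs.slope N F u).toReal) 2 (NLSGibbs.gibbs N lam) →
      NLSGibbs.LogSobolev (NLSGibbs.gibbs N lam) (1 - 14 * Real.pi ^ 2 * N * lam / 3) F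
        (fun u => (NLSGibbs.slope N F u).toReal)) := by
  have hlt : lam * N * (14 * Real.pi ^ 2) < 3 := (lt_div_iff₀ (by positivity)).1 h1
  have hle : Real.pi ^ 2 * (lam * N) ≤ 14 * Real.pi ^ 2 * N * lam / 3 := by
    nlinarith [mul_nonneg (sq_nonneg Real.pi) h0]
  exact proposition3p1_general N lam _ hN h0 (by linarith) (by linarith)
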